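/- Let $T>0$ and let $S_T$ be the circle of circumference $T$. For a $T$-periodic $f\in L^2(S_T)$ let $\hat f_j=\int_{-T/2}^{T/2} f\,\overline{e_j}\,dx$ with $e_j(x)=T^{-1/2}e^{-2\pi i jx/T}$, and let $H_1(S_T)$ be the space of those $f$ with $\|f\|_{H_1}^2=\sum_{j\in\mathbb Z}\bigl(1+\tfrac{4\pi^2j^2}{T^2}\bigr)|\hat f_j|^2<\infty$. Assume: (H1) $V:\mathbb R\to\mathbb R$ is smooth and $T$-periodic; (H2) $\zeta:\mathbb R\to\mathbb R$ is even and $\zeta\ge 0$; (H3) $\zeta\in L^1(\mathbb R)$ and $\int_{\mathbb R}\zeta\,dx=1$; (H4) $x\zeta(x)\in L^1(\mathbb R)$; (H5) there are constants $M$ and $\delta>0$ such that $\bigl|\int_{\mathbb R} e^{-i\xi x}\zeta(x)\,dx\bigr|\le M(1+|\xi|)^{-1/2-\delta}$ for all $\xi\in\mathbb R$. For $\varepsilon>0$ put $R_\varepsilon(x)=\frac1\varepsilon\zeta(\frac x\varepsilon)$ and consider the nonlocal repulsive Gross-Pitaevskii equation $$i\partial_t\psi=-\tfrac12\partial_x^2\psi+\psi(x)\int_{\mathbb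 R}R_\varepsilon(x-y)|\psi(y)|^2\,dy+V\psi;$$ for $\varepsilon=0$ consider the local equation $i\partial_t\psi=-\frac12\partial_x^2\psi+|\psi|^2\psi+V\psi$. A solution on a time interval $J$ is a $\psi\in C(J;H_1(S_T))$ (each $\psi(\cdot,t)$ being identified with its continuous representative) that satisfies the equation weakly in $x$, i.e. against every smooth $T$-periodic test function, for every $t\in J$. Let $C>0$. Then there is a constant $C_u>0$ such that the following holds for every family $(\psi_{0,\varepsilon})_{\varepsilon\ge0}$ in $H_1(S_T)$ with $\|\psi_{0,\varepsilon}\|_{H_1}\le C$ for all $\varepsilon\ge0$ and $\|\psi_{0,\varepsilon}-\psi_{0,0}\|_{H_1}\to0$ as $\varepsilon\to0^+$. (a) For every $\varepsilon\ge0$ there is a solution $\psi_\varepsilon$ on $[0,\infty)$ with initial value $\psi_{0,\varepsilon}$; for every $\tilde T>0$ it is on $[0,\tilde T]$ the only solution with this initial value; and $\|\psi_\varepsilon(\cdot,t)\|_{H_1}\le C_u$ for all $t\ge0$. Write $\psi=\psi_0$ for the solution of the local equation. (b) There is a function $\varrho(\tilde T;\varepsilon,\varepsilon')$ with $\lim_{\varepsilon\to\varepsilon'}\varrho(\tilde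 T;\varepsilon,\varepsilon')=0$ for all $\tilde T>0$ and $\varepsilon'\ge0$ (the limit being taken over $\varepsilon\ge0$), such that for every $\tilde T>0$, every $\varepsilon\ge0$ and every $t\in[0,\tilde T]$ $$\|\psi_\varepsilon(\cdot,t)-\psi(\cdot,t)\|_{L^\infty(S_T)}\le\bigl(\|\psi_{0,\varepsilon}-\psi_{0,0}\|_{H_1}+3C_u\tilde T\varrho(\tilde T;\varepsilon,0)\bigr)e^{3C_u^2\tilde T}.$$ (c) Consequently, for every $\tilde T>0$, $\psi_\varepsilon\to\psi$ uniformly on $\mathbb R\times[0,\tilde T]$ as $\varepsilon\to0^+$. -/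

import Mathlib

open Set Filter Topology MeasureTheory
open scoped ContDiff

noncomputable section

namespace GP

/-- The orthonormal Fourier basis of `L²(S_T)`: `e_j(x) = T^{-1/2} exp(-2πijx/T)`. -/
def e (T : ℝ) (j : ℤ) (x : ℝ) : ℂ :=
  (1 / Real.sqrt T : ℝ) * Complex.exp (-(2 * Real.pi * Complex.I * j * x / T))

/-- The Fourier coefficient of a `T`-periodic function with respect to `e T j`. -/
def fourierCoef (T : ℝ) (f : ℝ → ℂ) (j : ℤ) : ℂ :=
  ∫ x in (-(T / 2))..(T / 2), f x * (starRingEnd ℂ) (e T j x)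

/-- The weight `1 + 4π²j²/T²`. -/
def weight (T : ℝ) (j : ℤ) : ℝ := 1 + 4 * Real.pi ^ 2 * (j : ℝ) ^ 2 / T ^ 2

/-- `f` is a `T`-periodic function that belongs to the Sobolev space `H_s(S_T)`. -/
structure MemHs (T s : ℝ) (f : ℝ → ℂ) : Prop where
  periodic : Function.Periodic f T
  memLp : MemLp f 2 (volume.restrict (Ioc (-(T / 2)) (T / 2)))
  summable : Summable fun j : ℤ => weight T j ^ s * ‖fourierCoef T f j‖ ^ 2

/-- The norm of `H_s(S_T)` (meaningful for `f` with `MemHs T s f`). -/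
def hsNorm (T s : ℝ) (f : ℝ → ℂ) : ℝ :=
  Real.sqrt (∑' j : ℤ, weight T j ^ s * ‖fourierCoef T f j‖ ^ 2)

/-- The rescaled kernel `R(x; ε) = ζ(x / ε) / ε`, for `ε > 0`. -/
def kernel (ζ : ℝ → ℝ) (ε x : ℝ) : ℝ := 1 / ε * ζ (x / ε)

/-- The interaction potential of the wave function `f`: the convolution over the real line
`∫ R(x - y; ε) |f(y)|² dy` for `ε ≠ 0` (nonlocal equation), and `|f(x)|²` for `ε = 0`
(local equation). -/
def interaction (ζ : ℝ → ℝ) (ε : ℝ) (f : ℝ → ℂ) (x : ℝ) : ℝ :=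
  if ε = 0 then ‖f x‖ ^ 2 else ∫ y, kernel ζ ε (x - y) * ‖f y‖ ^ 2

/-- The Fourier transform `∫ exp(-iξx) ζ(x) dx`. -/
def fourierTransform (ζ : ℝ → ℝ) (ξ : ℝ) : ℂ :=
  ∫ x : ℝ, Complex.exp (-(Complex.I * ξ * x)) * (ζ x : ℂ)

/-- `u` (a function of `t` and `x`) is, on the time interval `J ∋ 0`, a `T`-periodic solution in
`C(J; H_1(S_T))`, with initial value `u₀`, of
`i ∂ₜ u = -½ ∂ₓ² u + α u · interaction ζ ε u + V u`,
the equation being understood weakly in `x`, against smooth `T`-periodic test functions.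
Each `u t` is the continuous representative of its class in `H_1(S_T)`. -/
structure IsSolutionOn (T α : ℝ) (V ζ : ℝ → ℝ) (ε : ℝ) (J : Set ℝ) (u₀ : ℝ → ℂ)
    (u : ℝ → ℝ → ℂ) : Prop where
  continuous_space : ∀ t ∈ J, Continuous (u t)
  memHs : ∀ t ∈ J, MemHs T 1 (u t)
  continuous_time : ∀ t ∈ J, Tendsto (fun s => hsNorm T 1 (u s - u t)) (𝓝[J] t) (𝓝 0)
  initial : u 0 =ᵐ[volume] u₀
  equation : ∀ φ : ℝ → ℂ, ContDiff ℝ ∞ φ → Function.Periodic φ T → ∀ t ∈ J,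
    HasDerivWithinAt (fun s => ∫ x in (-(T / 2))..(T / 2), u s x * φ x)
      (-Complex.I * ∫ x in (-(T / 2))..(T / 2),
        (-(1 / 2) * u t x * iteratedDeriv 2 φ x
          + α * u t x * (interaction ζ ε (u t) x : ℂ) * φ x
          + (V x : ℂ) * u t x * φ x)) J t

end GP

end

noncomputable section

namespace GP

/-! Write `u` through the sequence `b j = √(weight T j) * fourierCoef T u j`. Then `H_1(S_T)`
becomes `ℓ²(ℤ)`, with `halfSmooth b` carrying the `L²` size of `u` and `smooth b` its `H_{-1}` size.
The equation reads `i b' = λ b / 2 + Φ b` with `λ = laplaceSymbol T` and `Φ = gpField T ζ V ε`. The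
only unbounded term is diagonal. It is removed by passing to `v t = freeEvol (-t) (b t)`, which
solves an ordinary differential equation in `ℓ²(ℤ)`. Its field is locally Lipschitz because
`H_1(S_T)` is an algebra and convolution with the kernel is a Fourier multiplier of modulus at most
1. The substitution `y = x - εz` turns the interaction into `conv ζ ε |u|²`, which is `|u|²` at `ε =
0`; so the local equation is a member of the same family and needs no separate treatment.

Global existence follows from conservation of mass and energy. The solution is only differentiable
in `H_{-1}`, so the energy cannot be differentiated naively. However, the potential energy has an
expansion whose remainder is quadratic in `L²`, and `‖·‖_{L²}² ≤ ‖·‖_{H_1} ‖·‖_{H_{-1}}` makes that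
remainder `o(s - t)` along a solution (`IsInteractionSol.hasDerivWithinAt_potential`). Since the
interaction is nonnegative, the energy bounds the `H_1` norm uniformly in time and in `ε`
(`IsInteractionSol.norm_le`). Weak solutions and solutions in the interaction picture correspond to
each other (`IsInteractionSol.isSolutionOn`, `IsSolutionOn.isInteractionSol`), so uniqueness for the
differential equation is uniqueness for weak solutions.

For the limit `ε → 0`, two solutions are compared in `L²` by Grönwall's inequality. The change of
kernel costs a multiple of `|ε - ε'|`, because `conv ζ ε` is Lipschitz in `ε` from `H_1` to `L²`
with constant the first absolute moment of `ζ` (`IsProfile.integral_norm_conv_sub_sq_le`). The `L²`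
distance is then interpolated with the uniform `H_1` bound to give the uniform distance
(`norm_synthesis_le_interp`). The function `ρ` is this estimate of the uniform distance divided by
`3 C_u τ`; it may depend on the family of initial values, and the term with `ρ` alone dominates the
difference. -/

/-- The Hilbert space `ℓ²(ℤ; ℂ)`. -/
abbrev Seq : Type := lp (fun _ : ℤ => ℂ) 2

/-! ### Diagonal operators and coordinatewise differentiation in `ℓ²(ℤ)`. -/

theorem Seq.hasSum_norm_sq (b : Seq) : HasSum (fun j => ‖b j‖ ^ 2) (‖b‖ ^ 2) := by
  have := lp.hasSum_norm (p := 2) (by norm_num) b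
  simpa using this

theorem Seq.norm_sq_eq (b : Seq) : ‖b‖ ^ 2 = ∑' j, ‖b j‖ ^ 2 := (Seq.hasSum_norm_sq b).tsum_eq.symm

theorem memℓp_two_of_summable {a : ℤ → ℂ} (h : Summable fun j => ‖a j‖ ^ 2) : Memℓp a 2 :=
  memℓp_gen (by simpa using h)

theorem Seq.norm_le_of_forall_sum_le {b : Seq} {A : ℝ} (hA : 0 ≤ A)
    (h : ∀ s : Finset ℤ, ∑ j ∈ s, ‖b j‖ ^ 2 ≤ A ^ 2) : ‖b‖ ≤ A :=
  lp.norm_le_of_forall_sum_le (by norm_num) hA (by simpa using h)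

theorem Seq.norm_le_of_norm_coord_le {b c : Seq} (h : ∀ j, ‖b j‖ ≤ ‖c j‖) : ‖b‖ ≤ ‖c‖ := by
  refine Seq.norm_le_of_forall_sum_le (norm_nonneg _) fun s => ?_
  refine (Finset.sum_le_sum fun j _ => pow_le_pow_left₀ (norm_nonneg _) (h j) 2).trans ?_
  exact sum_le_hasSum s (fun _ _ => by positivity) (Seq.hasSum_norm_sq c)

/-- The diagonal operator on `ℓ²(ℤ)` with symbol `m`, where `|m| ≤ 1`. -/
def diagOp (m : ℤ → ℂ) (hm : ∀ j, ‖m j‖ ≤ 1) : Seq →L[ℂ] Seq :=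
  LinearMap.mkContinuous
    { toFun := fun b => ⟨fun j => m j * b j, memℓp_two_of_summable <|
        Summable.of_nonneg_of_le (fun _ => by positivity) (fun j => by
          rw [norm_mul]
          exact pow_le_pow_left₀ (by positivity)
            (mul_le_of_le_one_left (norm_nonneg _) (hm j)) 2) (Seq.hasSum_norm_sq b).summable⟩
      map_add' := fun b c => lp.ext (funext fun j => mul_add (m j) (b j) (c j))
      map_smul' := fun a b => lp.ext (funext fun j => mul_left_comm (m j) a (b j)) }
    1 (fun b => by
      rw [one_mul]
      refine Seq.norm_le_of_norm_coord_le fun j => ?_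
      change ‖m j * b j‖ ≤ _
      rw [norm_mul]
      exact mul_le_of_le_one_left (norm_nonneg _) (hm j))

@[simp] theorem diagOp_apply (m : ℤ → ℂ) (hm : ∀ j, ‖m j‖ ≤ 1) (b : Seq) (j : ℤ) :
    diagOp m hm b j = m j * b j := rfl

theorem norm_diagOp_le (m : ℤ → ℂ) (hm : ∀ j, ‖m j‖ ≤ 1) (b : Seq) : ‖diagOp m hm b‖ ≤ ‖b‖ := by
  refine Seq.norm_le_of_norm_coord_le fun j => ?_
  rw [diagOp_apply, norm_mul]
  exact mul_le_of_le_one_left (norm_nonneg _) (hm j)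

theorem norm_diagOp_of_norm_eq_one (m : ℤ → ℂ) (hm : ∀ j, ‖m j‖ ≤ 1) (h : ∀ j, ‖m j‖ = 1)
    (b : Seq) : ‖diagOp m hm b‖ = ‖b‖ :=
  le_antisymm (norm_diagOp_le m hm b)
    (Seq.norm_le_of_norm_coord_le fun j => by rw [diagOp_apply, norm_mul, h, one_mul])

theorem inner_diagOp_right (m : ℤ → ℂ) (hm : ∀ j, ‖m j‖ ≤ 1) (b c : Seq) :
    inner ℂ b (diagOp m hm c) =
      inner ℂ (diagOp (fun j => (starRingEnd ℂ) (m j)) (fun j => by simpa using hm j) b) c := by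
  rw [lp.inner_eq_tsum, lp.inner_eq_tsum]
  refine tsum_congr fun j => ?_
  simp [mul_comm, mul_left_comm, mul_assoc]

/-- The restriction of a sequence to a finite set of indices. -/
def truncOp (s : Finset ℤ) : Seq →L[ℂ] Seq :=
  diagOp (fun j => if j ∈ s then 1 else 0) (fun j => by split_ifs <;> simp)

theorem truncOp_eq_sum (s : Finset ℤ) (b : Seq) :
    truncOp s b = ∑ j ∈ s, b j • lp.single 2 j (1 : ℂ) := by
  refine lp.ext (funext fun k => ?_)
  rw [lp.coeFn_sum, Finset.sum_apply]
  simp [truncOp, lp.coeFn_smul, Pi.single_apply]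

theorem Seq.norm_le_of_norm_truncOp_le {b : Seq} {A : ℝ} (hA : 0 ≤ A)
    (h : ∀ s : Finset ℤ, ‖truncOp s b‖ ≤ A) : ‖b‖ ≤ A := by
  refine Seq.norm_le_of_forall_sum_le hA fun s => ?_
  refine le_trans ?_ (pow_le_pow_left₀ (norm_nonneg _) (h s) 2)
  refine le_trans (Finset.sum_le_sum fun j hj => ?_)
    (sum_le_hasSum s (fun _ _ => by positivity) (Seq.hasSum_norm_sq (truncOp s b)))
  simp [truncOp, hj]

/-- A curve in `ℓ²(ℤ)` whose coordinates are differentiable on a convex set is differentiable as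
soon as the coordinatewise derivative is a continuous curve in `ℓ²(ℤ)`. -/
theorem hasDerivWithinAt_of_coord {J : Set ℝ} (hJ : Convex ℝ J) {c g : ℝ → Seq}
    (hg : ContinuousOn g J)
    (h : ∀ j, ∀ t ∈ J, HasDerivWithinAt (fun s => c s j) (g t j) J t) {t : ℝ} (ht : t ∈ J) :
    HasDerivWithinAt c (g t) J t := by
  rw [hasDerivWithinAt_iff_isLittleO, Asymptotics.isLittleO_iff]
  intro η hη
  have hgt := Metric.continuousWithinAt_iff.1 (hg t ht) η hη
  obtain ⟨r, hr, hgr⟩ := hgt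
  have hmem : J ∩ Metric.ball t r ∈ 𝓝[J] t :=
    inter_mem_nhdsWithin _ (Metric.ball_mem_nhds t hr)
  filter_upwards [hmem] with s hs
  -- On finitely many coordinates the mean value inequality applies, with a constant `η` and a
  -- radius `r` that do not depend on the truncation `F`; the estimate therefore survives in the
  -- full norm.
  refine Seq.norm_le_of_norm_truncOp_le (by positivity) fun F => ?_
  have hconv : Convex ℝ (J ∩ Metric.ball t r) := hJ.inter (convex_ball t r)
  have hder : ∀ x ∈ J ∩ Metric.ball t r,
      HasDerivWithinAt (fun x => truncOp F (c x) - x • truncOp F (g t))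
        (truncOp F (g x) - truncOp F (g t)) (J ∩ Metric.ball t r) x := by
    intro x hx
    refine HasDerivWithinAt.sub ?_ ?_
    · simp only [truncOp_eq_sum]
      refine HasDerivWithinAt.fun_sum fun j _ => ?_
      exact ((h j x hx.1).mono inter_subset_left).smul_const _
    · simpa using (hasDerivWithinAt_id x _).smul_const (truncOp F (g t))
  have key := hconv.norm_image_sub_le_of_norm_hasDerivWithin_le (C := η) hder (fun x hx => by
    rw [← map_sub]
    refine (norm_diagOp_le _ _ _).trans ?_
    rw [← dist_eq_norm]
    exact (hgr hx.1 hx.2).le) ⟨ht, Metric.mem_ball_self hr⟩ hs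
  refine le_of_eq_of_le (congrArg _ ?_) key
  rw [map_sub, map_sub, ContinuousLinearMap.map_smul_of_tower, sub_smul]
  abel

/-! ### The free Schrödinger group and the smoothing operators. -/

section Evolution

variable (lam : ℤ → ℝ)

/-- The free Schrödinger group: multiplication by `exp (-i λ_j t / 2)`. -/
def freeEvol (t : ℝ) : Seq →L[ℂ] Seq :=
  diagOp (fun j => Complex.exp ((-(lam j * t / 2) : ℝ) * Complex.I))
    (fun _ => (Complex.norm_exp_ofReal_mul_I _).le)

theorem freeEvol_apply (t : ℝ) (b : Seq) (j : ℤ) :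
    freeEvol lam t b j = Complex.exp ((-(lam j * t / 2) : ℝ) * Complex.I) * b j := rfl

theorem norm_freeEvol (t : ℝ) (b : Seq) : ‖freeEvol lam t b‖ = ‖b‖ :=
  norm_diagOp_of_norm_eq_one _ _ (fun _ => Complex.norm_exp_ofReal_mul_I _) b

theorem freeEvol_zero (b : Seq) : freeEvol lam 0 b = b :=
  lp.ext (funext fun j => by simp [freeEvol_apply])

theorem freeEvol_freeEvol_neg (t : ℝ) (b : Seq) : freeEvol lam t (freeEvol lam (-t) b) = b := by
  refine lp.ext (funext fun j => ?_)
  rw [freeEvol_apply, freeEvol_apply, ← mul_assoc, ← Complex.exp_add, ← add_mul,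
    ← Complex.ofReal_add]
  simp only [mul_neg, neg_div, neg_neg, neg_add_cancel, Complex.ofReal_zero, zero_mul,
    Complex.exp_zero, one_mul]

theorem inner_freeEvol_left (t : ℝ) (b c : Seq) :
    inner ℂ (freeEvol lam t b) c = inner ℂ b (freeEvol lam (-t) c) := by
  nth_rw 1 [← freeEvol_freeEvol_neg lam t c]
  exact LinearIsometry.inner_map_map ⟨(freeEvol lam t).toLinearMap, norm_freeEvol lam t⟩ _ _

/-- Only strong continuity is available, since `lam` may be unbounded; it is dominated convergence
in the sum of squares. -/
theorem continuous_freeEvol (b : Seq) : Continuous fun t => freeEvol lam t b := by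
  rw [continuous_iff_continuousAt]
  intro t₀
  rw [ContinuousAt, tendsto_iff_norm_sub_tendsto_zero]
  have h : Tendsto (fun t => ‖freeEvol lam t b - freeEvol lam t₀ b‖ ^ 2) (𝓝 t₀) (𝓝 0) := by
    simp only [Seq.norm_sq_eq]
    rw [show (0 : ℝ) = ∑' _ : ℤ, (0 : ℝ) by simp]
    refine tendsto_tsum_of_dominated_convergence (bound := fun j => (2 * ‖b j‖) ^ 2)
      ?_ (fun j => ?_) (Eventually.of_forall fun t j => ?_)
    · simp only [mul_pow]
      exact (Seq.hasSum_norm_sq b).summable.mul_left _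
    · have hc : Continuous fun t => ‖(freeEvol lam t b - freeEvol lam t₀ b) j‖ ^ 2 := by
        simp only [lp.coeFn_sub, Pi.sub_apply, freeEvol_apply]
        fun_prop
      simpa using hc.tendsto t₀
    · rw [Real.norm_of_nonneg (by positivity)]
      refine pow_le_pow_left₀ (norm_nonneg _) ?_ 2
      rw [lp.coeFn_sub, Pi.sub_apply]
      refine (norm_sub_le _ _).trans ?_
      rw [freeEvol_apply, freeEvol_apply, norm_mul, norm_mul, Complex.norm_exp_ofReal_mul_I,
        Complex.norm_exp_ofReal_mul_I]
      linarith
  simpa using h.sqrt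

/-- Strong continuity of the group suffices for joint continuity because every `freeEvol` is an
isometry. -/
theorem continuousOn_freeEvol {J : Set ℝ} {τ : ℝ → ℝ} (hτ : Continuous τ) {g : ℝ → Seq}
    (hg : ContinuousOn g J) : ContinuousOn (fun t => freeEvol lam (τ t) (g t)) J := by
  intro t ht
  rw [ContinuousWithinAt, tendsto_iff_norm_sub_tendsto_zero]
  have h1 : Tendsto (fun s => ‖g s - g t‖) (𝓝[J] t) (𝓝 0) :=
    tendsto_iff_norm_sub_tendsto_zero.1 (hg t ht)
  have h2 : Tendsto (fun s => ‖freeEvol lam (τ s) (g t) - freeEvol lam (τ t) (g t)‖)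
      (𝓝[J] t) (𝓝 0) :=
    (tendsto_iff_norm_sub_tendsto_zero.1
      (((continuous_freeEvol lam (g t)).comp hτ).tendsto t)).mono_left nhdsWithin_le_nhds
  refine squeeze_zero (fun _ => norm_nonneg _) (fun s => ?_) (by simpa using h1.add h2)
  rw [← norm_freeEvol lam (τ s) (g s - g t), map_sub]
  exact norm_sub_le_norm_sub_add_norm_sub _ _ _

variable {lam} (hlam : ∀ j, 0 ≤ lam j)

theorem norm_inv_one_add_le (hlam : ∀ j, 0 ≤ lam j) (j : ℤ) : ‖(((1 + lam j)⁻¹ : ℝ) : ℂ)‖ ≤ 1 := by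
  have := hlam j
  rw [Complex.norm_real, Real.norm_of_nonneg (by positivity)]
  exact inv_le_one_of_one_le₀ (by linarith)

theorem norm_inv_sqrt_one_add_le (hlam : ∀ j, 0 ≤ lam j) (j : ℤ) :
    ‖(((√(1 + lam j))⁻¹ : ℝ) : ℂ)‖ ≤ 1 := by
  have := hlam j
  rw [Complex.norm_real, Real.norm_of_nonneg (by positivity)]
  exact inv_le_one_of_one_le₀ (by rw [Real.one_le_sqrt]; linarith)

/-- The operator `(1 + λ)⁻¹`. -/
def smooth : Seq →L[ℂ] Seq :=
  diagOp (fun j => (((1 + lam j)⁻¹ : ℝ) : ℂ)) (norm_inv_one_add_le hlam)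

/-- The operator `(1 + λ)^(-1/2)`. -/
def halfSmooth : Seq →L[ℂ] Seq :=
  diagOp (fun j => (((√(1 + lam j))⁻¹ : ℝ) : ℂ)) (norm_inv_sqrt_one_add_le hlam)

theorem smooth_apply (b : Seq) (j : ℤ) : smooth hlam b j = (((1 + lam j)⁻¹ : ℝ) : ℂ) * b j := rfl

theorem halfSmooth_apply (b : Seq) (j : ℤ) :
    halfSmooth hlam b j = (((√(1 + lam j))⁻¹ : ℝ) : ℂ) * b j := rfl

theorem halfSmooth_halfSmooth (b : Seq) : halfSmooth hlam (halfSmooth hlam b) = smooth hlam b := by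
  refine lp.ext (funext fun j => ?_)
  have := hlam j
  rw [halfSmooth_apply, halfSmooth_apply, smooth_apply, ← mul_assoc, ← Complex.ofReal_mul,
    ← mul_inv, Real.mul_self_sqrt (by linarith)]

theorem inner_halfSmooth_right (b c : Seq) :
    inner ℂ b (halfSmooth hlam c) = inner ℂ (halfSmooth hlam b) c := by
  rw [halfSmooth, inner_diagOp_right]
  simp

theorem inner_smooth_right (b c : Seq) :
    inner ℂ b (smooth hlam c) = inner ℂ (smooth hlam b) c := by
  rw [smooth, inner_diagOp_right]
  simp

/-- For `lam = laplaceSymbol T` this identifies pairing with `smooth` in `H_1` coordinates as the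
`L²` inner product of the functions. -/
theorem inner_smooth_eq (b c : Seq) :
    inner ℂ b (smooth hlam c) = inner ℂ (halfSmooth hlam b) (halfSmooth hlam c) := by
  rw [← halfSmooth_halfSmooth, inner_halfSmooth_right]

theorem freeEvol_smooth (t : ℝ) (b : Seq) :
    freeEvol lam t (smooth hlam b) = smooth hlam (freeEvol lam t b) :=
  lp.ext (funext fun j => by
    simp only [freeEvol_apply, smooth_apply]
    exact mul_left_comm _ _ _)

theorem freeEvol_halfSmooth (t : ℝ) (b : Seq) :
    freeEvol lam t (halfSmooth hlam b) = halfSmooth hlam (freeEvol lam t b) :=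
  lp.ext (funext fun j => by
    simp only [freeEvol_apply, halfSmooth_apply]
    exact mul_left_comm _ _ _)

end Evolution

/-! ### Conservation of mass and energy. -/

section Hamiltonian

variable {lam : ℤ → ℝ} (hlam : ∀ j, 0 ≤ lam j) {Φ : Seq → Seq} {G : Seq → ℝ} {J : Set ℝ}
  {v : ℝ → Seq}

/-- The vector field of the evolution equation in the interaction picture. -/
def interactionField (lam : ℤ → ℝ) (Φ : Seq → Seq) (t : ℝ) (x : Seq) : Seq :=
  -Complex.I • freeEvol lam (-t) (Φ (freeEvol lam t x))

/-- `v` is a solution on `J`, in the interaction picture, of `i b' = λ b / 2 + Φ b`. -/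
def IsInteractionSol (lam : ℤ → ℝ) (Φ : Seq → Seq) (J : Set ℝ) (v : ℝ → Seq) : Prop :=
  ∀ t ∈ J, HasDerivWithinAt v (interactionField lam Φ t (v t)) J t

theorem IsInteractionSol.mono {J' : Set ℝ} (hv : IsInteractionSol lam Φ J v) (h : J' ⊆ J) :
    IsInteractionSol lam Φ J' v :=
  fun t ht => (hv t (h ht)).mono h

theorem IsInteractionSol.continuousOn (hv : IsInteractionSol lam Φ J v) : ContinuousOn v J :=
  fun t ht => (hv t ht).continuousWithinAt

theorem IsInteractionSol.continuousOn_freeEvol (hv : IsInteractionSol lam Φ J v) :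
    ContinuousOn (fun t => freeEvol lam t (v t)) J :=
  GP.continuousOn_freeEvol lam continuous_id hv.continuousOn

theorem _root_.HasDerivWithinAt.seq_coord {c : ℝ → Seq} {c' : Seq} {t : ℝ}
    (h : HasDerivWithinAt c c' J t) (j : ℤ) : HasDerivWithinAt (fun s => c s j) (c' j) J t :=
  (((lp.evalCLM ℂ (fun _ : ℤ => ℂ) 2 j).restrictScalars ℝ).hasFDerivAt.comp_hasDerivWithinAt t h :)

theorem hasDerivAt_phase (l t : ℝ) :
    HasDerivAt (fun s : ℝ => Complex.exp ((-(l * s / 2) : ℝ) * Complex.I))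
      (Complex.exp ((-(l * t / 2) : ℝ) * Complex.I) * (-Complex.I * (l / 2))) t := by
  have h : HasDerivAt (fun s : ℝ => ((-(l * s / 2) : ℝ) : ℂ) * Complex.I)
      (((-(l / 2) : ℝ) : ℂ) * Complex.I) t := by
    refine HasDerivAt.mul_const (HasDerivAt.ofReal_comp ?_) _
    have := (((hasDerivAt_id t).const_mul l).div_const 2).fun_neg
    simpa using this
  convert h.cexp using 1
  push_cast
  ring

/-- The curve `(1 + λ)⁻¹ b` is differentiable in `ℓ²(ℤ)`. -/
theorem IsInteractionSol.hasDerivWithinAt_smooth (hv : IsInteractionSol lam Φ J v)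
    (hΦ : Continuous Φ) (hJ : Convex ℝ J) {t : ℝ} (ht : t ∈ J) :
    HasDerivWithinAt (fun s => smooth hlam (freeEvol lam s (v s)))
      (-Complex.I • ((1 / 2 : ℂ) • (freeEvol lam t (v t) - smooth hlam (freeEvol lam t (v t)))
        + smooth hlam (Φ (freeEvol lam t (v t))))) J t := by
  have hb := hv.continuousOn_freeEvol
  -- The symbol `λ / (1 + λ) = 1 - (1 + λ)⁻¹` is bounded, so the coordinatewise derivative is again
  -- a continuous curve in `ℓ²(ℤ)`.
  refine hasDerivWithinAt_of_coord hJ (g := fun t =>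
    (-Complex.I • ((1 / 2 : ℂ) • (freeEvol lam t (v t) - smooth hlam (freeEvol lam t (v t)))
        + smooth hlam (Φ (freeEvol lam t (v t)))))) ?_ ?_ ht
  · exact (((hb.sub ((smooth hlam).continuous.comp_continuousOn hb)).const_smul (1 / 2 : ℂ)).add
      ((smooth hlam).continuous.comp_continuousOn (hΦ.comp_continuousOn hb))).const_smul
        (-Complex.I)
  · intro j t ht
    have h1 := (hv t ht).seq_coord j
    have h2 := (((hasDerivAt_phase (lam j) t).hasDerivWithinAt (s := J)).mul h1).const_mul
      (((1 + lam j)⁻¹ : ℝ) : ℂ)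
    refine h2.congr_deriv ?_
    have hj : (1 : ℂ) + lam j ≠ 0 := by
      have := hlam j
      exact_mod_cast (by positivity : (1 : ℝ) + lam j ≠ 0)
    have hp : Complex.exp ((-(lam j * t / 2) : ℝ) * Complex.I)
        * Complex.exp ((-(lam j * -t / 2) : ℝ) * Complex.I) = 1 := by
      rw [← Complex.exp_add, ← add_mul, ← Complex.ofReal_add]
      simp only [mul_neg, neg_div, neg_neg, neg_add_cancel, Complex.ofReal_zero, zero_mul,
        Complex.exp_zero]
    simp only [interactionField, lp.coeFn_smul, lp.coeFn_add, lp.coeFn_sub, Pi.smul_apply,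
      Pi.add_apply, Pi.sub_apply, smooth_apply, freeEvol_apply lam (-t), smul_eq_mul]
    simp only [freeEvol_apply]
    generalize Φ (freeEvol lam t (v t)) j = z
    generalize Complex.exp ((-(lam j * -t / 2) : ℝ) * Complex.I) = p at *
    generalize Complex.exp ((-(lam j * t / 2) : ℝ) * Complex.I) = q at *
    generalize v t j = w
    have hz : q * (-Complex.I * (p * z)) = -Complex.I * z := by
      linear_combination (-Complex.I * z) * hp
    rw [hz]
    push_cast
    field_simp
    ring

variable (Φ G) in
/-- `Φ` is the gradient of the functional `G`, invariant under the gauge group. -/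
structure IsHamiltonian : Prop where
  lipschitz : ∀ R : ℝ, ∃ K : NNReal, LipschitzOnWith K Φ (Metric.closedBall 0 R)
  gauge : ∀ b, (inner ℂ b (smooth hlam (Φ b))).im = 0
  expand : ∀ R : ℝ, ∃ K : ℝ, ∀ b c : Seq, ‖b‖ ≤ R → ‖c‖ ≤ R →
    |G c - G b - (inner ℂ (Φ b) (smooth hlam (c - b))).re| ≤ K * ‖halfSmooth hlam (c - b)‖ ^ 2

theorem continuous_of_lipschitzOnWith_balls
    (h : ∀ R : ℝ, ∃ K : NNReal, LipschitzOnWith K Φ (Metric.closedBall 0 R)) : Continuous Φ := by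
  rw [continuous_iff_continuousAt]
  intro x
  obtain ⟨K, hK⟩ := h (‖x‖ + 1)
  refine hK.continuousOn.continuousAt ?_
  refine Filter.mem_of_superset (Metric.ball_mem_nhds x one_pos) fun y hy => ?_
  rw [mem_closedBall_zero_iff]
  rw [mem_ball_iff_norm] at hy
  linarith [norm_le_norm_add_norm_sub' y x]

theorem hasDerivWithinAt_re_inner {f g : ℝ → Seq} {f' g' : Seq} {t : ℝ}
    (hf : HasDerivWithinAt f f' J t) (hg : HasDerivWithinAt g g' J t) :
    HasDerivWithinAt (fun s => (inner ℂ (f s) (g s)).re)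
      ((inner ℂ (f t) g').re + (inner ℂ f' (g t)).re) J t := by
  have := Complex.reCLM.hasFDerivAt.comp_hasDerivWithinAt t (hf.inner ℂ hg)
  exact this.congr_deriv (by simp)

theorem eq_of_hasDerivWithinAt_zero (hJ : Convex ℝ J) {f : ℝ → ℝ}
    (h : ∀ t ∈ J, HasDerivWithinAt f 0 J t) {s t : ℝ} (hs : s ∈ J) (ht : t ∈ J) : f s = f t := by
  have := hJ.norm_image_sub_le_of_norm_hasDerivWithin_le (C := 0) h (by simp) ht hs
  rw [zero_mul] at this
  exact sub_eq_zero.1 (norm_le_zero_iff.1 this)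

variable {hlam}

theorem norm_sq_eq_re_inner (b : Seq) : ‖b‖ ^ 2 = (inner ℂ b b).re :=
  (inner_self_eq_norm_sq (𝕜 := ℂ) b).symm

theorem norm_halfSmooth_freeEvol (t : ℝ) (b : Seq) :
    ‖halfSmooth hlam (freeEvol lam t b)‖ = ‖halfSmooth hlam b‖ := by
  rw [← freeEvol_halfSmooth, norm_freeEvol]

/-- Conservation of mass. -/
theorem IsInteractionSol.norm_halfSmooth_eq (hv : IsInteractionSol lam Φ J v) (hJ : Convex ℝ J)
    (H : IsHamiltonian hlam Φ G) {s t : ℝ} (hs : s ∈ J) (ht : t ∈ J) :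
    ‖halfSmooth hlam (v s)‖ ^ 2 = ‖halfSmooth hlam (v t)‖ ^ 2 := by
  refine eq_of_hasDerivWithinAt_zero hJ (f := fun s => ‖halfSmooth hlam (v s)‖ ^ 2)
    (fun t ht => ?_) hs ht
  simp only [norm_sq_eq_re_inner]
  have h1 := ((halfSmooth hlam).restrictScalars ℝ).hasFDerivAt.comp_hasDerivWithinAt t (hv t ht)
  have h2 := hasDerivWithinAt_re_inner h1 h1
  refine h2.congr_deriv ?_
  have h3 : ∀ x y : Seq, (inner ℂ x y).re = (inner ℂ y x).re := fun x y => by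
    rw [← inner_conj_symm, Complex.conj_re]
  simp only [Function.comp, ContinuousLinearMap.coe_restrictScalars']
  rw [h3 (halfSmooth hlam (interactionField lam Φ t (v t)))]
  rw [← inner_smooth_eq, interactionField, map_smul, inner_smul_right, ← freeEvol_smooth,
    ← inner_freeEvol_left]
  have := H.gauge (freeEvol lam t (v t))
  simp [Complex.mul_re, this]

/-- This is the interpolation of `L²` between `H_1` and `H_{-1}`: Cauchy-Schwarz for `⟨b, smooth
b⟩`. -/
theorem norm_halfSmooth_sq_le (b : Seq) : ‖halfSmooth hlam b‖ ^ 2 ≤ ‖b‖ * ‖smooth hlam b‖ := by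
  rw [norm_sq_eq_re_inner, ← inner_smooth_eq]
  exact (Complex.re_le_norm _).trans (norm_inner_le_norm _ _)

/-- A chain rule along a curve that is only continuous in `H_1` and differentiable in `H_{-1}`. Of
the derivative of `smooth b` only the term `b / 2` contributes: the pairings of `Φ b` with `smooth
b` and with `smooth (Φ b)` are real, hence vanish after multiplication by `-i` and taking real
parts. -/
theorem IsInteractionSol.hasDerivWithinAt_potential (hv : IsInteractionSol lam Φ J v)
    (hJ : Convex ℝ J) (H : IsHamiltonian hlam Φ G) {t : ℝ} (ht : t ∈ J) :
    HasDerivWithinAt (fun s => G (freeEvol lam s (v s)))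
      (1 / 2 * (inner ℂ (Φ (freeEvol lam t (v t))) (freeEvol lam t (v t))).im) J t := by
  set b : ℝ → Seq := fun s => freeEvol lam s (v s) with hb
  have hbc : ContinuousWithinAt b J t := hv.continuousOn_freeEvol t ht
  have hy := hv.hasDerivWithinAt_smooth hlam (continuous_of_lipschitzOnWith_balls H.lipschitz) hJ ht
  have hA := hasDerivWithinAt_re_inner (hasDerivWithinAt_const t J (Φ (b t))) hy
  -- The nonlinear remainder has derivative zero: it is at most a constant times `‖b s - b t‖ *
  -- ‖smooth (b s - b t)‖`, where the first factor is `o(1)` and the second `O(s - t)`.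
  have hB : HasDerivWithinAt
      (fun s => G (b s) - (inner ℂ (Φ (b t)) (smooth hlam (b s))).re) 0 J t := by
    rw [hasDerivWithinAt_iff_isLittleO]
    obtain ⟨K, hK⟩ := H.expand (‖b t‖ + 1)
    have hO := hy.hasFDerivWithinAt.isBigO_sub
    have ho : (fun s => b s - b t) =o[𝓝[J] t] (fun _ => (1 : ℝ)) := by
      rw [Asymptotics.isLittleO_one_iff]
      simpa using hbc.tendsto.sub_const (b t)
    have hprod := ho.norm_left.mul_isBigO hO.norm_left
    simp only [one_mul] at hprod
    refine Asymptotics.IsBigO.trans_isLittleO ?_ hprod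
    refine Asymptotics.IsBigO.of_bound |K| ?_
    filter_upwards [hbc.tendsto (Metric.ball_mem_nhds (b t) one_pos)] with s hs
    have hs' : ‖b s‖ ≤ ‖b t‖ + 1 := by
      rw [mem_preimage, mem_ball_iff_norm] at hs
      linarith [norm_le_norm_add_norm_sub' (b s) (b t)]
    have h := hK (b t) (b s) (by linarith) hs'
    rw [smul_zero, sub_zero, Real.norm_eq_abs, Real.norm_eq_abs]
    have e1 : G (b s) - (inner ℂ (Φ (b t)) (smooth hlam (b s))).re
        - (G (b t) - (inner ℂ (Φ (b t)) (smooth hlam (b t))).re)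
        = G (b s) - G (b t) - (inner ℂ (Φ (b t)) (smooth hlam (b s - b t))).re := by
      rw [map_sub, inner_sub_right, Complex.sub_re]
      ring
    rw [e1]
    refine h.trans ?_
    rw [abs_of_nonneg (by positivity : 0 ≤ ‖b s - b t‖ * _)]
    refine mul_le_mul (le_abs_self K) ?_ (by positivity) (abs_nonneg _)
    rw [← map_sub]
    exact norm_halfSmooth_sq_le _
  refine ((hA.add hB).congr_of_mem (fun s _ => ?_) ht).congr_deriv ?_
  · simp [hb]
  · have hg := H.gauge (b t)
    have hg' : (inner ℂ (Φ (b t)) (smooth hlam (b t))).im = 0 := by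
      rw [inner_smooth_right, ← inner_conj_symm, Complex.conj_im, hg, neg_zero]
    have hself : (inner ℂ (Φ (b t)) (smooth hlam (Φ (b t)))).im = 0 := by
      rw [inner_smooth_eq]
      exact inner_self_im (𝕜 := ℂ) _
    simp only [hb] at hg' hself
    simp only [inner_smul_right, inner_add_right, inner_sub_right, inner_zero_left]
    simp [Complex.mul_re, hg', hself, hb]

/-- Conservation of energy. -/
theorem IsInteractionSol.energy_eq (hv : IsInteractionSol lam Φ J v) (hJ : Convex ℝ J)
    (H : IsHamiltonian hlam Φ G) {s t : ℝ} (hs : s ∈ J) (ht : t ∈ J) :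
    1 / 4 * ‖v s‖ ^ 2 + G (freeEvol lam s (v s)) =
      1 / 4 * ‖v t‖ ^ 2 + G (freeEvol lam t (v t)) := by
  refine eq_of_hasDerivWithinAt_zero hJ
    (f := fun s => 1 / 4 * ‖v s‖ ^ 2 + G (freeEvol lam s (v s))) (fun t ht => ?_) hs ht
  simp only [norm_sq_eq_re_inner]
  have h2 := ((hasDerivWithinAt_re_inner (hv t ht) (hv t ht)).const_mul (1 / 4)).add
    (hv.hasDerivWithinAt_potential hJ H ht)
  refine h2.congr_deriv ?_
  have h3 : ∀ x y : Seq, (inner ℂ x y).re = (inner ℂ y x).re := fun x y => by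
    rw [← inner_conj_symm, Complex.conj_re]
  have h4 : ∀ x y : Seq, (inner ℂ x y).im = -(inner ℂ y x).im := fun x y => by
    rw [← inner_conj_symm, Complex.conj_im]
  -- The quadratic part contributes `Im ⟨b, Φ b⟩ / 2`, which is the negative of the derivative of
  -- the potential.
  rw [h3 (interactionField lam Φ t (v t)), interactionField, inner_smul_right,
    ← inner_freeEvol_left, h4 (Φ _)]
  simp only [Complex.mul_re, Complex.neg_re, Complex.neg_im, Complex.I_re, Complex.I_im]
  ring

/-- The a priori bound that follows from the conservation laws. -/
theorem IsInteractionSol.norm_le (hv : IsInteractionSol lam Φ J v) (hJ : Convex ℝ J)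
    (H : IsHamiltonian hlam Φ G) {A B C : ℝ} (hA : 0 ≤ A)
    (hlow : ∀ b, -(A * ‖halfSmooth hlam b‖ ^ 2) ≤ G b) (hup : ∀ b : Seq, ‖b‖ ≤ C → G b ≤ B)
    {s t : ℝ} (hs : s ∈ J) (ht : t ∈ J) (hvs : ‖v s‖ ≤ C) :
    ‖v t‖ ≤ √(C ^ 2 + 4 * B + 4 * A * C ^ 2) := by
  refine Real.le_sqrt_of_sq_le ?_
  -- The lower bound for `G` involves only the conserved mass, so energy conservation controls `‖v
  -- t‖` with no smallness condition.
  have h1 := hv.energy_eq hJ H hs ht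
  have h2 := hv.norm_halfSmooth_eq hJ H hs ht
  have h3 := hup (freeEvol lam s (v s)) (by rwa [norm_freeEvol])
  have h4 := hlow (freeEvol lam t (v t))
  rw [norm_halfSmooth_freeEvol, ← h2] at h4
  have h5 : ‖halfSmooth hlam (v s)‖ ≤ C := (norm_diagOp_le _ _ _).trans hvs
  have h6 : ‖halfSmooth hlam (v s)‖ ^ 2 ≤ C ^ 2 := pow_le_pow_left₀ (norm_nonneg _) h5 2
  have h7 : ‖v s‖ ^ 2 ≤ C ^ 2 := pow_le_pow_left₀ (norm_nonneg _) hvs 2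
  nlinarith [mul_le_mul_of_nonneg_left h6 hA]

end Hamiltonian

/-! ### Existence, uniqueness and stability in the interaction picture. -/

section Existence

variable {lam : ℤ → ℝ} {Φ : Seq → Seq}

/-- A Lipschitz function of the norm, equal to `1` for `‖x‖ ≤ R` and to `0` for `R + 1 ≤ ‖x‖`. -/
def cutoff (R : ℝ) (x : Seq) : ℝ := max 0 (min 1 (R + 1 - ‖x‖))

theorem cutoff_nonneg (R : ℝ) (x : Seq) : 0 ≤ cutoff R x := le_max_left _ _

theorem cutoff_le_one (R : ℝ) (x : Seq) : cutoff R x ≤ 1 :=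
  max_le zero_le_one (min_le_left _ _)

theorem cutoff_eq_one {R : ℝ} {x : Seq} (h : ‖x‖ ≤ R) : cutoff R x = 1 := by
  rw [cutoff, min_eq_left (by linarith), max_eq_right zero_le_one]

theorem cutoff_eq_zero {R : ℝ} {x : Seq} (h : R + 1 ≤ ‖x‖) : cutoff R x = 0 := by
  rw [cutoff, max_eq_left]
  exact (min_le_right _ _).trans (by linarith)

theorem abs_cutoff_sub_le (R : ℝ) (x y : Seq) : |cutoff R x - cutoff R y| ≤ ‖x - y‖ := by
  have h1 := abs_max_sub_max_le_max 0 (min 1 (R + 1 - ‖x‖)) 0 (min 1 (R + 1 - ‖y‖))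
  have h2 := abs_min_sub_min_le_max 1 (R + 1 - ‖x‖) 1 (R + 1 - ‖y‖)
  simp only [sub_self, abs_zero, abs_nonneg, max_eq_right] at h1 h2
  refine h1.trans (h2.trans ?_)
  rw [show R + 1 - ‖x‖ - (R + 1 - ‖y‖) = ‖y‖ - ‖x‖ by ring, abs_sub_comm]
  exact abs_norm_sub_norm_le x y

/-- A Lipschitz map on a ball becomes globally Lipschitz after multiplication by the cutoff. -/
theorem norm_cutoff_smul_sub_le {R K N : ℝ} (hK : 0 ≤ K) (hN : 0 ≤ N) {f : Seq → Seq}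
    (hf : ∀ x y, ‖x‖ ≤ R + 1 → ‖y‖ ≤ R + 1 → ‖f x - f y‖ ≤ K * ‖x - y‖)
    (hb : ∀ x, ‖x‖ ≤ R + 1 → ‖f x‖ ≤ N) (x y : Seq) :
    ‖cutoff R x • f x - cutoff R y • f y‖ ≤ (N + K) * ‖x - y‖ := by
  -- With `x` the shorter vector, `f` is evaluated outside the ball of radius `R + 1` only where its
  -- coefficient `cutoff R y` vanishes.
  wlog h : ‖x‖ ≤ ‖y‖ generalizing x y
  · rw [norm_sub_rev, norm_sub_rev x y]
    exact this y x (le_of_not_ge h)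
  by_cases hx : ‖x‖ ≤ R + 1
  · rw [show cutoff R x • f x - cutoff R y • f y =
      (cutoff R x - cutoff R y) • f x + cutoff R y • (f x - f y) by module]
    refine (norm_add_le _ _).trans ?_
    rw [norm_smul, norm_smul, Real.norm_eq_abs, Real.norm_eq_abs, add_mul, mul_comm N]
    refine add_le_add (mul_le_mul (abs_cutoff_sub_le R x y) (hb x hx) (norm_nonneg _)
      (norm_nonneg _)) ?_
    by_cases hy : ‖y‖ ≤ R + 1
    · rw [abs_of_nonneg (cutoff_nonneg _ _)]
      exact (mul_le_of_le_one_left (norm_nonneg _) (cutoff_le_one _ _)).trans (hf x y hx hy)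
    · rw [cutoff_eq_zero (by linarith)]
      simp only [abs_zero, zero_mul]
      positivity
  · rw [cutoff_eq_zero (by linarith), cutoff_eq_zero (x := y) (by linarith)]
    simp only [zero_smul, sub_zero, norm_zero]
    positivity

theorem norm_interactionField (t : ℝ) (x : Seq) :
    ‖interactionField lam Φ t x‖ = ‖Φ (freeEvol lam t x)‖ := by
  rw [interactionField, norm_smul, norm_freeEvol]
  simp

theorem norm_interactionField_sub (t : ℝ) (x y : Seq) :
    ‖interactionField lam Φ t x - interactionField lam Φ t y‖ =
      ‖Φ (freeEvol lam t x) - Φ (freeEvol lam t y)‖ := by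
  rw [interactionField, interactionField, ← smul_sub, ← map_sub, norm_smul, norm_freeEvol]
  simp

theorem lipschitzOnWith_interactionField {K : NNReal} {R : ℝ}
    (h : LipschitzOnWith K Φ (Metric.closedBall 0 R)) (t : ℝ) :
    LipschitzOnWith K (interactionField lam Φ t) (Metric.closedBall 0 R) := by
  refine LipschitzOnWith.of_dist_le_mul fun x hx y hy => ?_
  rw [dist_eq_norm, dist_eq_norm, norm_interactionField_sub, ← norm_freeEvol lam t (x - y),
    map_sub, ← dist_eq_norm, ← dist_eq_norm]
  rw [mem_closedBall_zero_iff] at hx hy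
  exact h.dist_le_mul _ (by rwa [mem_closedBall_zero_iff, norm_freeEvol]) _
    (by rwa [mem_closedBall_zero_iff, norm_freeEvol])

/-- Global solvability of the evolution equation with cut-off nonlinearity. -/
theorem exists_cutoff_sol (hΦ : ∀ R : ℝ, ∃ K : NNReal, LipschitzOnWith K Φ (Metric.closedBall 0 R))
    (R : ℝ) (hR : 0 ≤ R) (τ : ℝ) (hτ : 0 ≤ τ) (x₀ : Seq) :
    ∃ v : ℝ → Seq, v 0 = x₀ ∧ ∀ t ∈ Icc 0 τ,
      HasDerivWithinAt v (cutoff R (v t) • interactionField lam Φ t (v t)) (Icc 0 τ) t := by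
  obtain ⟨K, hK⟩ := hΦ (R + 1)
  set N : NNReal := ⟨‖Φ 0‖ + K * (R + 1), by positivity⟩ with hN
  have hbound : ∀ x : Seq, ‖x‖ ≤ R + 1 → ‖Φ x‖ ≤ N := fun x hx => by
    have h0 := hK.dist_le_mul x (by simpa using hx) 0 (by simpa using by linarith)
    rw [dist_eq_norm, dist_eq_norm, sub_zero] at h0
    have h1 := norm_le_norm_add_norm_sub' (Φ x) (Φ 0)
    have h2 : (K : ℝ) * ‖x‖ ≤ K * (R + 1) := by gcongr
    change ‖Φ x‖ ≤ ‖Φ 0‖ + K * (R + 1)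
    linarith
  have hcont : Continuous Φ := continuous_of_lipschitzOnWith_balls hΦ
  -- The field is bounded by `N` everywhere, so a curve travels at most `N * τ` in time `τ`. With
  -- this radius Picard-Lindelöf covers all of `[0, τ]` at once.
  have hPL : IsPicardLindelof (fun t x => cutoff R x • interactionField lam Φ t x)
      (⟨0, by simpa using hτ⟩ : Icc 0 τ) x₀ (N * ⟨τ, hτ⟩) 0 N (N + K) := by
    refine ⟨fun t _ => LipschitzWith.lipschitzOnWith <| LipschitzWith.of_dist_le_mul fun x y => ?_,
      fun x _ => ?_, fun t _ x _ => ?_, ?_⟩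
    · rw [dist_eq_norm, dist_eq_norm]
      refine norm_cutoff_smul_sub_le K.2 N.2 (fun x y hx hy => ?_) (fun x hx => ?_) x y
      · rw [← dist_eq_norm, ← dist_eq_norm]
        exact (lipschitzOnWith_interactionField hK t).dist_le_mul _
          (by simpa using hx) _ (by simpa using hy)
      · rw [norm_interactionField]
        exact hbound _ (by rwa [norm_freeEvol])
    · refine ContinuousOn.const_smul (ContinuousOn.const_smul ?_ (-Complex.I)) (cutoff R x)
      exact continuousOn_freeEvol lam continuous_neg
        (hcont.comp (continuous_freeEvol lam x)).continuousOn
    · rw [norm_smul, Real.norm_of_nonneg (cutoff_nonneg _ _), norm_interactionField]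
      by_cases hx : ‖x‖ ≤ R + 1
      · exact (mul_le_of_le_one_left (norm_nonneg _) (cutoff_le_one _ _)).trans
          (hbound _ (by rwa [norm_freeEvol]))
      · rw [cutoff_eq_zero (by linarith), zero_mul]
        exact N.2
    · simp only [sub_zero, sub_self, hτ, sup_of_le_left, NNReal.coe_zero]
      exact le_rfl
  exact hPL.exists_eq_forall_mem_Icc_hasDerivWithinAt₀

/-- Solutions of the evolution equation exist on every bounded interval as soon as they satisfy an
a priori bound. -/
theorem exists_interactionSol
    (hΦ : ∀ R : ℝ, ∃ K : NNReal, LipschitzOnWith K Φ (Metric.closedBall 0 R)) {x₀ : Seq} {B : ℝ}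
    (hB : ‖x₀‖ ≤ B)
    (hap : ∀ (σ : ℝ) (v : ℝ → Seq), 0 ≤ σ → v 0 = x₀ → IsInteractionSol lam Φ (Icc 0 σ) v →
      ‖v σ‖ ≤ B) (τ : ℝ) (hτ : 0 ≤ τ) :
    ∃ v : ℝ → Seq, v 0 = x₀ ∧ IsInteractionSol lam Φ (Icc 0 τ) v := by
  have hB0 : 0 ≤ B := (norm_nonneg _).trans hB
  obtain ⟨v, hv0, hv⟩ := exists_cutoff_sol (lam := lam) hΦ (B + 1) (by linarith) τ hτ x₀
  have hvc : ContinuousOn v (Icc 0 τ) := fun t ht => (hv t ht).continuousWithinAt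
  have hlocal : ∀ σ ∈ Icc 0 τ, (∀ t ∈ Icc 0 σ, ‖v t‖ ≤ B + 1) →
      IsInteractionSol lam Φ (Icc 0 σ) v := by
    intro σ hσ h t ht
    have := hv t ⟨ht.1, ht.2.trans hσ.2⟩
    rw [cutoff_eq_one (h t ht), one_smul] at this
    exact this.mono (Icc_subset_Icc_right hσ.2)
  have hlt : ∀ t ∈ Icc 0 τ, ‖v t‖ < B + 1 := by
    by_contra! hne
    -- Continuity argument: up to the first time the norm reaches `B + 1` the cutoff equals 1, so
    -- the curve solves the true equation and the a priori bound gives norm at most `B` there, a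
    -- contradiction.
    set S : Set ℝ := Icc 0 τ ∩ {t | B + 1 ≤ ‖v t‖} with hS
    have hSne : S.Nonempty := hne
    have hScl : IsClosed S := by
      have := hvc.norm.preimage_isClosed_of_isClosed isClosed_Icc (isClosed_Ici (a := B + 1))
      exact this
    have hSbd : BddBelow S := ⟨0, fun t ht => ht.1.1⟩
    have hmem := hScl.csInf_mem hSne hSbd
    set σ := sInf S with hσ
    have hbefore : ∀ t ∈ Ico 0 σ, ‖v t‖ ≤ B + 1 := by
      intro t ht
      by_contra! hc
      have : σ ≤ t := csInf_le hSbd ⟨⟨ht.1, ht.2.le.trans hmem.1.2⟩, hc.le⟩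
      exact absurd this (not_le.2 ht.2)
    have hpos : 0 < σ := by
      refine lt_of_le_of_ne hmem.1.1 fun h => ?_
      have h2 : B + 1 ≤ ‖v σ‖ := hmem.2
      rw [← h, hv0] at h2
      linarith
    have hle : ‖v σ‖ ≤ B + 1 := by
      have hc : ContinuousWithinAt v (Ico 0 σ) σ :=
        (hvc σ hmem.1).mono (Ico_subset_Icc_self.trans (Icc_subset_Icc_right hmem.1.2))
      have hcl : σ ∈ closure (Ico 0 σ) := by
        rw [closure_Ico hpos.ne]
        exact right_mem_Icc.2 hpos.le
      have : (𝓝[Ico 0 σ] σ).NeBot := mem_closure_iff_nhdsWithin_neBot.1 hcl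
      exact le_of_tendsto hc.tendsto.norm (eventually_mem_nhdsWithin.mono hbefore)
    have hsol := hlocal σ hmem.1 fun t ht => by
      rcases eq_or_lt_of_le ht.2 with h | h
      · rwa [h]
      · exact hbefore t ⟨ht.1, h⟩
    have h1 := hap σ v hpos.le hv0 hsol
    have h2 : B + 1 ≤ ‖v σ‖ := hmem.2
    linarith
  exact ⟨v, hv0, hlocal τ ⟨hτ, le_rfl⟩ fun t ht => (hlt t ht).le⟩

theorem _root_.HasDerivWithinAt.Ici_of_Icc {E : Type*} [NormedAddCommGroup E] [NormedSpace ℝ E]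
    {f : ℝ → E} {f' : E} {a b t : ℝ} (h : HasDerivWithinAt f f' (Icc a b) t) (ht : t ∈ Ico a b) :
    HasDerivWithinAt f f' (Ici t) t := by
  refine h.mono_of_mem_nhdsWithin ?_
  exact Filter.mem_of_superset (Icc_mem_nhdsGE ht.2) (Icc_subset_Icc_left ht.1)

/-- Both curves are continuous on a compact interval, hence stay in a common ball, where the field
is Lipschitz uniformly in time. -/
theorem IsInteractionSol.eqOn
    (hΦ : ∀ R : ℝ, ∃ K : NNReal, LipschitzOnWith K Φ (Metric.closedBall 0 R)) {τ : ℝ}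
    {v v' : ℝ → Seq} (hv : IsInteractionSol lam Φ (Icc 0 τ) v)
    (hv' : IsInteractionSol lam Φ (Icc 0 τ) v') (h0 : v 0 = v' 0) : EqOn v v' (Icc 0 τ) := by
  obtain ⟨R, hR⟩ := isCompact_Icc.exists_bound_of_continuousOn hv.continuousOn
  obtain ⟨R', hR'⟩ := isCompact_Icc.exists_bound_of_continuousOn hv'.continuousOn
  obtain ⟨K, hK⟩ := hΦ (max R R')
  refine ODE_solution_unique_of_mem_Icc_right (v := interactionField lam Φ)
    (s := fun _ => Metric.closedBall 0 (max R R')) (K := K)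
    (fun t _ => lipschitzOnWith_interactionField hK t) hv.continuousOn
    (fun t ht => (hv t (Ico_subset_Icc_self ht)).Ici_of_Icc ht) (fun t ht => ?_) hv'.continuousOn
    (fun t ht => (hv' t (Ico_subset_Icc_self ht)).Ici_of_Icc ht) (fun t ht => ?_) h0
  · rw [mem_closedBall_zero_iff]
    exact (hR t (Ico_subset_Icc_self ht)).trans (le_max_left _ _)
  · rw [mem_closedBall_zero_iff]
    exact (hR' t (Ico_subset_Icc_self ht)).trans (le_max_right _ _)

/-- Global existence from solvability on all bounded intervals. -/
theorem exists_global_interactionSol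
    (hΦ : ∀ R : ℝ, ∃ K : NNReal, LipschitzOnWith K Φ (Metric.closedBall 0 R)) {x₀ : Seq}
    (hex : ∀ τ : ℝ, 0 ≤ τ → ∃ v : ℝ → Seq, v 0 = x₀ ∧ IsInteractionSol lam Φ (Icc 0 τ) v) :
    ∃ v : ℝ → Seq, v 0 = x₀ ∧ IsInteractionSol lam Φ (Ici 0) v := by
  choose! w hw0 hw using hex
  -- At time `t` the solution constructed on `[0, |t| + 1]` is used, so that `t` is not an endpoint;
  -- uniqueness makes these choices agree near each time.
  refine ⟨fun t => w (|t| + 1) t, hw0 _ (by positivity), fun t ht => ?_⟩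
  have ht' : (0 : ℝ) ≤ t := ht
  have heq : ∀ s ∈ Icc 0 (t + 1), w (|s| + 1) s = w (t + 2) s := by
    intro s hs
    rw [abs_of_nonneg hs.1]
    refine (((hw (s + 1) (by linarith [hs.1]))).eqOn hΦ
      ((hw (t + 2) (by linarith)).mono (Icc_subset_Icc_right (by linarith [hs.2]))) ?_)
      ⟨hs.1, by linarith⟩
    rw [hw0 _ (by linarith [hs.1]), hw0 _ (by linarith)]
  have hnhds : Icc 0 (t + 1) ∈ 𝓝[Ici 0] t := by
    rw [← Ici_inter_Iic]
    exact inter_mem_nhdsWithin _ (Iic_mem_nhds (by linarith))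
  have hmem : t ∈ Icc 0 (t + 1) := ⟨ht', by linarith⟩
  have h1 := (hw (t + 2) (by linarith) t ⟨ht', by linarith⟩).mono
    (Icc_subset_Icc_right (by linarith : t + 1 ≤ t + 2))
  have h2 := h1.mono_of_mem_nhdsWithin hnhds
  rw [← heq t hmem] at h2
  refine h2.congr_of_eventuallyEq_of_mem ?_ ht
  filter_upwards [hnhds] with s hs using heq s hs

/-- The difference of solutions of two evolution equations, measured in a weaker norm. -/
theorem norm_halfSmooth_sub_le (hlam : ∀ j, 0 ≤ lam j) {Φ' : Seq → Seq} {τ : ℝ}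
    {v v' : ℝ → Seq} (hv : IsInteractionSol lam Φ (Icc 0 τ) v)
    (hv' : IsInteractionSol lam Φ' (Icc 0 τ) v') {K η : ℝ}
    (hK : ∀ t ∈ Icc 0 τ, ‖halfSmooth hlam
        (Φ (freeEvol lam t (v t)) - Φ' (freeEvol lam t (v' t)))‖ ≤
      K * ‖halfSmooth hlam (freeEvol lam t (v t) - freeEvol lam t (v' t))‖ + η) :
    ∀ t ∈ Icc 0 τ, ‖halfSmooth hlam (v t - v' t)‖ ≤
      gronwallBound ‖halfSmooth hlam (v 0 - v' 0)‖ K η t := by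
  have hd : ∀ t ∈ Icc 0 τ, HasDerivWithinAt (fun t => halfSmooth hlam (v t - v' t))
      (halfSmooth hlam (interactionField lam Φ t (v t) - interactionField lam Φ' t (v' t)))
      (Icc 0 τ) t := fun t ht =>
    ((halfSmooth hlam).restrictScalars ℝ).hasFDerivAt.comp_hasDerivWithinAt t
      ((hv t ht).sub (hv' t ht))
  intro t ht
  have := norm_le_gronwallBound_of_norm_deriv_right_le
    (fun t ht => (hd t ht).continuousWithinAt)
    (fun t ht => (hd t (Ico_subset_Icc_self ht)).Ici_of_Icc ht) le_rfl
    (K := K) (ε := η) (fun t ht => ?_) t ht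
  · simpa using this
  -- The free group is isometric and commutes with `halfSmooth`, so the estimate for `freeEvol t v`
  -- is an estimate for `v`.
  · rw [interactionField, interactionField, ← smul_sub, ← map_sub, map_smul, ← freeEvol_halfSmooth,
      norm_smul, norm_freeEvol, ← norm_freeEvol lam t (halfSmooth hlam (v t - v' t)),
      freeEvol_halfSmooth, map_sub (freeEvol lam t)]
    simpa using hK t (Ico_subset_Icc_self ht)

end Existence

/-! ### Fourier coefficients on a period and Parseval's identity. -/

section Fourier

/-- The angular frequency `2πj/T` of the `j`-th Fourier mode. -/
def freq (T : ℝ) (j : ℤ) : ℝ := 2 * Real.pi * j / T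

/-- The symbol `4π²j²/T²` of `-d²/dx²`. -/
def laplaceSymbol (T : ℝ) (j : ℤ) : ℝ := 4 * Real.pi ^ 2 * (j : ℝ) ^ 2 / T ^ 2

theorem laplaceSymbol_eq (T : ℝ) (j : ℤ) : laplaceSymbol T j = freq T j ^ 2 := by
  rw [laplaceSymbol, freq]
  ring

theorem laplaceSymbol_nonneg (T : ℝ) (j : ℤ) : 0 ≤ laplaceSymbol T j := by
  rw [laplaceSymbol_eq]
  positivity

theorem weight_eq (T : ℝ) (j : ℤ) : weight T j = 1 + laplaceSymbol T j := rfl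

theorem one_le_weight (T : ℝ) (j : ℤ) : 1 ≤ weight T j := by
  linarith [laplaceSymbol_nonneg T j, weight_eq T j]

theorem weight_pos (T : ℝ) (j : ℤ) : 0 < weight T j := one_pos.trans_le (one_le_weight T j)

theorem e_eq (T : ℝ) (j : ℤ) (x : ℝ) :
    e T j x = ((√T)⁻¹ : ℝ) * Complex.exp ((-(freq T j * x) : ℝ) * Complex.I) := by
  rw [e, freq, one_div]
  congr 2
  push_cast
  ring

theorem conj_e_eq (T : ℝ) (j : ℤ) (x : ℝ) :
    (starRingEnd ℂ) (e T j x) =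
      ((√T)⁻¹ : ℝ) * Complex.exp ((freq T j * x : ℝ) * Complex.I) := by
  rw [e_eq, map_mul, Complex.conj_ofReal, ← Complex.exp_conj, map_mul, Complex.conj_ofReal,
    Complex.conj_I]
  congr 2
  push_cast
  ring

theorem norm_e (T : ℝ) (j : ℤ) (x : ℝ) : ‖e T j x‖ = (√T)⁻¹ := by
  rw [e_eq, norm_mul, Complex.norm_exp_ofReal_mul_I, Complex.norm_real, mul_one,
    Real.norm_of_nonneg (by positivity)]

theorem continuous_e (T : ℝ) (j : ℤ) : Continuous (e T j) := by
  simp only [funext (e_eq T j)]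
  fun_prop

theorem continuous_conj_e (T : ℝ) (j : ℤ) : Continuous fun x => (starRingEnd ℂ) (e T j x) :=
  Complex.continuous_conj.comp (continuous_e T j)

theorem exp_freq_mul_period {T : ℝ} (hT : T ≠ 0) (j : ℤ) :
    Complex.exp ((freq T j * T : ℝ) * Complex.I) = 1 := by
  rw [Complex.exp_eq_one_iff]
  refine ⟨j, ?_⟩
  rw [freq, div_mul_cancel₀ _ hT]
  push_cast
  ring

theorem conj_e_add (T : ℝ) (j : ℤ) (x h : ℝ) :
    (starRingEnd ℂ) (e T j (x + h)) =
      (starRingEnd ℂ) (e T j x) * Complex.exp ((freq T j * h : ℝ) * Complex.I) := by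
  rw [conj_e_eq, conj_e_eq, mul_assoc, ← Complex.exp_add, ← add_mul, ← Complex.ofReal_add, mul_add]

theorem e_periodic {T : ℝ} (hT : T ≠ 0) (j : ℤ) : Function.Periodic (e T j) T := by
  intro x
  have := conj_e_add T j x T
  rw [exp_freq_mul_period hT, mul_one] at this
  exact (starRingEnd ℂ).injective this

variable {T : ℝ}

theorem neg_half_lt_half (hT : 0 < T) : -(T / 2) < T / 2 := by linarith

/-- The exponent in `e` has a minus sign, hence the index `-j`. The factor `√T` compares the
`L²(dx)` normalization with the average over a period. -/
theorem fourierCoef_eq_fourierCoeffOn (hT : 0 < T) (f : ℝ → ℂ) (j : ℤ) :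
    fourierCoef T f j = (√T : ℂ) * fourierCoeffOn (neg_half_lt_half hT) f (-j) := by
  rw [fourierCoeffOn_eq_integral, fourierCoef, sub_neg_eq_add, add_halves, neg_neg,
    Complex.real_smul, ← mul_assoc, ← intervalIntegral.integral_const_mul]
  refine intervalIntegral.integral_congr fun x _ => ?_
  simp only [smul_eq_mul]
  rw [fourier_coe_apply, conj_e_eq, freq]
  have h1 : ((√T)⁻¹ : ℝ) = √T * (1 / T) := by
    nth_rw 3 [← Real.mul_self_sqrt hT.le]
    have := (Real.sqrt_pos.2 hT).ne'
    field_simp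
  rw [h1]
  have h2 : 2 * (Real.pi : ℂ) * Complex.I * j * x / T
      = ((2 * Real.pi * j / T * x : ℝ) : ℂ) * Complex.I := by
    push_cast
    ring
  rw [h2]
  push_cast
  ring

/-- The restriction of Lebesgue measure to a period. -/
abbrev periodMeasure (T : ℝ) : Measure ℝ := volume.restrict (Ioc (-(T / 2)) (T / 2))

theorem integral_period_eq (hT : 0 < T) {E : Type*} [NormedAddCommGroup E] [NormedSpace ℝ E]
    (f : ℝ → E) : ∫ x in (-(T / 2))..(T / 2), f x = ∫ x, f x ∂(periodMeasure T) :=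
  intervalIntegral.integral_of_le (neg_half_lt_half hT).le

theorem hasSum_norm_fourierCoef_sq (hT : 0 < T) {f : ℝ → ℂ} (hf : MemLp f 2 (periodMeasure T)) :
    HasSum (fun j => ‖fourierCoef T f j‖ ^ 2) (∫ x in (-(T / 2))..(T / 2), ‖f x‖ ^ 2) := by
  have h := (hasSum_sq_fourierCoeffOn (neg_half_lt_half hT) hf).mul_left T
  rw [sub_neg_eq_add, add_halves, smul_eq_mul, ← mul_assoc, mul_inv_cancel₀ hT.ne', one_mul] at h
  rw [← (Equiv.neg ℤ).hasSum_iff] at h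
  refine h.congr_fun fun j => ?_
  simp only [Function.comp, Equiv.neg_apply]
  rw [fourierCoef_eq_fourierCoeffOn hT, norm_mul, mul_pow, Complex.norm_real,
    Real.norm_of_nonneg (by positivity), Real.sq_sqrt hT.le]

theorem _root_.Continuous.memLp_period {f : ℝ → ℂ} (hf : Continuous f) :
    MemLp f 2 (periodMeasure T) := by
  obtain ⟨A, hA⟩ := isCompact_Icc.exists_bound_of_continuousOn
    (hf.continuousOn (s := Icc (-(T / 2)) (T / 2)))
  refine MemLp.of_bound hf.aestronglyMeasurable A ?_
  exact (ae_restrict_mem measurableSet_Ioc).mono fun x hx => hA x (Ioc_subset_Icc_self hx)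

theorem intervalIntegrable_of_memLp (hT : 0 < T) {f : ℝ → ℂ} (hf : MemLp f 2 (periodMeasure T)) :
    IntervalIntegrable f volume (-(T / 2)) (T / 2) := by
  rw [intervalIntegrable_iff_integrableOn_Ioc_of_le (neg_half_lt_half hT).le]
  exact hf.integrable one_le_two

theorem fourierCoef_add {f g : ℝ → ℂ} (hf : IntervalIntegrable f volume (-(T / 2)) (T / 2))
    (hg : IntervalIntegrable g volume (-(T / 2)) (T / 2)) (j : ℤ) :
    fourierCoef T (f + g) j = fourierCoef T f j + fourierCoef T g j := by
  simp only [fourierCoef, Pi.add_apply, add_mul]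
  exact intervalIntegral.integral_add (hf.mul_continuousOn (continuous_conj_e T j).continuousOn)
    (hg.mul_continuousOn (continuous_conj_e T j).continuousOn)

theorem fourierCoef_const_mul (f : ℝ → ℂ) (a : ℂ) (j : ℤ) :
    fourierCoef T (fun x => a * f x) j = a * fourierCoef T f j := by
  simp only [fourierCoef, mul_assoc]
  exact intervalIntegral.integral_const_mul _ _

theorem fourierCoef_sub {f g : ℝ → ℂ} (hf : IntervalIntegrable f volume (-(T / 2)) (T / 2))
    (hg : IntervalIntegrable g volume (-(T / 2)) (T / 2)) (j : ℤ) :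
    fourierCoef T (f - g) j = fourierCoef T f j - fourierCoef T g j := by
  simp only [fourierCoef, Pi.sub_apply, sub_mul]
  exact intervalIntegral.integral_sub (hf.mul_continuousOn (continuous_conj_e T j).continuousOn)
    (hg.mul_continuousOn (continuous_conj_e T j).continuousOn)

theorem fourierCoef_congr_ae {f g : ℝ → ℂ} (h : f =ᵐ[volume] g) (j : ℤ) :
    fourierCoef T f j = fourierCoef T g j := by
  rw [fourierCoef, fourierCoef]
  exact intervalIntegral.integral_congr_ae (h.mono fun x hx _ => by rw [hx])

theorem integral_period_comp_add {E : Type*} [NormedAddCommGroup E] [NormedSpace ℝ E]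
    {f : ℝ → E} (hf : Function.Periodic f T) (h : ℝ) :
    ∫ x in (-(T / 2))..(T / 2), f (x + h) = ∫ x in (-(T / 2))..(T / 2), f x := by
  rw [intervalIntegral.integral_comp_add_right]
  have := hf.intervalIntegral_add_eq (-(T / 2) + h) (-(T / 2))
  rw [show -(T / 2) + h + T = T / 2 + h by ring, show -(T / 2) + T = T / 2 by ring] at this
  exact this

theorem fourierCoef_comp_add (hT : T ≠ 0) {f : ℝ → ℂ} (hf : Function.Periodic f T) (h : ℝ)
    (j : ℤ) : fourierCoef T (fun x => f (x + h)) j =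
      Complex.exp ((-(freq T j * h) : ℝ) * Complex.I) * fourierCoef T f j := by
  have hper : Function.Periodic (fun x => f x * (starRingEnd ℂ) (e T j x)) T := fun x => by
    simp only [hf x, e_periodic hT j x]
  rw [fourierCoef, fourierCoef, ← integral_period_comp_add hper h,
    ← intervalIntegral.integral_const_mul]
  refine intervalIntegral.integral_congr fun x _ => ?_
  simp only [conj_e_add]
  have : Complex.exp ((-(freq T j * h) : ℝ) * Complex.I)
      * Complex.exp ((freq T j * h : ℝ) * Complex.I) = 1 := by
    rw [← Complex.exp_add, ← add_mul, ← Complex.ofReal_add, neg_add_cancel, Complex.ofReal_zero,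
      zero_mul, Complex.exp_zero]
  linear_combination (-(f (x + h) * (starRingEnd ℂ) (e T j x))) * this

theorem fourierCoef_e (hT : 0 < T) (k j : ℤ) :
    fourierCoef T (e T k) j = if j = k then 1 else 0 := by
  have hs : ((√T)⁻¹ : ℝ) * ((√T)⁻¹ : ℝ) = T⁻¹ := by
    rw [← mul_inv, Real.mul_self_sqrt hT.le]
  have hpt : ∀ x : ℝ, e T k x * (starRingEnd ℂ) (e T j x) =
      (T⁻¹ : ℝ) * Complex.exp ((freq T j - freq T k : ℝ) * Complex.I * x) := by
    intro x
    rw [e_eq, conj_e_eq, mul_mul_mul_comm, ← Complex.ofReal_mul, hs, ← Complex.exp_add]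
    congr 2
    push_cast
    ring
  rw [fourierCoef]
  simp only [hpt]
  rw [intervalIntegral.integral_const_mul]
  split_ifs with hjk
  · subst hjk
    simp only [sub_self, Complex.ofReal_zero, zero_mul, Complex.exp_zero,
      intervalIntegral.integral_const, sub_neg_eq_add, add_halves]
    simp [hT.ne']
  · have hne : freq T j - freq T k ≠ 0 := by
      rw [freq, freq, ← sub_div, ← mul_sub]
      have : (j : ℝ) - k ≠ 0 := sub_ne_zero.2 (by exact_mod_cast hjk)
      positivity
    rw [integral_exp_mul_complex (mul_ne_zero (by exact_mod_cast hne) Complex.I_ne_zero)]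
    have hper : Complex.exp ((freq T j - freq T k : ℝ) * Complex.I * (T / 2 : ℝ)) =
        Complex.exp ((freq T j - freq T k : ℝ) * Complex.I * (-(T / 2) : ℝ)) := by
      rw [Complex.exp_eq_exp_iff_exists_int]
      refine ⟨j - k, ?_⟩
      have hTc : (T : ℂ) ≠ 0 := by exact_mod_cast hT.ne'
      rw [freq, freq]
      push_cast
      field_simp
      ring
    rw [hper]
    simp

/-- The sequence of Fourier coefficients, as an element of `ℓ²(ℤ)`. -/
def coefSeq (T : ℝ) (f : ℝ → ℂ) : Seq :=
  open Classical in if h : Memℓp (fourierCoef T f) 2 then ⟨fourierCoef T f, h⟩ else 0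

theorem coefSeq_apply (hT : 0 < T) {f : ℝ → ℂ} (hf : MemLp f 2 (periodMeasure T)) (j : ℤ) :
    coefSeq T f j = fourierCoef T f j := by
  rw [coefSeq, dif_pos (memℓp_two_of_summable (hasSum_norm_fourierCoef_sq hT hf).summable)]

theorem norm_coefSeq_sq (hT : 0 < T) {f : ℝ → ℂ} (hf : MemLp f 2 (periodMeasure T)) :
    ‖coefSeq T f‖ ^ 2 = ∫ x in (-(T / 2))..(T / 2), ‖f x‖ ^ 2 := by
  refine (Seq.hasSum_norm_sq _).unique ((hasSum_norm_fourierCoef_sq hT hf).congr_fun fun j => ?_)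
  rw [coefSeq_apply hT hf]

theorem coefSeq_add (hT : 0 < T) {f g : ℝ → ℂ} (hf : MemLp f 2 (periodMeasure T))
    (hg : MemLp g 2 (periodMeasure T)) : coefSeq T (f + g) = coefSeq T f + coefSeq T g :=
  lp.ext (funext fun j => by
    rw [lp.coeFn_add, Pi.add_apply, coefSeq_apply hT (hf.add hg), coefSeq_apply hT hf,
      coefSeq_apply hT hg, fourierCoef_add (intervalIntegrable_of_memLp hT hf)
        (intervalIntegrable_of_memLp hT hg)])

theorem coefSeq_sub (hT : 0 < T) {f g : ℝ → ℂ} (hf : MemLp f 2 (periodMeasure T))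
    (hg : MemLp g 2 (periodMeasure T)) : coefSeq T (f - g) = coefSeq T f - coefSeq T g :=
  lp.ext (funext fun j => by
    rw [lp.coeFn_sub, Pi.sub_apply, coefSeq_apply hT (hf.sub hg), coefSeq_apply hT hf,
      coefSeq_apply hT hg, fourierCoef_sub (intervalIntegrable_of_memLp hT hf)
        (intervalIntegrable_of_memLp hT hg)])

theorem coefSeq_const_mul (hT : 0 < T) {f : ℝ → ℂ} (hf : MemLp f 2 (periodMeasure T)) (a : ℂ) :
    coefSeq T (fun x => a * f x) = a • coefSeq T f :=
  lp.ext (funext fun j => by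
    rw [lp.coeFn_smul, Pi.smul_apply, coefSeq_apply hT (hf.const_mul a), coefSeq_apply hT hf,
      fourierCoef_const_mul, smul_eq_mul])

/-- Parseval's identity. -/
theorem inner_coefSeq (hT : 0 < T) {f g : ℝ → ℂ} (hf : Continuous f) (hg : Continuous g) :
    inner ℂ (coefSeq T g) (coefSeq T f) =
      ∫ x in (-(T / 2))..(T / 2), (starRingEnd ℂ) (g x) * f x := by
  have hf2 := hf.memLp_period (T := T)
  have hg2 := hg.memLp_period (T := T)
  have hI : MemLp (fun x => Complex.I * f x) 2 (periodMeasure T) := hf2.const_mul _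
  have hn : ∀ h : ℝ → ℂ, Continuous h →
      ((‖coefSeq T h‖ : ℂ)) ^ 2 = ∫ x in (-(T / 2))..(T / 2), ((‖h x‖ : ℂ)) ^ 2 := fun h hh => by
    rw [← Complex.ofReal_pow, norm_coefSeq_sq hT hh.memLp_period,
      ← intervalIntegral.integral_ofReal]
    simp only [Complex.ofReal_pow]
  have hint : ∀ h : ℝ → ℂ, Continuous h →
      IntervalIntegrable (fun x => ((‖h x‖ : ℂ)) ^ 2) volume (-(T / 2)) (T / 2) := fun h hh =>
    Continuous.intervalIntegrable (by fun_prop) _ _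
  have c1 : Continuous (g + f) := hg.add hf
  have c2 : Continuous (g - f) := hg.sub hf
  have c3 : Continuous (g - fun x => Complex.I * f x) := hg.sub (continuous_const.mul hf)
  have c4 : Continuous (g + fun x => Complex.I * f x) := hg.add (continuous_const.mul hf)
  -- Polarization on both sides reduces the claim to the identity of norms for `g ± f` and `g ± i
  -- f`.
  rw [inner_eq_sum_norm_sq_div_four, ← coefSeq_add hT hg2 hf2, ← coefSeq_sub hT hg2 hf2,
    show (RCLike.I : ℂ) = Complex.I from rfl,
    ← coefSeq_const_mul hT hf2, ← coefSeq_sub hT hg2 hI, ← coefSeq_add hT hg2 hI]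
  change (((‖coefSeq T (g + f)‖ : ℂ)) ^ 2 - ((‖coefSeq T (g - f)‖ : ℂ)) ^ 2
    + (((‖coefSeq T (g - fun x => Complex.I * f x)‖ : ℂ)) ^ 2
      - ((‖coefSeq T (g + fun x => Complex.I * f x)‖ : ℂ)) ^ 2) * Complex.I) / 4 = _
  rw [hn _ c1, hn _ c2, hn _ c3, hn _ c4, ← intervalIntegral.integral_sub (hint _ c1) (hint _ c2),
    ← intervalIntegral.integral_sub (hint _ c3) (hint _ c4),
    ← intervalIntegral.integral_mul_const, ← intervalIntegral.integral_add
      ((hint _ c1).sub (hint _ c2)) (((hint _ c3).sub (hint _ c4)).mul_const _),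
    ← intervalIntegral.integral_div]
  refine intervalIntegral.integral_congr fun x _ => ?_
  have := inner_eq_sum_norm_sq_div_four (𝕜 := ℂ) (g x) (f x)
  rw [RCLike.inner_apply, mul_comm] at this
  exact this.symm

theorem eq_of_fourierCoef_eq_ae (hT : 0 < T) {f g : ℝ → ℂ} (hf : MemLp f 2 (periodMeasure T))
    (hg : MemLp g 2 (periodMeasure T)) (h : ∀ j, fourierCoef T f j = fourierCoef T g j) :
    f =ᵐ[periodMeasure T] g := by
  have h1 := hasSum_norm_fourierCoef_sq hT (hf.sub hg)
  have h0 : ∀ j, fourierCoef T (f - g) j = 0 := fun j => by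
    rw [fourierCoef_sub (intervalIntegrable_of_memLp hT hf) (intervalIntegrable_of_memLp hT hg), h,
      sub_self]
  simp only [h0, norm_zero, ne_eq, OfNat.ofNat_ne_zero, not_false_eq_true, zero_pow] at h1
  have h2 := h1.unique hasSum_zero
  rw [integral_period_eq hT, integral_eq_zero_iff_of_nonneg (fun x => by positivity)
    (hf.sub hg).norm.integrable_sq] at h2
  filter_upwards [h2] with x hx
  simpa [sub_eq_zero] using hx

theorem _root_.Function.Periodic.ae_eq_of_period (hT : 0 < T) {f g : ℝ → ℂ}
    (hf : Function.Periodic f T) (hg : Function.Periodic g T) (h : f =ᵐ[periodMeasure T] g) :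
    f =ᵐ[volume] g := by
  have h1 : ∀ n : ℤ, ∀ᵐ x ∂volume.restrict (Ioc (-(T / 2) + n • T) (-(T / 2) + (n + 1) • T)),
      f x = g x := by
    intro n
    rw [ae_restrict_iff' measurableSet_Ioc]
    have h2 := (ae_restrict_iff' measurableSet_Ioc).1 h
    have h3 := (measurePreserving_sub_right volume (n • T)).quasiMeasurePreserving.ae h2
    filter_upwards [h3] with x hx hmem
    have hfx := hf.sub_zsmul_eq (x := x) n
    have hgx := hg.sub_zsmul_eq (x := x) n
    rw [← hfx, ← hgx]
    refine hx ⟨by linarith [hmem.1], ?_⟩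
    have := hmem.2
    rw [add_smul, one_smul] at this
    linarith
  have := ae_restrict_iUnion_iff (fun n : ℤ => Ioc (-(T / 2) + n • T) (-(T / 2) + (n + 1) • T))
    (fun x => f x = g x) (μ := volume)
  rw [iUnion_Ioc_add_zsmul hT, Measure.restrict_univ] at this
  exact this.2 h1

theorem eq_of_fourierCoef_eq (hT : 0 < T) {f g : ℝ → ℂ} (hf : Continuous f) (hg : Continuous g)
    (hfp : Function.Periodic f T) (hgp : Function.Periodic g T)
    (h : ∀ j, fourierCoef T f j = fourierCoef T g j) : f = g :=
  (Continuous.ae_eq_iff_eq volume hf hg).1 (hfp.ae_eq_of_period hT hgp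
    (eq_of_fourierCoef_eq_ae hT hf.memLp_period hg.memLp_period h))

end Fourier

/-! ### `H_1(S_T)` as `ℓ²(ℤ)`: synthesis, analysis and embeddings. -/

section Sobolev

variable {T : ℝ}

theorem summable_weight_rpow (hT : 0 < T) {s : ℝ} (hs : 1 / 2 < s) :
    Summable fun j : ℤ => weight T j ^ (-s) := by
  have h1 : Summable fun j : ℤ => ((2 * Real.pi / T) ^ 2) ^ (-s) * |(j : ℝ)| ^ (-(2 * s)) :=
    (Real.summable_abs_int_rpow (by linarith)).mul_left _
  refine h1.of_norm_bounded_eventually ?_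
  have h0 : ∀ᶠ j : ℤ in cofinite, j ≠ 0 := (Set.finite_singleton (0 : ℤ)).compl_mem_cofinite
  filter_upwards [h0] with j hj
  have hj' : 0 < |(j : ℝ)| := abs_pos.2 (by exact_mod_cast hj)
  rw [Real.norm_of_nonneg (Real.rpow_nonneg (weight_pos T j).le _),
    show -(2 * s) = (2 : ℝ) * (-s) by ring, Real.rpow_mul hj'.le,
    ← Real.mul_rpow (by positivity) (by positivity)]
  refine Real.rpow_le_rpow_of_nonpos (by positivity) ?_ (by linarith)
  rw [weight_eq, laplaceSymbol_eq, freq, Real.rpow_two, sq_abs]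
  have : (2 * Real.pi / T) ^ 2 * (j : ℝ) ^ 2 = (2 * Real.pi * j / T) ^ 2 := by ring
  linarith

/-- The constant of the embedding of `H_1(S_T)` into the continuous functions. -/
def embConst (T : ℝ) : ℝ := (√T)⁻¹ * √(∑' j : ℤ, weight T j ^ (-(1 : ℝ)))

/-- The synthesis operator: the function whose `H_1`-normalized Fourier coefficients are `b`. -/
def synthesis (T : ℝ) (b : Seq) (x : ℝ) : ℂ :=
  ∑' j : ℤ, (((√(weight T j))⁻¹ : ℝ) : ℂ) * b j * e T j x

theorem tsum_mul_le_sqrt_mul_sqrt {a b : ℤ → ℝ} (ha : ∀ j, 0 ≤ a j) (hb : ∀ j, 0 ≤ b j)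
    (has : Summable fun j => a j ^ 2) (hbs : Summable fun j => b j ^ 2) :
    (Summable fun j => a j * b j) ∧
      ∑' j, a j * b j ≤ √(∑' j, a j ^ 2) * √(∑' j, b j ^ 2) := by
  have h := Real.summable_and_inner_le_Lp_mul_Lq_tsum_of_nonneg Real.HolderConjugate.two_two ha hb
    (by simpa using has) (by simpa using hbs)
  simpa [Real.sqrt_eq_rpow] using h

theorem sq_inv_sqrt_weight (T : ℝ) (j : ℤ) : ((√(weight T j))⁻¹) ^ 2 = weight T j ^ (-(1 : ℝ)) := by
  rw [inv_pow, Real.sq_sqrt (weight_pos T j).le, Real.rpow_neg_one]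

/-- Cauchy-Schwarz with `∑ 1 / weight < ∞`: this is the embedding of `H_1` into absolutely
convergent Fourier series. -/
theorem summable_synthesis_norm (hT : 0 < T) (b : Seq) :
    (Summable fun j => (√(weight T j))⁻¹ * ‖b j‖) ∧
      ∑' j, (√(weight T j))⁻¹ * ‖b j‖ ≤ √(∑' j : ℤ, weight T j ^ (-(1 : ℝ))) * ‖b‖ := by
  have h := tsum_mul_le_sqrt_mul_sqrt (a := fun j => (√(weight T j))⁻¹) (b := fun j => ‖b j‖)
    (fun j => by positivity) (fun j => norm_nonneg _)
    (by simpa only [sq_inv_sqrt_weight] using summable_weight_rpow hT (by norm_num))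
    (Seq.hasSum_norm_sq b).summable
  rw [← Seq.norm_sq_eq, Real.sqrt_sq (norm_nonneg _)] at h
  simpa only [sq_inv_sqrt_weight] using h

theorem norm_synthesis_term (T : ℝ) (b : Seq) (j : ℤ) (x : ℝ) :
    ‖(((√(weight T j))⁻¹ : ℝ) : ℂ) * b j * e T j x‖ =
      (√T)⁻¹ * ((√(weight T j))⁻¹ * ‖b j‖) := by
  rw [norm_mul, norm_mul, norm_e, Complex.norm_real, Real.norm_of_nonneg (by positivity), mul_comm]

theorem norm_synthesis_le_tsum (hT : 0 < T) (b : Seq) (x : ℝ) :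
    ‖synthesis T b x‖ ≤ (√T)⁻¹ * ∑' j, (√(weight T j))⁻¹ * ‖b j‖ := by
  have hs : Summable fun j => ‖(((√(weight T j))⁻¹ : ℝ) : ℂ) * b j * e T j x‖ := by
    simp only [norm_synthesis_term]
    exact (summable_synthesis_norm hT b).1.mul_left _
  refine (norm_tsum_le_tsum_norm hs).trans_eq ?_
  simp only [norm_synthesis_term]
  exact tsum_mul_left

theorem norm_synthesis_le (hT : 0 < T) (b : Seq) (x : ℝ) :
    ‖synthesis T b x‖ ≤ embConst T * ‖b‖ := by
  refine (norm_synthesis_le_tsum hT b x).trans ?_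
  rw [embConst, mul_assoc]
  exact mul_le_mul_of_nonneg_left (summable_synthesis_norm hT b).2 (by positivity)

theorem continuous_synthesis (hT : 0 < T) (b : Seq) : Continuous (synthesis T b) :=
  continuous_tsum (fun j => continuous_const.mul (continuous_e T j))
    ((summable_synthesis_norm hT b).1.mul_left _) (fun j x => (norm_synthesis_term T b j x).le)

theorem synthesis_periodic (hT : 0 < T) (b : Seq) : Function.Periodic (synthesis T b) T :=
  fun x => tsum_congr fun j => by rw [e_periodic hT.ne' j x]

theorem fourierCoef_synthesis (hT : 0 < T) (b : Seq) (j : ℤ) :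
    fourierCoef T (synthesis T b) j = (((√(weight T j))⁻¹ : ℝ) : ℂ) * b j := by
  have hsum := (summable_synthesis_norm hT b).1.mul_left ((√T)⁻¹)
  have h := intervalIntegral.hasSum_integral_of_dominated_convergence (μ := volume)
    (a := -(T / 2)) (b := T / 2)
    (F := fun k x => (((√(weight T k))⁻¹ : ℝ) : ℂ) * b k * e T k x * (starRingEnd ℂ) (e T j x))
    (f := fun x => synthesis T b x * (starRingEnd ℂ) (e T j x))
    (fun k _ => (√T)⁻¹ * ((√(weight T k))⁻¹ * ‖b k‖) * (√T)⁻¹)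
    (fun k => ((continuous_const.mul (continuous_e T k)).mul
      (continuous_conj_e T j)).aestronglyMeasurable)
    (fun k => Eventually.of_forall fun x _ => by
      rw [norm_mul, norm_synthesis_term, RCLike.norm_conj, norm_e])
    (Eventually.of_forall fun x _ => hsum.mul_right _)
    intervalIntegrable_const
    (Eventually.of_forall fun x _ => HasSum.mul_right _ (Summable.hasSum (Summable.of_norm (by
      simpa only [norm_synthesis_term] using hsum))))
  refine h.unique ?_
  refine (hasSum_ite_eq j ((((√(weight T j))⁻¹ : ℝ) : ℂ) * b j)).congr_fun fun k => ?_
  have := fourierCoef_const_mul (T := T) (e T k) ((((√(weight T k))⁻¹ : ℝ) : ℂ) * b k) j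
  rw [fourierCoef_e hT] at this
  rw [fourierCoef] at this
  rw [this]
  by_cases hk : j = k
  · subst hk; simp
  · simp [hk, Ne.symm hk]

theorem synthesis_sub (hT : 0 < T) (b c : Seq) (x : ℝ) :
    synthesis T (b - c) x = synthesis T b x - synthesis T c x := by
  have hs : ∀ b : Seq, Summable fun j => (((√(weight T j))⁻¹ : ℝ) : ℂ) * b j * e T j x :=
    fun b => Summable.of_norm (by
      simpa only [norm_synthesis_term] using (summable_synthesis_norm hT b).1.mul_left ((√T)⁻¹))
  rw [synthesis, synthesis, synthesis, ← (hs b).tsum_sub (hs c)]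
  refine tsum_congr fun j => ?_
  rw [lp.coeFn_sub, Pi.sub_apply]
  ring

/-- The analysis operator: the `H_1`-normalized Fourier coefficients of `f`. -/
def analysis (T : ℝ) (f : ℝ → ℂ) : Seq :=
  open Classical in
  if h : Memℓp (fun j => ((√(weight T j) : ℝ) : ℂ) * fourierCoef T f j) 2 then ⟨_, h⟩ else 0

theorem norm_sqrt_weight_mul_sq (T : ℝ) (f : ℝ → ℂ) (j : ℤ) :
    ‖((√(weight T j) : ℝ) : ℂ) * fourierCoef T f j‖ ^ 2 =
      weight T j ^ (1 : ℝ) * ‖fourierCoef T f j‖ ^ 2 := by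
  rw [norm_mul, mul_pow, Complex.norm_real, Real.norm_of_nonneg (by positivity),
    Real.sq_sqrt (weight_pos T j).le, Real.rpow_one]

theorem MemHs.analysis_apply {f : ℝ → ℂ} (hf : MemHs T 1 f) (j : ℤ) :
    analysis T f j = ((√(weight T j) : ℝ) : ℂ) * fourierCoef T f j := by
  rw [analysis, dif_pos (memℓp_two_of_summable
    (by simpa only [norm_sqrt_weight_mul_sq] using hf.summable))]

theorem MemHs.norm_analysis {f : ℝ → ℂ} (hf : MemHs T 1 f) : ‖analysis T f‖ = hsNorm T 1 f := by
  rw [hsNorm, ← Real.sqrt_sq (norm_nonneg (analysis T f)), Seq.norm_sq_eq]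
  congr 1
  refine tsum_congr fun j => ?_
  rw [hf.analysis_apply, norm_sqrt_weight_mul_sq]

theorem sqrt_weight_mul_inv (T : ℝ) (j : ℤ) :
    ((√(weight T j) : ℝ) : ℂ) * (((√(weight T j))⁻¹ : ℝ) : ℂ) = 1 := by
  rw [← Complex.ofReal_mul, mul_inv_cancel₀ (Real.sqrt_pos.2 (weight_pos T j)).ne',
    Complex.ofReal_one]

theorem memHs_synthesis (hT : 0 < T) (b : Seq) : MemHs T 1 (synthesis T b) := by
  refine ⟨synthesis_periodic hT b, (continuous_synthesis hT b).memLp_period, ?_⟩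
  refine (Seq.hasSum_norm_sq b).summable.congr fun j => ?_
  rw [← norm_sqrt_weight_mul_sq, fourierCoef_synthesis hT, ← mul_assoc, sqrt_weight_mul_inv,
    one_mul]

theorem analysis_synthesis (hT : 0 < T) (b : Seq) : analysis T (synthesis T b) = b :=
  lp.ext (funext fun j => by
    rw [(memHs_synthesis hT b).analysis_apply, fourierCoef_synthesis hT, ← mul_assoc,
      sqrt_weight_mul_inv, one_mul])

theorem fourierCoef_synthesis_analysis (hT : 0 < T) {f : ℝ → ℂ} (hf : MemHs T 1 f) (j : ℤ) :
    fourierCoef T (synthesis T (analysis T f)) j = fourierCoef T f j := by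
  rw [fourierCoef_synthesis hT, hf.analysis_apply, ← mul_assoc, mul_comm (((_)⁻¹ : ℝ) : ℂ),
    sqrt_weight_mul_inv, one_mul]

theorem synthesis_analysis (hT : 0 < T) {f : ℝ → ℂ} (hf : MemHs T 1 f) (hc : Continuous f) :
    synthesis T (analysis T f) = f :=
  eq_of_fourierCoef_eq hT (continuous_synthesis hT _) hc (synthesis_periodic hT _) hf.periodic
    (fourierCoef_synthesis_analysis hT hf)

theorem synthesis_analysis_ae (hT : 0 < T) {f : ℝ → ℂ} (hf : MemHs T 1 f) :
    synthesis T (analysis T f) =ᵐ[volume] f :=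
  (synthesis_periodic hT _).ae_eq_of_period hT hf.periodic
    (eq_of_fourierCoef_eq_ae hT (continuous_synthesis hT _).memLp_period hf.memLp
      (fourierCoef_synthesis_analysis hT hf))

theorem MemHs.analysis_sub (hT : 0 < T) {f g : ℝ → ℂ} (hf : MemHs T 1 f) (hg : MemHs T 1 g) :
    MemHs T 1 (f - g) ∧ analysis T (f - g) = analysis T f - analysis T g := by
  have hc : ∀ j, ((√(weight T j) : ℝ) : ℂ) * fourierCoef T (f - g) j =
      (analysis T f - analysis T g) j := fun j => by
    rw [lp.coeFn_sub, Pi.sub_apply, hf.analysis_apply, hg.analysis_apply,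
      fourierCoef_sub (intervalIntegrable_of_memLp hT hf.memLp)
        (intervalIntegrable_of_memLp hT hg.memLp)]
    ring
  have hm : MemHs T 1 (f - g) := by
    refine ⟨hf.periodic.sub hg.periodic, hf.memLp.sub hg.memLp, ?_⟩
    simp only [← norm_sqrt_weight_mul_sq, hc]
    exact (Seq.hasSum_norm_sq _).summable
  exact ⟨hm, lp.ext (funext fun j => by rw [hm.analysis_apply, hc])⟩

theorem halfSmooth_analysis (hT : 0 < T) {f : ℝ → ℂ} (hf : MemHs T 1 f) :
    halfSmooth (laplaceSymbol_nonneg T) (analysis T f) = coefSeq T f :=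
  lp.ext (funext fun j => by
    rw [halfSmooth_apply, hf.analysis_apply, ← weight_eq, coefSeq_apply hT hf.memLp, ← mul_assoc,
      mul_comm (((_)⁻¹ : ℝ) : ℂ), sqrt_weight_mul_inv, one_mul])

theorem halfSmooth_eq_coefSeq (hT : 0 < T) (b : Seq) :
    halfSmooth (laplaceSymbol_nonneg T) b = coefSeq T (synthesis T b) := by
  rw [← halfSmooth_analysis hT (memHs_synthesis hT b), analysis_synthesis hT]

theorem norm_halfSmooth_sq (hT : 0 < T) (b : Seq) :
    ‖halfSmooth (laplaceSymbol_nonneg T) b‖ ^ 2 =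
      ∫ x in (-(T / 2))..(T / 2), ‖synthesis T b x‖ ^ 2 := by
  rw [halfSmooth_eq_coefSeq hT, norm_coefSeq_sq hT (continuous_synthesis hT b).memLp_period]

/-- Interpolation between `L²` and `H_1`. -/
theorem norm_synthesis_le_interp (hT : 0 < T) (b : Seq) (x : ℝ) :
    ‖synthesis T b x‖ ≤ (√T)⁻¹ * √(∑' j : ℤ, weight T j ^ (-(3 / 4 : ℝ))) *
      (‖halfSmooth (laplaceSymbol_nonneg T) b‖ ^ (1 / 4 : ℝ) * ‖b‖ ^ (3 / 4 : ℝ)) := by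
  -- With `w` the weight, split `w^(-1/2) |b|` as `w^(-3/8) * (w^(-1/8) |b|)`. Cauchy-Schwarz uses
  -- `∑ w^(-3/4) < ∞`, which holds as `3/4 > 1/2`, and leaves `∑ w^(-1/4) |b|²`. Hölder with
  -- exponents 4 and 4/3 bounds the latter by the powers 1/4 and 3/4 of `∑ w^(-1) |b|²` and `∑
  -- |b|²`.
  have hw := fun j => weight_pos T j
  have hq : (4 : ℝ).HolderConjugate (4 / 3) := by
    rw [Real.holderConjugate_iff]; norm_num
  have hb4 : ∀ j, ((weight T j) ^ (-(1 / 4 : ℝ)) * ‖b j‖ ^ (1 / 2 : ℝ)) ^ (4 : ℝ) =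
      ‖halfSmooth (laplaceSymbol_nonneg T) b j‖ ^ 2 := fun j => by
    rw [Real.mul_rpow (Real.rpow_nonneg (hw j).le _) (Real.rpow_nonneg (norm_nonneg _) _),
      ← Real.rpow_mul (hw j).le, ← Real.rpow_mul (norm_nonneg _), halfSmooth_apply, norm_mul,
      mul_pow, Complex.norm_real, Real.norm_of_nonneg (by positivity), ← weight_eq,
      sq_inv_sqrt_weight, ← Real.rpow_natCast]
    norm_num
  have hb43 : ∀ j, (‖b j‖ ^ (3 / 2 : ℝ)) ^ (4 / 3 : ℝ) = ‖b j‖ ^ 2 := fun j => by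
    rw [← Real.rpow_mul (norm_nonneg _), ← Real.rpow_natCast]
    norm_num
  have hprod : ∀ j, (weight T j) ^ (-(1 / 4 : ℝ)) * ‖b j‖ ^ (1 / 2 : ℝ) * ‖b j‖ ^ (3 / 2 : ℝ) =
      ((weight T j) ^ (-(1 / 8 : ℝ)) * ‖b j‖) ^ 2 := fun j => by
    rw [mul_assoc, ← Real.rpow_add_of_nonneg (norm_nonneg _) (by norm_num) (by norm_num), mul_pow,
      ← Real.rpow_natCast (_ ^ _), ← Real.rpow_mul (hw j).le, ← Real.rpow_natCast ‖b j‖]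
    norm_num
  have hH := Real.summable_and_inner_le_Lp_mul_Lq_tsum_of_nonneg hq
    (f := fun j => (weight T j) ^ (-(1 / 4 : ℝ)) * ‖b j‖ ^ (1 / 2 : ℝ))
    (g := fun j => ‖b j‖ ^ (3 / 2 : ℝ))
    (fun j => mul_nonneg (Real.rpow_nonneg (hw j).le _) (Real.rpow_nonneg (norm_nonneg _) _))
    (fun j => Real.rpow_nonneg (norm_nonneg _) _)
    (by simpa only [hb4] using (Seq.hasSum_norm_sq _).summable)
    (by simpa only [hb43] using (Seq.hasSum_norm_sq b).summable)
  simp only [hb4, hb43, hprod, ← Seq.norm_sq_eq] at hH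
  have h38 : ∀ j, (weight T j ^ (-(3 / 8 : ℝ))) ^ 2 = weight T j ^ (-(3 / 4 : ℝ)) := fun j => by
    rw [← Real.rpow_natCast, ← Real.rpow_mul (hw j).le]
    norm_num
  have hC := tsum_mul_le_sqrt_mul_sqrt (a := fun j => weight T j ^ (-(3 / 8 : ℝ)))
    (b := fun j => (weight T j) ^ (-(1 / 8 : ℝ)) * ‖b j‖)
    (fun j => Real.rpow_nonneg (hw j).le _)
    (fun j => mul_nonneg (Real.rpow_nonneg (hw j).le _) (norm_nonneg _))
    (by simpa only [h38] using summable_weight_rpow hT (by norm_num)) hH.1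
  have hterm : ∀ j, weight T j ^ (-(3 / 8 : ℝ)) * ((weight T j) ^ (-(1 / 8 : ℝ)) * ‖b j‖) =
      (√(weight T j))⁻¹ * ‖b j‖ := fun j => by
    rw [← mul_assoc, ← Real.rpow_add (hw j), Real.sqrt_eq_rpow, ← Real.rpow_neg (hw j).le]
    norm_num
  simp only [hterm, h38] at hC
  refine (norm_synthesis_le_tsum hT b x).trans ?_
  rw [mul_assoc]
  refine mul_le_mul_of_nonneg_left (hC.2.trans ?_) (by positivity)
  refine mul_le_mul_of_nonneg_left ((Real.sqrt_le_sqrt hH.2).trans_eq ?_) (by positivity)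
  have hn : ∀ a c : ℝ, 0 ≤ a → (a ^ 2) ^ (c : ℝ) = a ^ (2 * c) := fun a c ha => by
    rw [← Real.rpow_natCast, ← Real.rpow_mul ha]
    norm_num
  rw [hn _ _ (norm_nonneg _), hn _ _ (norm_nonneg _),
    Real.sqrt_mul (Real.rpow_nonneg (norm_nonneg _) _), Real.sqrt_eq_rpow, Real.sqrt_eq_rpow,
    ← Real.rpow_mul (norm_nonneg _), ← Real.rpow_mul (norm_nonneg _)]
  norm_num

end Sobolev

/-! ### Sobolev bounds through translations, and the algebra property. -/

section Translation

variable {T : ℝ}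

/-- `A` bounds `f` uniformly, and `A` bounds the `L²(S_T)`-norm of the derivative of `f`, expressed
by translations. -/
structure SobolevBound (T A : ℝ) (f : ℝ → ℂ) : Prop where
  continuous : Continuous f
  periodic : Function.Periodic f T
  norm_le : ∀ x, ‖f x‖ ≤ A
  translation : ∀ h : ℝ, ∫ x in (-(T / 2))..(T / 2), ‖f (x + h) - f x‖ ^ 2 ≤ (A * h) ^ 2

theorem SobolevBound.nonneg {A : ℝ} {f : ℝ → ℂ} (hf : SobolevBound T A f) : 0 ≤ A :=
  (norm_nonneg _).trans (hf.norm_le 0)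

theorem SobolevBound.memLp {A : ℝ} {f : ℝ → ℂ} (hf : SobolevBound T A f) :
    MemLp f 2 (periodMeasure T) := hf.continuous.memLp_period

theorem hasSum_translation (hT : 0 < T) {f : ℝ → ℂ} (hc : Continuous f)
    (hp : Function.Periodic f T) (h : ℝ) :
    HasSum (fun j => ‖Complex.exp ((-(freq T j * h) : ℝ) * Complex.I) - 1‖ ^ 2 *
        ‖fourierCoef T f j‖ ^ 2)
      (∫ x in (-(T / 2))..(T / 2), ‖f (x + h) - f x‖ ^ 2) := by
  have hch : Continuous fun x => f (x + h) := by fun_prop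
  have hs := hasSum_norm_fourierCoef_sq hT (hch.sub hc).memLp_period
  refine hs.congr_fun fun j => ?_
  have h1 := fourierCoef_sub (T := T) (hch.intervalIntegrable _ _) (hc.intervalIntegrable _ _) j
  rw [fourierCoef_comp_add hT.ne' hp] at h1
  rw [h1, ← sub_one_mul, norm_mul, mul_pow]

theorem norm_exp_mul_I_sub_one_le (x : ℝ) : ‖Complex.exp (x * Complex.I) - 1‖ ≤ |x| := by
  rw [mul_comm]
  exact Real.norm_exp_I_mul_ofReal_sub_one_le

/-- A translation multiplies the coefficients by `exp (-i freq t)`, and `|exp (iθ) - 1| ≤ |θ|`. -/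
theorem translation_le_of_coef (hT : 0 < T) {f : ℝ → ℂ} (hc : Continuous f)
    (hp : Function.Periodic f T) {A : ℝ}
    (h : ∀ s : Finset ℤ, ∑ j ∈ s, laplaceSymbol T j * ‖fourierCoef T f j‖ ^ 2 ≤ A ^ 2) (t : ℝ) :
    ∫ x in (-(T / 2))..(T / 2), ‖f (x + t) - f x‖ ^ 2 ≤ (A * t) ^ 2 := by
  refine hasSum_le_of_sum_le (hasSum_translation hT hc hp t) fun s => ?_
  rw [mul_pow]
  refine le_trans ?_ (mul_le_mul_of_nonneg_right (h s) (sq_nonneg t))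
  rw [Finset.sum_mul]
  refine Finset.sum_le_sum fun j _ => ?_
  have := pow_le_pow_left₀ (norm_nonneg _) (norm_exp_mul_I_sub_one_le (-(freq T j * t))) 2
  rw [sq_abs] at this
  rw [laplaceSymbol_eq]
  nlinarith [mul_le_mul_of_nonneg_right this (sq_nonneg ‖fourierCoef T f j‖)]

/-- Divide the Parseval sum of the difference by `t²` and let `t → 0`; restricting to a finite set
of modes makes the limit termwise. -/
theorem coef_le_of_translation (hT : 0 < T) {f : ℝ → ℂ} (hc : Continuous f)
    (hp : Function.Periodic f T) {A : ℝ}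
    (h : ∀ t : ℝ, ∫ x in (-(T / 2))..(T / 2), ‖f (x + t) - f x‖ ^ 2 ≤ (A * t) ^ 2)
    (s : Finset ℤ) : ∑ j ∈ s, laplaceSymbol T j * ‖fourierCoef T f j‖ ^ 2 ≤ A ^ 2 := by
  have hlim : ∀ j : ℤ, Tendsto (fun t : ℝ =>
      ‖t⁻¹ • (Complex.exp ((-(freq T j * t) : ℝ) * Complex.I) - 1)‖ ^ 2) (𝓝[≠] 0)
      (𝓝 (laplaceSymbol T j)) := fun j => by
    have h1 : HasDerivAt (fun t : ℝ => Complex.exp ((-(freq T j * t) : ℝ) * Complex.I))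
        (-Complex.I * freq T j) 0 := by
      have := hasDerivAt_phase (2 * freq T j) 0
      simp only [mul_zero, zero_div, neg_zero, Complex.ofReal_zero, zero_mul, Complex.exp_zero,
        one_mul] at this
      convert this using 3
      · congr 3
        ring
      · push_cast
        ring
    have h2 := hasDerivAt_iff_tendsto_slope.1 h1
    have h3 := (h2.norm).pow 2
    have h4 : ‖-Complex.I * (freq T j : ℂ)‖ ^ 2 = laplaceSymbol T j := by
      rw [laplaceSymbol_eq, norm_mul, norm_neg, Complex.norm_I, one_mul, Complex.norm_real,
        Real.norm_eq_abs, sq_abs]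
    rw [h4] at h3
    refine h3.congr fun t => ?_
    simp [slope]
  have hsum := tendsto_finsetSum s fun j _ => (hlim j).mul_const (‖fourierCoef T f j‖ ^ 2)
  refine le_of_tendsto hsum ?_
  filter_upwards [self_mem_nhdsWithin] with t ht
  have ht0 : (t : ℝ) ≠ 0 := ht
  have h5 := (sum_le_hasSum s (fun _ _ => by positivity) (hasSum_translation hT hc hp t)).trans
    (h t)
  have h6 : ∀ j, ‖t⁻¹ • (Complex.exp ((-(freq T j * t) : ℝ) * Complex.I) - 1)‖ ^ 2 *
      ‖fourierCoef T f j‖ ^ 2 = (t ^ 2)⁻¹ *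
        (‖Complex.exp ((-(freq T j * t) : ℝ) * Complex.I) - 1‖ ^ 2
        * ‖fourierCoef T f j‖ ^ 2) := fun j => by
    rw [norm_smul, mul_pow, norm_inv, inv_pow, Real.norm_eq_abs, sq_abs]
    ring
  simp only [h6]
  rw [← Finset.mul_sum, inv_mul_le_iff₀ (by positivity)]
  linarith [mul_pow A t 2]

theorem SobolevBound.coef_le (hT : 0 < T) {A : ℝ} {f : ℝ → ℂ} (hf : SobolevBound T A f)
    (s : Finset ℤ) : ∑ j ∈ s, laplaceSymbol T j * ‖fourierCoef T f j‖ ^ 2 ≤ A ^ 2 :=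
  coef_le_of_translation hT hf.continuous hf.periodic hf.translation s

theorem SobolevBound.mono {A B : ℝ} {f : ℝ → ℂ} (hf : SobolevBound T A f) (h : A ≤ B) :
    SobolevBound T B f := by
  refine ⟨hf.continuous, hf.periodic, fun x => (hf.norm_le x).trans h, fun t => ?_⟩
  refine (hf.translation t).trans ?_
  rw [mul_pow, mul_pow]
  exact mul_le_mul_of_nonneg_right (pow_le_pow_left₀ hf.nonneg h 2) (sq_nonneg t)

theorem integral_period_mono (hT : 0 < T) {f g : ℝ → ℝ} (hf : Continuous f) (hg : Continuous g)
    (h : ∀ x, f x ≤ g x) :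
    ∫ x in (-(T / 2))..(T / 2), f x ≤ ∫ x in (-(T / 2))..(T / 2), g x :=
  intervalIntegral.integral_mono_on (neg_half_lt_half hT).le (hf.intervalIntegrable _ _)
    (hg.intervalIntegrable _ _) fun x _ => h x

theorem norm_add_sq_le (a b : ℂ) : ‖a + b‖ ^ 2 ≤ 2 * ‖a‖ ^ 2 + 2 * ‖b‖ ^ 2 := by
  have := pow_le_pow_left₀ (norm_nonneg _) (norm_add_le a b) 2
  nlinarith [sq_nonneg (‖a‖ - ‖b‖)]

theorem integral_norm_add_sq_le (hT : 0 < T) {f g k : ℝ → ℂ} (hf : Continuous f)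
    (hg : Continuous g) (hk : Continuous k) {a b : ℝ}
    (h : ∀ x, ‖k x‖ ^ 2 ≤ 2 * (a ^ 2 * ‖f x‖ ^ 2) + 2 * (b ^ 2 * ‖g x‖ ^ 2)) :
    ∫ x in (-(T / 2))..(T / 2), ‖k x‖ ^ 2 ≤
      2 * (a ^ 2 * ∫ x in (-(T / 2))..(T / 2), ‖f x‖ ^ 2) +
      2 * (b ^ 2 * ∫ x in (-(T / 2))..(T / 2), ‖g x‖ ^ 2) := by
  refine (integral_period_mono hT (by fun_prop) (by fun_prop) h).trans_eq ?_
  rw [intervalIntegral.integral_add (Continuous.intervalIntegrable (by fun_prop) _ _)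
    (Continuous.intervalIntegrable (by fun_prop) _ _)]
  simp only [intervalIntegral.integral_const_mul]

theorem SobolevBound.add (hT : 0 < T) {A B : ℝ} {f g : ℝ → ℂ} (hf : SobolevBound T A f)
    (hg : SobolevBound T B g) : SobolevBound T (2 * (A + B)) (fun x => f x + g x) := by
  have hA := hf.nonneg
  have hB := hg.nonneg
  have cf := hf.continuous
  have cg := hg.continuous
  refine ⟨cf.add cg, hf.periodic.add hg.periodic, fun x => ?_, fun t => ?_⟩
  · linarith [norm_add_le (f x) (g x), hf.norm_le x, hg.norm_le x]
  · have := integral_norm_add_sq_le hT (f := fun x => f (x + t) - f x)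
      (g := fun x => g (x + t) - g x) (k := fun x => f (x + t) + g (x + t) - (f x + g x))
      (a := 1) (b := 1) (by fun_prop) (by fun_prop) (by fun_prop) (fun x => by
        rw [add_sub_add_comm]
        simpa using norm_add_sq_le (f (x + t) - f x) (g (x + t) - g x))
    refine this.trans ?_
    have h1 := hf.translation t
    have h2 := hg.translation t
    have h3 : 0 ≤ A * B * t ^ 2 := by positivity
    nlinarith [sq_nonneg (A * t), sq_nonneg (B * t)]

/-- The algebra property of `H_1`. Finite differences obey an exact Leibniz rule, so no weak
derivative is needed. -/
theorem SobolevBound.mul (hT : 0 < T) {A B : ℝ} {f g : ℝ → ℂ} (hf : SobolevBound T A f)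
    (hg : SobolevBound T B g) : SobolevBound T (2 * (A * B)) (fun x => f x * g x) := by
  have hA := hf.nonneg
  have hB := hg.nonneg
  have cf := hf.continuous
  have cg := hg.continuous
  refine ⟨cf.mul cg, hf.periodic.mul hg.periodic, fun x => ?_, fun t => ?_⟩
  · rw [norm_mul]
    nlinarith [mul_le_mul (hf.norm_le x) (hg.norm_le x) (norm_nonneg _) hA, mul_nonneg hA hB]
  · have := integral_norm_add_sq_le hT (f := fun x => f (x + t) - f x)
      (g := fun x => g (x + t) - g x) (k := fun x => f (x + t) * g (x + t) - f x * g x)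
      (a := B) (b := A) (by fun_prop) (by fun_prop) (by fun_prop) (fun x => by
        have e : f (x + t) * g (x + t) - f x * g x =
          (f (x + t) - f x) * g (x + t) + f x * (g (x + t) - g x) := by ring
        rw [e]
        refine (norm_add_sq_le _ _).trans ?_
        rw [norm_mul, norm_mul, mul_pow, mul_pow]
        have h1 := pow_le_pow_left₀ (norm_nonneg _) (hg.norm_le (x + t)) 2
        have h2 := pow_le_pow_left₀ (norm_nonneg _) (hf.norm_le x) 2
        have h3 := mul_le_mul_of_nonneg_left h1 (sq_nonneg ‖f (x + t) - f x‖)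
        have h4 := mul_le_mul_of_nonneg_right h2 (sq_nonneg ‖g (x + t) - g x‖)
        linarith)
    refine this.trans ?_
    have h1 := mul_le_mul_of_nonneg_left (hf.translation t) (sq_nonneg B)
    have h2 := mul_le_mul_of_nonneg_left (hg.translation t) (sq_nonneg A)
    linarith [mul_pow A t 2, mul_pow B t 2, show (2 * (A * B) * t) ^ 2 =
      2 * (B ^ 2 * (A * t) ^ 2) + 2 * (A ^ 2 * (B * t) ^ 2) by ring]

theorem SobolevBound.conj {A : ℝ} {f : ℝ → ℂ} (hf : SobolevBound T A f) :
    SobolevBound T A (fun x => (starRingEnd ℂ) (f x)) := by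
  refine ⟨Complex.continuous_conj.comp hf.continuous, fun x => by simp only [hf.periodic x],
    fun x => ?_, fun t => ?_⟩
  · rw [RCLike.norm_conj]
    exact hf.norm_le x
  · simp only [← map_sub, RCLike.norm_conj]
    exact hf.translation t

/-- In the constant, `T` comes from integrating the uniform bound over a period and 1 from the
translation bound. -/
theorem SobolevBound.memHs (hT : 0 < T) {A : ℝ} {f : ℝ → ℂ} (hf : SobolevBound T A f) :
    MemHs T 1 f ∧ ‖analysis T f‖ ≤ √(1 + T) * A := by
  have hA := hf.nonneg
  have h2 : ∫ x in (-(T / 2))..(T / 2), ‖f x‖ ^ 2 ≤ T * A ^ 2 := by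
    refine (integral_period_mono hT (g := fun _ => A ^ 2)
      (by have := hf.continuous; fun_prop) continuous_const
      fun x => pow_le_pow_left₀ (norm_nonneg _) (hf.norm_le x) 2).trans_eq ?_
    simp
  have hsum : ∀ s : Finset ℤ, ∑ j ∈ s, weight T j ^ (1 : ℝ) * ‖fourierCoef T f j‖ ^ 2 ≤
      (1 + T) * A ^ 2 := fun s => by
    have h3 := sum_le_hasSum s (fun _ _ => by positivity) (hasSum_norm_fourierCoef_sq hT hf.memLp)
    simp only [Real.rpow_one, weight_eq, add_mul, one_mul, Finset.sum_add_distrib]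
    linarith [hf.coef_le hT s]
  have hm : MemHs T 1 f := ⟨hf.periodic, hf.memLp, summable_of_sum_le
    (fun j => mul_nonneg (Real.rpow_nonneg (weight_pos T j).le _) (sq_nonneg _)) hsum⟩
  refine ⟨hm, Seq.norm_le_of_forall_sum_le (by positivity) fun s => ?_⟩
  rw [mul_pow, Real.sq_sqrt (by positivity)]
  refine le_trans (Finset.sum_le_sum fun j _ => ?_) (hsum s)
  rw [hm.analysis_apply, norm_sqrt_weight_mul_sq]

/-- The constant that controls `SobolevBound` by the norm of `H_1(S_T)`. -/
def sobConst (T : ℝ) : ℝ := max 1 (embConst T)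

theorem one_le_sobConst (T : ℝ) : 1 ≤ sobConst T := le_max_left _ _

theorem sobolevBound_synthesis (hT : 0 < T) (b : Seq) :
    SobolevBound T (sobConst T * ‖b‖) (synthesis T b) := by
  refine ⟨continuous_synthesis hT b, synthesis_periodic hT b, fun x => ?_, fun t => ?_⟩
  · exact (norm_synthesis_le hT b x).trans
      (mul_le_mul_of_nonneg_right (le_max_right _ _) (norm_nonneg _))
  · have hle : ‖b‖ ≤ sobConst T * ‖b‖ :=
      le_mul_of_one_le_left (norm_nonneg _) (one_le_sobConst T)
    refine (translation_le_of_coef hT (continuous_synthesis hT b) (synthesis_periodic hT b)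
      (A := ‖b‖) (fun s => ?_) t).trans ?_
    · refine le_trans (Finset.sum_le_sum fun j _ => ?_)
        (sum_le_hasSum s (fun _ _ => by positivity) (Seq.hasSum_norm_sq b))
      rw [fourierCoef_synthesis hT, norm_mul, mul_pow, Complex.norm_real, Real.norm_eq_abs, sq_abs,
        inv_pow, Real.sq_sqrt (weight_pos T j).le, ← mul_assoc]
      refine mul_le_of_le_one_left (sq_nonneg _) ?_
      rw [← div_eq_mul_inv, div_le_one (weight_pos T j), weight_eq]
      linarith
    · rw [mul_pow, mul_pow]
      exact mul_le_mul_of_nonneg_right (pow_le_pow_left₀ (norm_nonneg _) hle 2) (sq_nonneg t)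

theorem sobolevBound_of_lipschitz (hT : 0 < T) {f : ℝ → ℂ} (hp : Function.Periodic f T) {A : ℝ}
    {K : NNReal} (hf : LipschitzWith K f) (hA : ∀ x, ‖f x‖ ≤ A) (hK : √T * K ≤ A) :
    SobolevBound T A f := by
  refine ⟨hf.continuous, hp, hA, fun t => ?_⟩
  have h := integral_period_mono hT (f := fun x => ‖f (x + t) - f x‖ ^ 2)
    (g := fun _ => (K * |t|) ^ 2) (by have := hf.continuous; fun_prop) continuous_const fun x => by
      refine pow_le_pow_left₀ (norm_nonneg _) ?_ 2
      simpa [dist_eq_norm] using hf.dist_le_mul (x + t) x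
  refine h.trans ?_
  have h1 : (√T * K) ^ 2 ≤ A ^ 2 := pow_le_pow_left₀ (by positivity) hK 2
  rw [mul_pow, Real.sq_sqrt hT.le] at h1
  simp only [intervalIntegral.integral_const, sub_neg_eq_add, add_halves, smul_eq_mul, mul_pow,
    sq_abs]
  nlinarith [mul_le_mul_of_nonneg_right h1 (sq_nonneg t)]

end Translation

/-! ### Convolution with the rescaled kernel as a Fourier multiplier. -/

section Convolution

variable {T : ℝ} {ζ : ℝ → ℝ}

/-- The hypotheses on the interaction profile. -/
structure IsProfile (ζ : ℝ → ℝ) : Prop where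
  nonneg : ∀ x, 0 ≤ ζ x
  even : ∀ x, ζ (-x) = ζ x
  integrable : Integrable ζ volume
  mass : ∫ x, ζ x = 1
  moment : Integrable (fun x => x * ζ x) volume

/-- The convolution of `f` with the rescaled kernel, `∫ ζ(z) f(x - εz) dz`. It is `f` for
`ε = 0`. -/
def conv (ζ : ℝ → ℝ) (ε : ℝ) (f : ℝ → ℂ) (x : ℝ) : ℂ := ∫ z, (ζ z : ℂ) * f (x - ε * z)

/-- The Fourier multiplier of the convolution operator. -/
def convSymbol (ζ : ℝ → ℝ) (T ε : ℝ) (j : ℤ) : ℂ :=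
  ∫ z, (ζ z : ℂ) * Complex.exp ((freq T j * (ε * z) : ℝ) * Complex.I)

theorem IsProfile.integrable_mul (hζ : IsProfile ζ)
    {f : ℝ → ℂ} {A : ℝ} (hf : Continuous f) (hA : ∀ x, ‖f x‖ ≤ A) :
    Integrable (fun z => (ζ z : ℂ) * f z) volume :=
  hζ.integrable.ofReal.mul_bdd hf.aestronglyMeasurable (Eventually.of_forall hA)

theorem IsProfile.integral_norm (hζ : IsProfile ζ) : ∫ z, ‖(ζ z : ℂ)‖ = 1 := by
  rw [← hζ.mass]
  refine integral_congr_ae (Eventually.of_forall fun z => ?_)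
  simp only [Complex.norm_real, Real.norm_of_nonneg (hζ.nonneg z)]

theorem IsProfile.norm_integral_mul_le (hζ : IsProfile ζ)
    {f : ℝ → ℂ} {A : ℝ} (hA : ∀ x, ‖f x‖ ≤ A) :
    ‖∫ z, (ζ z : ℂ) * f z‖ ≤ A := by
  have h : ∫ z, ‖(ζ z : ℂ)‖ * A = A := by
    rw [integral_mul_const, hζ.integral_norm, one_mul]
  refine (norm_integral_le_of_norm_le (hζ.integrable.ofReal.norm.mul_const A)
    (Eventually.of_forall fun z => ?_)).trans_eq h
  rw [norm_mul]
  exact mul_le_mul_of_nonneg_left (hA z) (norm_nonneg _)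

theorem IsProfile.continuous_conv (hζ : IsProfile ζ)
    {f : ℝ → ℂ} {A : ℝ} (hf : Continuous f) (hA : ∀ x, ‖f x‖ ≤ A)
    (ε : ℝ) : Continuous (conv ζ ε f) := by
  refine continuous_of_dominated (bound := fun z => ‖(ζ z : ℂ)‖ * A) (fun x => ?_) (fun x => ?_)
    (hζ.integrable.ofReal.norm.mul_const A) ?_
  · exact (hζ.integrable_mul (f := fun z => f (x - ε * z)) (by fun_prop) fun z => hA _).1
  · refine Eventually.of_forall fun z => ?_
    rw [norm_mul]
    exact mul_le_mul_of_nonneg_left (hA _) (norm_nonneg _)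
  · exact Eventually.of_forall fun z => by fun_prop

theorem IsProfile.norm_conv_le (hζ : IsProfile ζ)
    {f : ℝ → ℂ} {A : ℝ} (hA : ∀ x, ‖f x‖ ≤ A) (ε x : ℝ) :
    ‖conv ζ ε f x‖ ≤ A :=
  hζ.norm_integral_mul_le fun _ => hA _

theorem conv_periodic {f : ℝ → ℂ} (hf : Function.Periodic f T) (ε : ℝ) :
    Function.Periodic (conv ζ ε f) T := fun x => by
  simp only [conv, show ∀ z, x + T - ε * z = x - ε * z + T from fun z => by ring, hf _]

theorem IsProfile.conv_sub (hζ : IsProfile ζ)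
    {f g : ℝ → ℂ} {A B : ℝ} (hf : Continuous f) (hA : ∀ x, ‖f x‖ ≤ A)
    (hg : Continuous g) (hB : ∀ x, ‖g x‖ ≤ B) (ε x : ℝ) :
    conv ζ ε (fun y => f y - g y) x = conv ζ ε f x - conv ζ ε g x := by
  simp only [conv, mul_sub]
  exact integral_sub
    (hζ.integrable_mul (f := fun z => f (x - ε * z)) (by fun_prop) fun z => hA _)
    (hζ.integrable_mul (f := fun z => g (x - ε * z)) (by fun_prop) fun z => hB _)

theorem IsProfile.norm_convSymbol_le (hζ : IsProfile ζ)
    (ε : ℝ) (j : ℤ) : ‖convSymbol ζ T ε j‖ ≤ 1 :=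
  hζ.norm_integral_mul_le (f := fun z => Complex.exp ((freq T j * (ε * z) : ℝ) * Complex.I))
    fun _ => (Complex.norm_exp_ofReal_mul_I _).le

/-- The symbol is real because the profile is even; this makes the convolution symmetric and gives
the equation its energy. -/
theorem IsProfile.conj_convSymbol (hζ : IsProfile ζ) (ε : ℝ) (j : ℤ) :
    (starRingEnd ℂ) (convSymbol ζ T ε j) = convSymbol ζ T ε j := by
  rw [convSymbol, ← integral_conj, ← integral_neg_eq_self]
  refine integral_congr_ae (Eventually.of_forall fun z => ?_)
  simp only [map_mul, Complex.conj_ofReal, ← Complex.exp_conj, Complex.conj_I, hζ.even]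
  congr 2
  push_cast
  ring

theorem IsProfile.norm_convSymbol_sub_le (hζ : IsProfile ζ) (ε ε' : ℝ) (j : ℤ) :
    ‖convSymbol ζ T ε j - convSymbol ζ T ε' j‖ ≤
      (∫ z, |z * ζ z|) * |ε - ε'| * |freq T j| := by
  have hi : ∀ ε, Integrable (fun z => (ζ z : ℂ) *
      Complex.exp ((freq T j * (ε * z) : ℝ) * Complex.I)) volume := fun ε =>
    hζ.integrable_mul (f := fun z => Complex.exp ((freq T j * (ε * z) : ℝ) * Complex.I))
      (by fun_prop) fun _ => (Complex.norm_exp_ofReal_mul_I _).le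
  rw [convSymbol, convSymbol, ← integral_sub (hi ε) (hi ε'), mul_assoc, ← integral_mul_const]
  refine norm_integral_le_of_norm_le (hζ.moment.abs.mul_const _) (Eventually.of_forall fun z => ?_)
  have h1 : Complex.exp ((freq T j * (ε * z) : ℝ) * Complex.I) =
      Complex.exp ((freq T j * (ε' * z) : ℝ) * Complex.I) *
        Complex.exp ((freq T j * ((ε - ε') * z) : ℝ) * Complex.I) := by
    rw [← Complex.exp_add, ← add_mul, ← Complex.ofReal_add]
    congr 3
    ring
  rw [← mul_sub, h1, ← mul_sub_one, norm_mul, norm_mul, Complex.norm_exp_ofReal_mul_I, one_mul,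
    Complex.norm_real, Real.norm_eq_abs]
  refine (mul_le_mul_of_nonneg_left (norm_exp_mul_I_sub_one_le _) (abs_nonneg _)).trans_eq ?_
  rw [abs_mul, abs_mul, abs_mul]
  ring

/-- Fubini, then the behaviour of Fourier coefficients under the translation by `-εz`. -/
theorem IsProfile.fourierCoef_conv (hζ : IsProfile ζ)
    (hT : 0 < T) {f : ℝ → ℂ} {A : ℝ} (hf : Continuous f)
    (hp : Function.Periodic f T) (hA : ∀ x, ‖f x‖ ≤ A) (ε : ℝ) (j : ℤ) :
    fourierCoef T (conv ζ ε f) j = convSymbol ζ T ε j * fourierCoef T f j := by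
  have hint : Integrable (Function.uncurry fun x z =>
      (ζ z : ℂ) * (f (x - ε * z) * (starRingEnd ℂ) (e T j x)))
      ((volume.restrict (uIoc (-(T / 2)) (T / 2))).prod volume) := by
    rw [uIoc_of_le (neg_half_lt_half hT).le]
    have : Integrable (fun p : ℝ × ℝ => ((ζ p.2 : ℂ)))
        ((periodMeasure T).prod volume) :=
      (hζ.integrable.ofReal (𝕜 := ℂ)).comp_snd _
    refine this.mul_bdd (c := A * (√T)⁻¹) (Continuous.aestronglyMeasurable ?_)
      (Eventually.of_forall fun p => ?_)
    · exact (hf.comp (by fun_prop)).mul ((continuous_conj_e T j).comp continuous_fst)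
    · rw [norm_mul, RCLike.norm_conj, norm_e]
      exact mul_le_mul_of_nonneg_right (hA _) (by positivity)
  have h1 : fourierCoef T (conv ζ ε f) j = ∫ x in (-(T / 2))..(T / 2), ∫ z,
      (ζ z : ℂ) * (f (x - ε * z) * (starRingEnd ℂ) (e T j x)) := by
    rw [fourierCoef]
    refine intervalIntegral.integral_congr fun x _ => ?_
    simp only [conv, ← mul_assoc]
    exact (integral_mul_const _ _).symm
  rw [h1, intervalIntegral_integral_swap hint, convSymbol, ← integral_mul_const]
  refine integral_congr_ae (Eventually.of_forall fun z => ?_)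
  have h2 := fourierCoef_comp_add hT.ne' hp (-(ε * z)) j
  simp only [intervalIntegral.integral_const_mul, mul_assoc]
  rw [fourierCoef] at h2
  simp only [← sub_eq_add_neg, mul_neg, neg_neg] at h2
  rw [h2]

theorem IsProfile.sobolevBound_conv (hζ : IsProfile ζ)
    (hT : 0 < T) {A : ℝ} {f : ℝ → ℂ} (hf : SobolevBound T A f)
    (ε : ℝ) : SobolevBound T A (conv ζ ε f) := by
  have hc := hζ.continuous_conv hf.continuous hf.norm_le ε
  have hp := conv_periodic (ζ := ζ) hf.periodic ε
  refine ⟨hc, hp, hζ.norm_conv_le hf.norm_le ε, translation_le_of_coef hT hc hp fun s => ?_⟩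
  refine le_trans (Finset.sum_le_sum fun j _ => ?_) (hf.coef_le hT s)
  rw [hζ.fourierCoef_conv hT hf.continuous hf.periodic hf.norm_le, norm_mul]
  exact mul_le_mul_of_nonneg_left (pow_le_pow_left₀ (by positivity)
    (mul_le_of_le_one_left (norm_nonneg _) (hζ.norm_convSymbol_le ε j)) 2)
    (laplaceSymbol_nonneg T j)

/-- The convolution operators are contractions on `L²(S_T)`. -/
theorem IsProfile.integral_norm_conv_sq_le (hζ : IsProfile ζ)
    (hT : 0 < T) {f : ℝ → ℂ} {A : ℝ} (hf : Continuous f)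
    (hp : Function.Periodic f T) (hA : ∀ x, ‖f x‖ ≤ A) (ε : ℝ) :
    ∫ x in (-(T / 2))..(T / 2), ‖conv ζ ε f x‖ ^ 2 ≤ ∫ x in (-(T / 2))..(T / 2), ‖f x‖ ^ 2 := by
  refine hasSum_le (fun j => ?_)
    (hasSum_norm_fourierCoef_sq hT (hζ.continuous_conv hf hA ε).memLp_period)
    (hasSum_norm_fourierCoef_sq hT hf.memLp_period)
  rw [hζ.fourierCoef_conv hT hf hp hA, norm_mul]
  exact pow_le_pow_left₀ (by positivity)
    (mul_le_of_le_one_left (norm_nonneg _) (hζ.norm_convSymbol_le ε j)) 2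

/-- The convolution operators depend on `ε` in a Lipschitz way, from `H_1(S_T)` to `L²(S_T)`. -/
theorem IsProfile.integral_norm_conv_sub_sq_le (hζ : IsProfile ζ) (hT : 0 < T) {f : ℝ → ℂ} {A : ℝ}
    (hf : SobolevBound T A f) (ε ε' : ℝ) :
    ∫ x in (-(T / 2))..(T / 2), ‖conv ζ ε f x - conv ζ ε' f x‖ ^ 2 ≤
      ((∫ z, |z * ζ z|) * |ε - ε'| * A) ^ 2 := by
  have c := fun ε => hζ.continuous_conv hf.continuous hf.norm_le ε
  have hs := hasSum_norm_fourierCoef_sq hT ((c ε).sub (c ε')).memLp_period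
  refine hasSum_le_of_sum_le hs fun s => ?_
  rw [mul_pow]
  refine le_trans ?_ (mul_le_mul_of_nonneg_left (hf.coef_le hT s) (sq_nonneg _))
  rw [Finset.mul_sum]
  refine Finset.sum_le_sum fun j _ => ?_
  have h1 := fourierCoef_sub (T := T) ((c ε).intervalIntegrable _ _)
    ((c ε').intervalIntegrable _ _) j
  rw [hζ.fourierCoef_conv hT hf.continuous hf.periodic hf.norm_le,
    hζ.fourierCoef_conv hT hf.continuous hf.periodic hf.norm_le, ← sub_mul] at h1
  change ‖fourierCoef T (conv ζ ε f - conv ζ ε' f) j‖ ^ 2 ≤ _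
  rw [h1, norm_mul, mul_pow ‖_‖, ← mul_assoc, laplaceSymbol_eq, ← sq_abs (freq T j),
    ← mul_pow (_ * |ε - ε'|)]
  exact mul_le_mul_of_nonneg_right (pow_le_pow_left₀ (norm_nonneg _)
    (hζ.norm_convSymbol_sub_le ε ε' j) 2) (sq_nonneg _)

/-- The convolution operators are symmetric. -/
theorem IsProfile.integral_conj_mul_conv (hζ : IsProfile ζ)
    (hT : 0 < T) {f g : ℝ → ℂ} {A B : ℝ} (hf : Continuous f)
    (hfp : Function.Periodic f T) (hA : ∀ x, ‖f x‖ ≤ A) (hg : Continuous g)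
    (hgp : Function.Periodic g T) (hB : ∀ x, ‖g x‖ ≤ B) (ε : ℝ) :
    ∫ x in (-(T / 2))..(T / 2), (starRingEnd ℂ) (g x) * conv ζ ε f x =
      ∫ x in (-(T / 2))..(T / 2), (starRingEnd ℂ) (conv ζ ε g x) * f x := by
  have cf := hζ.continuous_conv hf hA ε
  have cg := hζ.continuous_conv hg hB ε
  rw [← inner_coefSeq hT cf hg, ← inner_coefSeq hT hf cg, lp.inner_eq_tsum, lp.inner_eq_tsum]
  refine tsum_congr fun j => ?_
  rw [coefSeq_apply hT cf.memLp_period, coefSeq_apply hT cg.memLp_period,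
    coefSeq_apply hT hf.memLp_period, coefSeq_apply hT hg.memLp_period,
    hζ.fourierCoef_conv hT hf hfp hA, hζ.fourierCoef_conv hT hg hgp hB, RCLike.inner_apply,
    RCLike.inner_apply, map_mul, hζ.conj_convSymbol]
  ring

theorem IsProfile.conv_zero (hζ : IsProfile ζ) (f : ℝ → ℂ) (x : ℝ) : conv ζ 0 f x = f x := by
  simp only [conv, zero_mul, sub_zero]
  rw [integral_mul_const, integral_complex_ofReal, hζ.mass]
  simp

/-- The reflection `y ↦ x - y` followed by the scaling `y = εz` absorbs the factor `1 / ε` of the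
kernel, and puts the local and nonlocal cases under one formula. -/
theorem IsProfile.interaction_eq (hζ : IsProfile ζ) {ε : ℝ} (hε : 0 ≤ ε) (f : ℝ → ℂ) (x : ℝ) :
    (interaction ζ ε f x : ℂ) = conv ζ ε (fun y => f y * (starRingEnd ℂ) (f y)) x := by
  have hn : ∀ y, f y * (starRingEnd ℂ) (f y) = ((‖f y‖ ^ 2 : ℝ) : ℂ) := fun y => by
    rw [Complex.mul_conj, Complex.normSq_eq_norm_sq]
  simp only [hn]
  rcases eq_or_lt_of_le hε with rfl | hε
  · rw [hζ.conv_zero, interaction, if_pos rfl]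
  · rw [interaction, if_neg hε.ne', conv]
    simp only [← Complex.ofReal_mul]
    rw [integral_complex_ofReal]
    congr 1
    rw [← integral_sub_left_eq_self _ volume x]
    simp only [sub_sub_cancel]
    have h := Measure.integral_comp_mul_left (fun y => kernel ζ ε y * ‖f (x - y)‖ ^ 2) ε
    rw [abs_of_pos (by positivity), smul_eq_mul] at h
    rw [← mul_inv_cancel_left₀ hε.ne' (∫ y, kernel ζ ε y * ‖f (x - y)‖ ^ 2), ← h,
      ← integral_const_mul]
    refine integral_congr_ae (Eventually.of_forall fun z => ?_)
    simp only [kernel]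
    rw [mul_div_cancel_left₀ _ hε.ne', ← mul_assoc, ← mul_assoc, mul_one_div_cancel hε.ne', one_mul]

theorem IsProfile.interaction_nonneg (hζ : IsProfile ζ) {ε : ℝ} (hε : 0 ≤ ε) (f : ℝ → ℂ) (x : ℝ) :
    0 ≤ interaction ζ ε f x := by
  rw [interaction]
  split_ifs
  · positivity
  · refine integral_nonneg fun y => mul_nonneg ?_ (sq_nonneg _)
    exact mul_nonneg (by positivity) (hζ.nonneg _)

end Convolution

/-! ### The Gross-Pitaevskii nonlinearity and its potential energy. -/

section Nonlinearity

variable {T : ℝ} {ζ V : ℝ → ℝ}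

/-- The density `|u|²`, as a complex-valued function. -/
def density (u : ℝ → ℂ) (x : ℝ) : ℂ := u x * (starRingEnd ℂ) (u x)

/-- The nonlinearity and the external potential of the Gross-Pitaevskii equation. -/
def nonlin (ζ V : ℝ → ℝ) (ε : ℝ) (u : ℝ → ℂ) (x : ℝ) : ℂ :=
  conv ζ ε (density u) x * u x + (V x : ℂ) * u x

/-- The nonlinearity, acting on `H_1`-normalized Fourier coefficients. -/
def gpField (T : ℝ) (ζ V : ℝ → ℝ) (ε : ℝ) (b : Seq) : Seq :=
  analysis T (nonlin ζ V ε (synthesis T b))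

/-- The potential energy. -/
def gpPotential (T : ℝ) (ζ V : ℝ → ℝ) (ε : ℝ) (b : Seq) : ℝ :=
  ∫ x in (-(T / 2))..(T / 2),
    (1 / 2 * V x + 1 / 4 * interaction ζ ε (synthesis T b) x) * ‖synthesis T b x‖ ^ 2

theorem density_eq (u : ℝ → ℂ) (x : ℝ) : density u x = ((‖u x‖ ^ 2 : ℝ) : ℂ) := by
  rw [density, Complex.mul_conj, Complex.normSq_eq_norm_sq]

theorem SobolevBound.density (hT : 0 < T) {A : ℝ} {u : ℝ → ℂ} (hu : SobolevBound T A u) :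
    SobolevBound T (2 * (A * A)) (density u) :=
  hu.mul hT hu.conj

theorem SobolevBound.norm_density_le {A : ℝ} {u : ℝ → ℂ} (hu : SobolevBound T A u) (x : ℝ) :
    ‖GP.density u x‖ ≤ A ^ 2 := by
  rw [density_eq, Complex.norm_real, Real.norm_of_nonneg (by positivity)]
  exact pow_le_pow_left₀ (norm_nonneg _) (hu.norm_le x) 2

theorem SobolevBound.nonlin (hT : 0 < T) (hζ : IsProfile ζ) {A AV : ℝ} {u : ℝ → ℂ}
    (hu : SobolevBound T A u) (hV : SobolevBound T AV fun x => (V x : ℂ)) (ε : ℝ) :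
    SobolevBound T (2 * (2 * (2 * (A * A) * A) + 2 * (AV * A))) (nonlin ζ V ε u) :=
  ((hζ.sobolevBound_conv hT (hu.density hT) ε).mul hT hu).add hT (hV.mul hT hu)

theorem memHs_nonlin_synthesis (hT : 0 < T) (hζ : IsProfile ζ) {AV : ℝ}
    (hV : SobolevBound T AV fun x => (V x : ℂ)) (ε : ℝ) (b : Seq) :
    MemHs T 1 (nonlin ζ V ε (synthesis T b)) ∧ Continuous (nonlin ζ V ε (synthesis T b)) := by
  have h := (sobolevBound_synthesis hT b).nonlin hT hζ hV ε
  exact ⟨(h.memHs hT).1, h.continuous⟩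

theorem synthesis_gpField (hT : 0 < T) (hζ : IsProfile ζ) {AV : ℝ}
    (hV : SobolevBound T AV fun x => (V x : ℂ)) (ε : ℝ) (b : Seq) :
    synthesis T (gpField T ζ V ε b) = nonlin ζ V ε (synthesis T b) :=
  synthesis_analysis hT (memHs_nonlin_synthesis hT hζ hV ε b).1
    (memHs_nonlin_synthesis hT hζ hV ε b).2

theorem SobolevBound.density_sub (hT : 0 < T) {A D : ℝ} {u w : ℝ → ℂ} (hu : SobolevBound T A u)
    (hw : SobolevBound T A w) (hd : SobolevBound T D (fun x => u x - w x)) :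
    SobolevBound T (8 * (A * D)) (fun x => GP.density u x - GP.density w x) := by
  have h := (hu.mul hT hd.conj).add hT (hd.mul hT hw.conj)
  have e : (fun x => GP.density u x - GP.density w x) = fun x =>
      u x * (starRingEnd ℂ) (u x - w x) + (u x - w x) * (starRingEnd ℂ) (w x) := by
    funext x
    simp only [GP.density, map_sub]
    ring
  rw [e]
  exact h.mono (by linarith [mul_comm A D])

/-- Telescoping writes the difference as three products, each with a factor linear in `u - w`; the
constant collects the factors 2 of `SobolevBound.add` and `SobolevBound.mul`. -/
theorem SobolevBound.nonlin_sub (hT : 0 < T) (hζ : IsProfile ζ) {A AV D : ℝ}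
    {u w : ℝ → ℂ} (hu : SobolevBound T A u) (hV : SobolevBound T AV fun x => (V x : ℂ))
    (hw : SobolevBound T A w) (hd : SobolevBound T D (fun x => u x - w x)) (ε : ℝ) :
    SobolevBound T ((80 * A ^ 2 + 4 * AV) * D)
      (GP.nonlin ζ V ε u - GP.nonlin ζ V ε w) := by
  have h := ((((hζ.sobolevBound_conv hT (hu.density hT) ε).mul hT hd).add hT
    ((hζ.sobolevBound_conv hT (hu.density_sub hT hw hd) ε).mul hT hw)).add hT (hV.mul hT hd))
  have e : (GP.nonlin ζ V ε u - GP.nonlin ζ V ε w) = fun x =>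
      conv ζ ε (GP.density u) x * (u x - w x) +
        conv ζ ε (fun y => GP.density u y - GP.density w y) x * w x + (V x : ℂ) * (u x - w x) := by
    funext x
    rw [hζ.conv_sub (hu.density hT).continuous (hu.density hT).norm_le (hw.density hT).continuous
      (hw.density hT).norm_le]
    simp only [Pi.sub_apply, GP.nonlin]
    ring
  rw [e]
  exact h.mono (by ring_nf; rfl)

theorem gpField_lipschitz (hT : 0 < T) (hζ : IsProfile ζ) {AV : ℝ}
    (hV : SobolevBound T AV fun x => (V x : ℂ)) (ε R : ℝ) :
    ∃ K : NNReal, LipschitzOnWith K (gpField T ζ V ε) (Metric.closedBall 0 R) := by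
  have hAV := hV.nonneg
  set S := sobConst T with hS
  have hS1 : 1 ≤ S := one_le_sobConst T
  refine ⟨⟨√(1 + T) * ((80 * (S * R) ^ 2 + 4 * AV) * S), by positivity⟩,
    LipschitzOnWith.of_dist_le_mul fun b hb c hc => ?_⟩
  rw [mem_closedBall_zero_iff] at hb hc
  have hu := (sobolevBound_synthesis hT b).mono (B := S * R) (by gcongr)
  have hw := (sobolevBound_synthesis hT c).mono (B := S * R) (by gcongr)
  have hd := sobolevBound_synthesis hT (b - c)
  rw [funext (synthesis_sub hT b c)] at hd
  have h := ((hu.nonlin_sub hT hζ hV hw hd ε).memHs hT).2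
  rw [(((memHs_nonlin_synthesis hT hζ hV ε b).1).analysis_sub hT
    (memHs_nonlin_synthesis hT hζ hV ε c).1).2] at h
  rw [dist_eq_norm, dist_eq_norm]
  refine h.trans_eq ?_
  change _ = √(1 + T) * ((80 * (S * R) ^ 2 + 4 * AV) * S) * ‖b - c‖
  ring

theorem norm_coefSeq_le (hT : 0 < T) {f g : ℝ → ℂ} (hf : Continuous f) (hg : Continuous g) {a : ℝ}
    (ha : 0 ≤ a) (h : ∀ x, ‖f x‖ ≤ a * ‖g x‖) : ‖coefSeq T f‖ ≤ a * ‖coefSeq T g‖ := by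
  refine (sq_le_sq₀ (norm_nonneg _) (by positivity)).1 ?_
  rw [mul_pow, norm_coefSeq_sq hT hf.memLp_period, norm_coefSeq_sq hT hg.memLp_period,
    ← intervalIntegral.integral_const_mul]
  refine integral_period_mono hT (by fun_prop) (by fun_prop) fun x => ?_
  rw [← mul_pow]
  exact pow_le_pow_left₀ (norm_nonneg _) (h x) 2

theorem norm_density_sub_le {A : ℝ} {u w : ℝ → ℂ} (hu : ∀ x, ‖u x‖ ≤ A) (hw : ∀ x, ‖w x‖ ≤ A)
    (x : ℝ) : ‖density u x - density w x‖ ≤ 2 * A * ‖u x - w x‖ := by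
  have e : density u x - density w x =
      u x * (starRingEnd ℂ) (u x - w x) + (u x - w x) * (starRingEnd ℂ) (w x) := by
    simp only [density, map_sub]
    ring
  rw [e]
  refine (norm_add_le _ _).trans ?_
  rw [norm_mul, norm_mul, RCLike.norm_conj, RCLike.norm_conj]
  nlinarith [mul_le_mul_of_nonneg_right (hu x) (norm_nonneg (u x - w x)),
    mul_le_mul_of_nonneg_right (hw x) (norm_nonneg (u x - w x))]

/-- Stability in `L²(S_T)` of the nonlinearity with respect to the function and to `ε`. -/
theorem norm_halfSmooth_gpField_sub_le (hT : 0 < T) (hζ : IsProfile ζ) {AV : ℝ}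
    (hV : SobolevBound T AV fun x => (V x : ℂ)) (ε ε' : ℝ) {R : ℝ} {b c : Seq} (hb : ‖b‖ ≤ R)
    (hc : ‖c‖ ≤ R) :
    ‖halfSmooth (laplaceSymbol_nonneg T) (gpField T ζ V ε b - gpField T ζ V ε' c)‖ ≤
      (3 * (sobConst T * R) ^ 2 + AV) * ‖halfSmooth (laplaceSymbol_nonneg T) (b - c)‖ +
      2 * (sobConst T * R) ^ 3 * (∫ z, |z * ζ z|) * |ε - ε'| := by
  have hAV := hV.nonneg
  have hS1 := one_le_sobConst T
  have hR : 0 ≤ R := (norm_nonneg _).trans hb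
  set A := sobConst T * R with hA
  have hA0 : 0 ≤ A := by positivity
  have hu := (sobolevBound_synthesis hT b).mono (B := A) (by rw [hA]; gcongr)
  have hw := (sobolevBound_synthesis hT c).mono (B := A) (by rw [hA]; gcongr)
  set u := synthesis T b with hudef
  set w := synthesis T c with hwdef
  have cu := hu.continuous
  have cw := hw.continuous
  have cV := hV.continuous
  have hdu := hu.density hT
  have hdw := hw.density hT
  have cd : Continuous fun y => density u y - density w y := hdu.continuous.sub hdw.continuous
  have bd : ∀ x, ‖density u x - density w x‖ ≤ 2 * (A * A) + 2 * (A * A) := fun x =>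
    (norm_sub_le _ _).trans (add_le_add (hdu.norm_le x) (hdw.norm_le x))
  have pd : Function.Periodic (fun y => density u y - density w y) T :=
    hdu.periodic.sub hdw.periodic
  -- The difference splits into the change of the outer factor (`k1`), of the density inside the
  -- convolution (`k2`) and of the kernel (`k3`). They contribute `A² + AV` and `2A²` times the `L²`
  -- distance, and `2A³` times the moment times `|ε - ε'|`.
  set k1 : ℝ → ℂ := fun x => (conv ζ ε (density u) x + (V x : ℂ)) * (u x - w x) with hk1
  set k2 : ℝ → ℂ := fun x => conv ζ ε (fun y => density u y - density w y) x * w x with hk2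
  set k3 : ℝ → ℂ := fun x => (conv ζ ε (density w) x - conv ζ ε' (density w) x) * w x with hk3
  have cconv : ∀ ε, Continuous (conv ζ ε (density w)) := fun ε =>
    hζ.continuous_conv hdw.continuous hdw.norm_le ε
  have cconvu : Continuous (conv ζ ε (density u)) :=
    hζ.continuous_conv hdu.continuous hdu.norm_le ε
  have cconvd : Continuous (conv ζ ε (fun y => density u y - density w y)) :=
    hζ.continuous_conv cd bd ε
  have c1 : Continuous k1 := (cconvu.add cV).mul (cu.sub cw)
  have c2 : Continuous k2 := cconvd.mul cw
  have c3 : Continuous k3 := ((cconv ε).sub (cconv ε')).mul cw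
  have hsplit : gpField T ζ V ε b - gpField T ζ V ε' c = analysis T (k1 + k2 + k3) := by
    rw [gpField, gpField, ← (((memHs_nonlin_synthesis hT hζ hV ε b).1).analysis_sub hT
      (memHs_nonlin_synthesis hT hζ hV ε' c).1).2]
    congr 1
    funext x
    simp only [Pi.sub_apply, Pi.add_apply, nonlin, hk1, hk2, hk3, ← hudef, ← hwdef]
    rw [hζ.conv_sub hdu.continuous hdu.norm_le hdw.continuous hdw.norm_le]
    ring
  have hmem : MemHs T 1 (k1 + k2 + k3) := by
    have hd := sobolevBound_synthesis hT (b - c)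
    rw [funext (synthesis_sub hT b c)] at hd
    have s1 := (((hζ.sobolevBound_conv hT hdu ε).add hT hV).mul hT hd)
    have s2 := (hζ.sobolevBound_conv hT (hu.density_sub hT hw hd) ε).mul hT hw
    have s3 := (((hζ.sobolevBound_conv hT hdw ε).memHs hT).1.analysis_sub hT
      ((hζ.sobolevBound_conv hT hdw ε').memHs hT).1).1
    -- Only some Sobolev bound is needed here, to see that the product with `w` is in `H_1`; its
    -- size plays no role.
    have s3' := sobolevBound_synthesis hT
      (analysis T (conv ζ ε (density w) - conv ζ ε' (density w)))
    rw [synthesis_analysis hT s3 ((cconv ε).sub (cconv ε'))] at s3'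
    exact (((s1.add hT s2).add hT (s3'.mul hT hw)).memHs hT).1
  have hdiff : ‖halfSmooth (laplaceSymbol_nonneg T) (b - c)‖ = ‖coefSeq T fun x => u x - w x‖ := by
    rw [halfSmooth_eq_coefSeq hT, funext (synthesis_sub hT b c)]
  rw [hsplit, halfSmooth_analysis hT hmem, coefSeq_add hT (c1.add c2).memLp_period c3.memLp_period,
    coefSeq_add hT c1.memLp_period c2.memLp_period, hdiff]
  have e1 : ‖coefSeq T k1‖ ≤ (A ^ 2 + AV) * ‖coefSeq T fun x => u x - w x‖ := by
    refine norm_coefSeq_le hT c1 (cu.sub cw) (by positivity) fun x => ?_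
    rw [hk1, norm_mul]
    refine mul_le_mul_of_nonneg_right ((norm_add_le _ _).trans (add_le_add ?_ (hV.norm_le x)))
      (norm_nonneg _)
    exact hζ.norm_conv_le hu.norm_density_le ε x
  have e2 : ‖coefSeq T k2‖ ≤ A * (2 * A * ‖coefSeq T fun x => u x - w x‖) := by
    refine (norm_coefSeq_le hT c2 cconvd hA0 fun x => ?_).trans
      (mul_le_mul_of_nonneg_left (le_trans ?_ (norm_coefSeq_le hT cd (cu.sub cw) (by positivity)
        (norm_density_sub_le hu.norm_le hw.norm_le))) hA0)
    · rw [hk2, norm_mul, mul_comm]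
      exact mul_le_mul_of_nonneg_right (hw.norm_le x) (norm_nonneg _)
    · refine (sq_le_sq₀ (norm_nonneg _) (norm_nonneg _)).1 ?_
      rw [norm_coefSeq_sq hT cconvd.memLp_period, norm_coefSeq_sq hT cd.memLp_period]
      exact hζ.integral_norm_conv_sq_le hT cd pd bd ε
  have e3 : ‖coefSeq T k3‖ ≤ A * ((∫ z, |z * ζ z|) * |ε - ε'| * (2 * (A * A))) := by
    have c4 : Continuous fun x => conv ζ ε (density w) x - conv ζ ε' (density w) x :=
      (cconv ε).sub (cconv ε')
    refine (norm_coefSeq_le hT c3 c4 hA0 fun x => ?_).trans (mul_le_mul_of_nonneg_left ?_ hA0)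
    · rw [hk3, norm_mul, mul_comm]
      exact mul_le_mul_of_nonneg_right (hw.norm_le x) (norm_nonneg _)
    · have hm : 0 ≤ ∫ z, |z * ζ z| := integral_nonneg fun z => abs_nonneg _
      refine (sq_le_sq₀ (norm_nonneg _) (by positivity)).1 ?_
      rw [norm_coefSeq_sq hT c4.memLp_period]
      exact hζ.integral_norm_conv_sub_sq_le hT hdw ε ε'
  refine (norm_add₃_le).trans ((add_le_add (add_le_add e1 e2) e3).trans_eq ?_)
  ring

theorem inner_smooth_eq_integral (hT : 0 < T) (b c : Seq) :
    inner ℂ b (smooth (laplaceSymbol_nonneg T) c) =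
      ∫ x in (-(T / 2))..(T / 2), (starRingEnd ℂ) (synthesis T b x) * synthesis T c x := by
  rw [inner_smooth_eq, halfSmooth_eq_coefSeq hT, halfSmooth_eq_coefSeq hT,
    inner_coefSeq hT (continuous_synthesis hT c) (continuous_synthesis hT b)]

theorem IsProfile.nonlin_eq (hζ : IsProfile ζ) {ε : ℝ} (hε : 0 ≤ ε) (u : ℝ → ℂ) (x : ℝ) :
    nonlin ζ V ε u x = ((interaction ζ ε u x + V x : ℝ) : ℂ) * u x := by
  have h := hζ.interaction_eq hε u x
  rw [nonlin, Complex.ofReal_add, h, add_mul]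
  rfl

/-- The integrand is `(N + V) |u|²` with a real potential, where `N` is the interaction. -/
theorem gpField_gauge (hT : 0 < T) (hζ : IsProfile ζ) {AV : ℝ}
    (hV : SobolevBound T AV fun x => (V x : ℂ)) {ε : ℝ} (hε : 0 ≤ ε) (b : Seq) :
    (inner ℂ b (smooth (laplaceSymbol_nonneg T) (gpField T ζ V ε b))).im = 0 := by
  rw [inner_smooth_eq_integral hT, synthesis_gpField hT hζ hV]
  have h : ∀ x, (starRingEnd ℂ) (synthesis T b x) * nonlin ζ V ε (synthesis T b) x =
      (((interaction ζ ε (synthesis T b) x + V x) * ‖synthesis T b x‖ ^ 2 : ℝ) : ℂ) := fun x => by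
    rw [hζ.nonlin_eq hε, mul_left_comm, mul_comm ((starRingEnd ℂ) _)]
    rw [Complex.ofReal_mul, ← density_eq, density]
  simp only [h]
  rw [intervalIntegral.integral_ofReal, Complex.ofReal_im]

theorem SobolevBound.continuous_interaction (hT : 0 < T) (hζ : IsProfile ζ) {ε : ℝ} (hε : 0 ≤ ε)
    {A : ℝ} {u : ℝ → ℂ} (hu : SobolevBound T A u) : Continuous (interaction ζ ε u) := by
  have h : interaction ζ ε u = fun x => (conv ζ ε (GP.density u) x).re := by
    funext x
    rw [← Complex.ofReal_re (interaction ζ ε u x), hζ.interaction_eq hε]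
    rfl
  rw [h]
  exact Complex.continuous_re.comp (hζ.sobolevBound_conv hT (hu.density hT) ε).continuous

theorem SobolevBound.interaction_le (hζ : IsProfile ζ) {ε : ℝ} (hε : 0 ≤ ε)
    {A : ℝ} {u : ℝ → ℂ} (hu : SobolevBound T A u) (x : ℝ) : interaction ζ ε u x ≤ A ^ 2 := by
  have h := hζ.norm_conv_le hu.norm_density_le ε x
  change ‖conv ζ ε (fun y => u y * (starRingEnd ℂ) (u y)) x‖ ≤ _ at h
  rw [← hζ.interaction_eq hε, Complex.norm_real] at h
  exact (le_abs_self _).trans h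

theorem SobolevBound.continuous_potential {AV : ℝ} (hV : SobolevBound T AV fun x => (V x : ℂ)) :
    Continuous V := by
  exact Complex.continuous_re.comp hV.continuous

theorem SobolevBound.abs_potential_le {AV : ℝ} (hV : SobolevBound T AV fun x => (V x : ℂ))
    (x : ℝ) : |V x| ≤ AV := by
  simpa using hV.norm_le x

/-- Repulsion enters here: the interaction term is nonnegative and can be dropped. -/
theorem gpPotential_lower (hT : 0 < T) (hζ : IsProfile ζ) {AV : ℝ}
    (hV : SobolevBound T AV fun x => (V x : ℂ)) {ε : ℝ} (hε : 0 ≤ ε) (b : Seq) :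
    -(AV / 2 * ‖halfSmooth (laplaceSymbol_nonneg T) b‖ ^ 2) ≤ gpPotential T ζ V ε b := by
  have hu := sobolevBound_synthesis hT b
  have cu := hu.continuous
  have cV := hV.continuous_potential
  have cN := hu.continuous_interaction hT hζ hε
  rw [norm_halfSmooth_sq hT, ← neg_mul, ← intervalIntegral.integral_const_mul]
  refine integral_period_mono hT (by fun_prop) (by fun_prop) fun x => ?_
  refine mul_le_mul_of_nonneg_right ?_ (sq_nonneg _)
  linarith [neg_le_of_abs_le (hV.abs_potential_le x), hζ.interaction_nonneg hε (synthesis T b) x]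

theorem gpPotential_upper (hT : 0 < T) (hζ : IsProfile ζ) {AV : ℝ}
    (hV : SobolevBound T AV fun x => (V x : ℂ)) {ε : ℝ} (hε : 0 ≤ ε) {C : ℝ} (b : Seq)
    (hb : ‖b‖ ≤ C) :
    gpPotential T ζ V ε b ≤ (AV / 2 + (sobConst T * C) ^ 2 / 4) * C ^ 2 := by
  have hAV := hV.nonneg
  have hS := one_le_sobConst T
  have hu := (sobolevBound_synthesis hT b).mono (B := sobConst T * C) (by gcongr)
  have cu := hu.continuous
  have cV := hV.continuous_potential
  have cN := hu.continuous_interaction hT hζ hε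
  have h1 : ‖halfSmooth (laplaceSymbol_nonneg T) b‖ ^ 2 ≤ C ^ 2 :=
    pow_le_pow_left₀ (norm_nonneg _) ((norm_diagOp_le _ _ _).trans hb) 2
  refine le_trans ?_ (mul_le_mul_of_nonneg_left h1 (by positivity))
  rw [norm_halfSmooth_sq hT, ← intervalIntegral.integral_const_mul]
  refine integral_period_mono hT (by fun_prop) (by fun_prop) fun x => ?_
  refine mul_le_mul_of_nonneg_right ?_ (sq_nonneg _)
  linarith [le_of_abs_le (hV.abs_potential_le x), hu.interaction_le hζ hε x]

/-- The first-order term of the energy in `u` is exactly the pairing with `gpField`. What remains is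
quadratic in `w - u`, and it is controlled in `L²` because convolution is an `L²` contraction and
`u`, `w` are uniformly bounded. -/
theorem gpPotential_expand (hT : 0 < T) (hζ : IsProfile ζ) {AV : ℝ}
    (hV : SobolevBound T AV fun x => (V x : ℂ)) {ε : ℝ} (hε : 0 ≤ ε) {R : ℝ} {b c : Seq}
    (hb : ‖b‖ ≤ R) (hc : ‖c‖ ≤ R) :
    |gpPotential T ζ V ε c - gpPotential T ζ V ε b -
        (inner ℂ (gpField T ζ V ε b) (smooth (laplaceSymbol_nonneg T) (c - b))).re| ≤
      (AV / 2 + 3 / 2 * (sobConst T * R) ^ 2) *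
        ‖halfSmooth (laplaceSymbol_nonneg T) (c - b)‖ ^ 2 := by
  have hAV := hV.nonneg
  have hS1 := one_le_sobConst T
  set A := sobConst T * R with hA
  have hu := (sobolevBound_synthesis hT b).mono (B := A) (by rw [hA]; gcongr)
  have hw := (sobolevBound_synthesis hT c).mono (B := A) (by rw [hA]; gcongr)
  have hA0 := hu.nonneg
  rw [inner_smooth_eq_integral hT, synthesis_gpField hT hζ hV, norm_halfSmooth_sq hT,
    funext (synthesis_sub hT c b), gpPotential, gpPotential]
  set u := synthesis T b with hudef
  set w := synthesis T c with hwdef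
  have cu := hu.continuous
  have cw := hw.continuous
  have cV := hV.continuous_potential
  have cN := hu.continuous_interaction hT hζ hε
  have cN' := hw.continuous_interaction hT hζ hε
  have hdu := hu.density hT
  have hdw := hw.density hT
  set N := interaction ζ ε u with hN
  set N' := interaction ζ ε w with hN'
  have cdd : Continuous fun y => density w y - density u y := hdw.continuous.sub hdu.continuous
  have pdd : Function.Periodic (fun y => density w y - density u y) T :=
    hdw.periodic.sub hdu.periodic
  have bdd : ∀ x, ‖density w x - density u x‖ ≤ 2 * (A * A) + 2 * (A * A) := fun x =>
    (norm_sub_le _ _).trans (add_le_add (hdw.norm_le x) (hdu.norm_le x))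
  have hNc : ∀ x, conv ζ ε (density u) x = (N x : ℂ) := fun x => (hζ.interaction_eq hε u x).symm
  have hNc' : ∀ x, conv ζ ε (density w) x = (N' x : ℂ) := fun x => (hζ.interaction_eq hε w x).symm
  have hconvd : ∀ x, conv ζ ε (fun y => density w y - density u y) x = ((N' x - N x : ℝ) : ℂ) :=
    fun x => by
      rw [hζ.conv_sub hdw.continuous hdw.norm_le hdu.continuous hdu.norm_le, hNc, hNc',
        Complex.ofReal_sub]
  have hdd : ∀ x, density w x - density u x = ((‖w x‖ ^ 2 - ‖u x‖ ^ 2 : ℝ) : ℂ) := fun x => by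
    rw [density_eq, density_eq, Complex.ofReal_sub]
  -- Symmetry of the convolution: this cancels the one remainder term in `hpt` that is not quadratic
  -- in the difference.
  have hsymm : ∫ x in (-(T / 2))..(T / 2), ‖w x‖ ^ 2 * (N' x - N x) =
      ∫ x in (-(T / 2))..(T / 2), N' x * (‖w x‖ ^ 2 - ‖u x‖ ^ 2) := by
    have h := hζ.integral_conj_mul_conv hT cdd pdd bdd hdw.continuous hdw.periodic hdw.norm_le ε
    simp only [hconvd, hNc'] at h
    simp only [hdd] at h
    simp only [density_eq w, Complex.conj_ofReal, ← Complex.ofReal_mul] at h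
    rw [intervalIntegral.integral_ofReal, intervalIntegral.integral_ofReal] at h
    exact_mod_cast h
  have hcontr : ∫ x in (-(T / 2))..(T / 2), (N' x - N x) ^ 2 ≤
      ∫ x in (-(T / 2))..(T / 2), (‖w x‖ ^ 2 - ‖u x‖ ^ 2) ^ 2 := by
    have h := hζ.integral_norm_conv_sq_le hT cdd pdd bdd ε
    simp only [hconvd] at h
    simpa only [hdd, Complex.norm_real, Real.norm_eq_abs, sq_abs] using h
  have hdens : ∫ x in (-(T / 2))..(T / 2), (‖w x‖ ^ 2 - ‖u x‖ ^ 2) ^ 2 ≤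
      4 * A ^ 2 * ∫ x in (-(T / 2))..(T / 2), ‖w x - u x‖ ^ 2 := by
    rw [← intervalIntegral.integral_const_mul]
    refine integral_period_mono hT (by fun_prop) (by fun_prop) fun x => ?_
    have h := norm_density_sub_le hw.norm_le hu.norm_le x
    rw [hdd, Complex.norm_real] at h
    have h2 := pow_le_pow_left₀ (norm_nonneg _) h 2
    rw [Real.norm_eq_abs, sq_abs] at h2
    linarith [mul_pow (2 * A) ‖w x - u x‖ 2, mul_pow 2 A 2]
  have hre : (∫ x in (-(T / 2))..(T / 2), (starRingEnd ℂ) (nonlin ζ V ε u x) * (w x - u x)).re =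
      ∫ x in (-(T / 2))..(T / 2), (N x + V x) * ((starRingEnd ℂ) (u x) * (w x - u x)).re := by
    have hc : Continuous fun x => (starRingEnd ℂ) (nonlin ζ V ε u x) * (w x - u x) :=
      (Complex.continuous_conj.comp (hu.nonlin hT hζ hV ε).continuous).mul (cw.sub cu)
    have h := Complex.reCLM.intervalIntegral_comp_comm (hc.intervalIntegrable (-(T / 2)) (T / 2)
      (μ := volume))
    simp only [Complex.reCLM_apply] at h
    rw [← h]
    refine intervalIntegral.integral_congr fun x _ => ?_
    simp only [hζ.nonlin_eq hε, map_mul, Complex.conj_ofReal, mul_assoc, Complex.re_ofReal_mul, hN]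
  have cre : Continuous fun x => ((starRingEnd ℂ) (u x) * (w x - u x)).re :=
    Complex.continuous_re.comp ((Complex.continuous_conj.comp cu).mul (cw.sub cu))
  have hpt : ∀ x, (1 / 2 * V x + 1 / 4 * N' x) * ‖w x‖ ^ 2 - (1 / 2 * V x + 1 / 4 * N x) * ‖u x‖ ^ 2
      - (N x + V x) * ((starRingEnd ℂ) (u x) * (w x - u x)).re =
      (1 / 2 * (V x + N x) * ‖w x - u x‖ ^ 2
        + 1 / 4 * ((‖w x‖ ^ 2 - ‖u x‖ ^ 2) * (N' x - N x)))
        + 1 / 4 * (‖w x‖ ^ 2 * (N' x - N x) - N' x * (‖w x‖ ^ 2 - ‖u x‖ ^ 2)) := fun x => by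
    have hn : ‖w x‖ ^ 2 = ‖u x‖ ^ 2 + 2 * ((starRingEnd ℂ) (u x) * (w x - u x)).re
        + ‖w x - u x‖ ^ 2 := by
      simp only [← Complex.normSq_eq_norm_sq, Complex.normSq_apply, Complex.mul_re, Complex.conj_re,
        Complex.conj_im, Complex.sub_re, Complex.sub_im]
      ring
    rw [hn]
    ring
  have hint : ∀ {f : ℝ → ℝ}, Continuous f → IntervalIntegrable f volume (-(T / 2)) (T / 2) :=
    fun hf => hf.intervalIntegrable _ _
  rw [hre, ← intervalIntegral.integral_sub (hint (by fun_prop)) (hint (by fun_prop)),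
    ← intervalIntegral.integral_sub (hint (by fun_prop)) (hint (by fun_prop))]
  simp only [hpt]
  rw [intervalIntegral.integral_add (hint (by fun_prop)) (hint (by fun_prop)),
    intervalIntegral.integral_const_mul, intervalIntegral.integral_sub (hint (by fun_prop))
      (hint (by fun_prop)), hsymm, sub_self, mul_zero, add_zero]
  have hbound : |∫ x in (-(T / 2))..(T / 2), (1 / 2 * (V x + N x) * ‖w x - u x‖ ^ 2
        + 1 / 4 * ((‖w x‖ ^ 2 - ‖u x‖ ^ 2) * (N' x - N x)))| ≤
      ∫ x in (-(T / 2))..(T / 2), (1 / 2 * (AV + A ^ 2) * ‖w x - u x‖ ^ 2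
        + 1 / 8 * ((‖w x‖ ^ 2 - ‖u x‖ ^ 2) ^ 2 + (N' x - N x) ^ 2)) := by
    refine (intervalIntegral.abs_integral_le_integral_abs (neg_half_lt_half hT).le).trans ?_
    refine integral_period_mono hT (by fun_prop) (by fun_prop) fun x => ?_
    have hVN : |V x + N x| ≤ AV + A ^ 2 := by
      refine (abs_add_le _ _).trans (add_le_add (hV.abs_potential_le x) ?_)
      rw [abs_of_nonneg (hζ.interaction_nonneg hε u x)]
      exact hu.interaction_le hζ hε x
    refine (abs_add_le _ _).trans (add_le_add ?_ ?_)
    · rw [abs_mul, abs_mul, abs_of_nonneg (sq_nonneg ‖w x - u x‖), abs_of_pos (by norm_num)]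
      exact mul_le_mul_of_nonneg_right (mul_le_mul_of_nonneg_left hVN (by norm_num)) (sq_nonneg _)
    · rw [abs_le]
      constructor <;>
      nlinarith [sq_nonneg ((‖w x‖ ^ 2 - ‖u x‖ ^ 2) - (N' x - N x)),
        sq_nonneg ((‖w x‖ ^ 2 - ‖u x‖ ^ 2) + (N' x - N x))]
  refine hbound.trans ?_
  rw [intervalIntegral.integral_add (hint (by fun_prop)) (hint (by fun_prop)),
    intervalIntegral.integral_const_mul, intervalIntegral.integral_const_mul,
    intervalIntegral.integral_add (hint (by fun_prop)) (hint (by fun_prop))]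
  linarith

theorem isHamiltonian_gp (hT : 0 < T) (hζ : IsProfile ζ) {AV : ℝ}
    (hV : SobolevBound T AV fun x => (V x : ℂ)) {ε : ℝ} (hε : 0 ≤ ε) :
    IsHamiltonian (laplaceSymbol_nonneg T) (gpField T ζ V ε) (gpPotential T ζ V ε) :=
  ⟨gpField_lipschitz hT hζ hV ε, gpField_gauge hT hζ hV hε,
    fun R => ⟨AV / 2 + 3 / 2 * (sobConst T * R) ^ 2, fun _ _ hb hc =>
      gpPotential_expand hT hζ hV hε hb hc⟩⟩

end Nonlinearity

/-! ### Weak solutions and the interaction picture. -/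

section WeakSolutions

variable {T : ℝ} {ζ V : ℝ → ℝ}

theorem exists_sobolevBound_of_contDiff (hT : 0 < T) {f : ℝ → ℂ} (hf : ContDiff ℝ ∞ f)
    (hp : Function.Periodic f T) : ∃ A, SobolevBound T A f := by
  have hd : Differentiable ℝ f := hf.differentiable (by simp)
  have hc : Continuous (deriv f) := hf.continuous_deriv (by simp)
  have hpd : Function.Periodic (deriv f) T := fun x => by
    rw [← deriv_comp_add_const]
    congr 1
    exact funext hp
  obtain ⟨A, hA⟩ := (hp.isBounded_of_continuous hT.ne' hf.continuous).exists_norm_le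
  obtain ⟨B, hB⟩ := (hpd.isBounded_of_continuous hT.ne' hc).exists_norm_le
  have hB0 : 0 ≤ B := (norm_nonneg _).trans (hB _ (mem_range_self 0))
  have hL : LipschitzWith ⟨B, hB0⟩ f := lipschitzWith_of_nnnorm_deriv_le hd fun x =>
    hB _ (mem_range_self x)
  exact ⟨max A (√T * B), sobolevBound_of_lipschitz hT hp hL
    (fun x => (hA _ (mem_range_self x)).trans (le_max_left _ _)) (le_max_right _ _)⟩

theorem hasDerivAt_conj_e (T : ℝ) (j : ℤ) (x : ℝ) :
    HasDerivAt (fun x => (starRingEnd ℂ) (e T j x))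
      (Complex.I * freq T j * (starRingEnd ℂ) (e T j x)) x := by
  have h := (hasDerivAt_phase (-2 * freq T j) x).const_mul (((√T)⁻¹ : ℝ) : ℂ)
  simp only [show ∀ s, -(-2 * freq T j * s / 2) = freq T j * s from fun s => by ring,
    ← conj_e_eq] at h
  refine h.congr_deriv ?_
  rw [conj_e_eq]
  push_cast
  ring

theorem fourierCoef_of_hasDerivAt (hT : T ≠ 0) {f f' : ℝ → ℂ} (hf : ∀ x, HasDerivAt f (f' x) x)
    (hc : Continuous f') (hp : Function.Periodic f T) (j : ℤ) :
    fourierCoef T f' j = -(Complex.I * freq T j) * fourierCoef T f j := by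
  have hi : IntervalIntegrable (fun x => Complex.I * freq T j * (starRingEnd ℂ) (e T j x)) volume
      (-(T / 2)) (T / 2) :=
    (continuous_const.mul (continuous_conj_e T j)).intervalIntegrable _ _
  have h := intervalIntegral.integral_mul_deriv_eq_deriv_mul (a := -(T / 2)) (b := T / 2)
    (fun x _ => hf x) (fun x _ => hasDerivAt_conj_e T j x) (hc.intervalIntegrable _ _) hi
  have e1 : f (T / 2) = f (-(T / 2)) := by
    rw [← hp (-(T / 2))]
    congr 1
    ring
  have e2 : e T j (T / 2) = e T j (-(T / 2)) := by
    rw [← e_periodic hT j (-(T / 2))]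
    congr 1
    ring
  rw [e1, e2, sub_self, zero_sub] at h
  rw [fourierCoef, fourierCoef, ← intervalIntegral.integral_const_mul, ← neg_inj, ← h,
    ← intervalIntegral.integral_neg]
  refine intervalIntegral.integral_congr fun x _ => ?_
  ring

theorem iteratedDeriv_two_conj_e (T : ℝ) (j : ℤ) :
    iteratedDeriv 2 (fun x => (starRingEnd ℂ) (e T j x)) =
      fun x => -(laplaceSymbol T j : ℂ) * (starRingEnd ℂ) (e T j x) := by
  have h1 : deriv (fun x => (starRingEnd ℂ) (e T j x)) =
      fun x => Complex.I * freq T j * (starRingEnd ℂ) (e T j x) :=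
    funext fun x => (hasDerivAt_conj_e T j x).deriv
  rw [iteratedDeriv_succ, iteratedDeriv_one, h1]
  funext x
  rw [((hasDerivAt_conj_e T j x).const_mul _).deriv, ← mul_assoc, laplaceSymbol_eq]
  push_cast
  linear_combination ((freq T j : ℂ) ^ 2 * (starRingEnd ℂ) (e T j x)) * Complex.I_sq

theorem contDiff_conj_e (T : ℝ) (j : ℤ) : ContDiff ℝ ∞ fun x => (starRingEnd ℂ) (e T j x) := by
  simp only [conj_e_eq]
  refine contDiff_const.mul (ContDiff.cexp (ContDiff.mul ?_ contDiff_const))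
  exact Complex.ofRealCLM.contDiff.comp (contDiff_const.mul contDiff_id)

/-- The right-hand side of the weak formulation. -/
theorem weak_rhs_eq (hT : 0 < T) (hζ : IsProfile ζ) {AV : ℝ}
    (hV : SobolevBound T AV fun x => (V x : ℂ)) {ε : ℝ} (hε : 0 ≤ ε) (b : Seq) {φ : ℝ → ℂ}
    (hφ : ContDiff ℝ ∞ φ) :
    ∫ x in (-(T / 2))..(T / 2),
        (-(1 / 2) * synthesis T b x * iteratedDeriv 2 φ x
          + (1 : ℝ) * synthesis T b x * (interaction ζ ε (synthesis T b) x : ℂ) * φ x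
          + (V x : ℂ) * synthesis T b x * φ x) =
      -(1 / 2) * (∫ x in (-(T / 2))..(T / 2), synthesis T b x * iteratedDeriv 2 φ x) +
        ∫ x in (-(T / 2))..(T / 2), nonlin ζ V ε (synthesis T b) x * φ x := by
  have c1 : Continuous (iteratedDeriv 2 φ) :=
    hφ.continuous_iteratedDeriv 2 (WithTop.coe_le_coe.2 (le_top : (2 : ℕ∞) ≤ ⊤))
  have c2 := continuous_synthesis hT b
  have c3 := (memHs_nonlin_synthesis hT hζ hV ε b).2
  have c4 := hφ.continuous
  have i1 : IntervalIntegrable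
      (fun x => -(1 / 2 : ℂ) * (synthesis T b x * iteratedDeriv 2 φ x)) volume
      (-(T / 2)) (T / 2) := (continuous_const.mul (c2.mul c1)).intervalIntegrable _ _
  have i2 : IntervalIntegrable (fun x => nonlin ζ V ε (synthesis T b) x * φ x) volume
      (-(T / 2)) (T / 2) := (c3.mul c4).intervalIntegrable _ _
  rw [← intervalIntegral.integral_const_mul, ← intervalIntegral.integral_add i1 i2]
  refine intervalIntegral.integral_congr fun x _ => ?_
  simp only [hζ.nonlin_eq hε]
  push_cast
  ring

/-- Integrating by parts twice multiplies the coefficients of the test function by `-λ`. On the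
other side `1 - smooth` has the symbol `λ / (1 + λ)`, and the two square roots of the weight in the
`H_1` coordinates cancel the denominator. -/
theorem inner_analysis_sub_smooth (hT : 0 < T) (b : Seq) {φ : ℝ → ℂ} (hφ : ContDiff ℝ ∞ φ)
    (hp : Function.Periodic φ T) :
    inner ℂ (analysis T fun x => (starRingEnd ℂ) (φ x)) (b - smooth (laplaceSymbol_nonneg T) b) =
      -∫ x in (-(T / 2))..(T / 2), synthesis T b x * iteratedDeriv 2 φ x := by
  obtain ⟨A, hA⟩ := exists_sobolevBound_of_contDiff hT hφ hp
  have hm := (hA.conj.memHs hT).1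
  have hφ1 : ContDiff ℝ ∞ (deriv φ) := ((contDiff_infty_iff_deriv).1 hφ).2
  have h1 : ∀ x, HasDerivAt φ (deriv φ x) x := fun x =>
    (hφ.differentiable (by simp) x).hasDerivAt
  have h2 : ∀ x, HasDerivAt (deriv φ) (iteratedDeriv 2 φ x) x := fun x => by
    rw [iteratedDeriv_succ, iteratedDeriv_one]
    exact (hφ1.differentiable (by simp) x).hasDerivAt
  have c2 : Continuous (iteratedDeriv 2 φ) :=
    hφ.continuous_iteratedDeriv 2 (WithTop.coe_le_coe.2 (le_top : (2 : ℕ∞) ≤ ⊤))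
  have hpd : Function.Periodic (deriv φ) T := fun x => by
    rw [← deriv_comp_add_const]
    congr 1
    exact funext hp
  have hstar : ∀ {f f' : ℝ → ℂ}, (∀ x, HasDerivAt f (f' x) x) →
      ∀ x, HasDerivAt (fun x => (starRingEnd ℂ) (f x)) ((starRingEnd ℂ) (f' x)) x := fun h x =>
    Complex.conjCLE.toContinuousLinearMap.hasFDerivAt.comp_hasDerivAt x (h x)
  have hcoef : ∀ j, fourierCoef T (fun x => (starRingEnd ℂ) (iteratedDeriv 2 φ x)) j =
      -(laplaceSymbol T j : ℂ) * fourierCoef T (fun x => (starRingEnd ℂ) (φ x)) j := fun j => by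
    rw [fourierCoef_of_hasDerivAt hT.ne' (hstar h2) (Complex.continuous_conj.comp c2)
      (fun x => by simp only [hpd x]),
      fourierCoef_of_hasDerivAt hT.ne' (hstar h1) (Complex.continuous_conj.comp hφ1.continuous)
      (fun x => by simp only [hp x]), ← mul_assoc, laplaceSymbol_eq]
    push_cast
    linear_combination ((freq T j : ℂ) ^ 2 *
      fourierCoef T (fun x => (starRingEnd ℂ) (φ x)) j) * Complex.I_sq
  have c2' : Continuous fun x => (starRingEnd ℂ) (iteratedDeriv 2 φ x) :=
    Complex.continuous_conj.comp c2
  have cs := continuous_synthesis hT b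
  have hpars := inner_coefSeq hT cs c2'
  simp only [Complex.conj_conj, mul_comm (iteratedDeriv 2 φ _)] at hpars
  rw [← hpars, lp.inner_eq_tsum, lp.inner_eq_tsum, ← tsum_neg]
  refine tsum_congr fun j => ?_
  rw [hm.analysis_apply, coefSeq_apply hT cs.memLp_period, coefSeq_apply hT c2'.memLp_period,
    fourierCoef_synthesis hT, hcoef, lp.coeFn_sub, Pi.sub_apply, smooth_apply, ← weight_eq,
    RCLike.inner_apply, RCLike.inner_apply, map_mul, map_mul, map_neg, Complex.conj_ofReal,
    Complex.conj_ofReal]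
  generalize (starRingEnd ℂ) (fourierCoef T (fun x => (starRingEnd ℂ) (φ x)) j) = z
  have hw := weight_pos T j
  have hs : √(weight T j) * (1 - (weight T j)⁻¹) = laplaceSymbol T j * (√(weight T j))⁻¹ := by
    have hq := Real.sq_sqrt hw.le
    have hq0 := (Real.sqrt_pos.2 hw).ne'
    have hl : laplaceSymbol T j = weight T j - 1 := by rw [weight_eq]; ring
    rw [hl]
    field_simp
    rw [hq]
  have hs' := congrArg (Complex.ofReal) hs
  push_cast at hs' ⊢
  linear_combination (b j * z) * hs'

/-- A solution in the interaction picture gives a weak solution. -/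
theorem IsInteractionSol.isSolutionOn (hT : 0 < T) (hζ : IsProfile ζ) {AV : ℝ}
    (hV : SobolevBound T AV fun x => (V x : ℂ)) {ε : ℝ} (hε : 0 ≤ ε) {J : Set ℝ} (hJ : Convex ℝ J)
    {v : ℝ → Seq} (hv : IsInteractionSol (laplaceSymbol T) (gpField T ζ V ε) J v) {u₀ : ℝ → ℂ}
    (h0 : synthesis T (v 0) =ᵐ[volume] u₀) :
    IsSolutionOn T 1 V ζ ε J u₀ (fun t => synthesis T (freeEvol (laplaceSymbol T) t (v t))) where
  continuous_space t _ := continuous_synthesis hT _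
  memHs t _ := memHs_synthesis hT _
  continuous_time t ht := by
    have h := hv.continuousOn_freeEvol t ht
    rw [ContinuousWithinAt, tendsto_iff_norm_sub_tendsto_zero] at h
    refine h.congr fun s => ?_
    have h1 := (memHs_synthesis hT (freeEvol (laplaceSymbol T) s (v s))).analysis_sub hT
      (memHs_synthesis hT (freeEvol (laplaceSymbol T) t (v t)))
    rw [← h1.1.norm_analysis, h1.2, analysis_synthesis hT, analysis_synthesis hT]
  initial := by simpa only [freeEvol_zero] using h0
  equation φ hφ hp t ht := by
    obtain ⟨A, hA⟩ := exists_sobolevBound_of_contDiff hT hφ hp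
    have hm := (hA.conj.memHs hT).1
    -- Pairing with a test function is a bounded functional of `smooth b`, and `smooth b` is
    -- differentiable along the solution.
    have hpair : ∀ b, ∫ x in (-(T / 2))..(T / 2), synthesis T b x * φ x =
        inner ℂ (analysis T fun x => (starRingEnd ℂ) (φ x))
          (smooth (laplaceSymbol_nonneg T) b) := by
      intro b
      rw [inner_smooth_eq_integral hT, synthesis_analysis hT hm hA.conj.continuous]
      refine intervalIntegral.integral_congr fun x _ => ?_
      simp only [Complex.conj_conj]
      ring
    have hd := hv.hasDerivWithinAt_smooth (laplaceSymbol_nonneg T)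
      (continuous_of_lipschitzOnWith_balls (gpField_lipschitz hT hζ hV ε)) hJ ht
    have hd' := (hasDerivWithinAt_const t J
      (analysis T fun x => (starRingEnd ℂ) (φ x))).inner ℂ hd
    simp only [← hpair] at hd'
    refine hd'.congr_deriv ?_
    rw [weak_rhs_eq hT hζ hV hε _ hφ, inner_smul_right, inner_add_right, inner_smul_right,
      inner_analysis_sub_smooth hT _ hφ hp, ← hpair, synthesis_gpField hT hζ hV, inner_zero_left,
      add_zero]
    ring

/-- A weak solution gives a solution in the interaction picture. -/
theorem IsSolutionOn.isInteractionSol (hT : 0 < T) (hζ : IsProfile ζ) {AV : ℝ}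
    (hV : SobolevBound T AV fun x => (V x : ℂ)) {ε : ℝ} (hε : 0 ≤ ε) {J : Set ℝ} (hJ : Convex ℝ J)
    {u : ℝ → ℝ → ℂ} {u₀ : ℝ → ℂ} (hu : IsSolutionOn T 1 V ζ ε J u₀ u) :
    IsInteractionSol (laplaceSymbol T) (gpField T ζ V ε) J
      (fun t => freeEvol (laplaceSymbol T) (-t) (analysis T (u t))) := by
  have hcont : ContinuousOn (fun t => analysis T (u t)) J := fun t ht => by
    rw [ContinuousWithinAt, tendsto_iff_norm_sub_tendsto_zero]
    refine (hu.continuous_time t ht).congr' ?_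
    filter_upwards [self_mem_nhdsWithin] with s hs
    have h1 := (hu.memHs s hs).analysis_sub hT (hu.memHs t ht)
    rw [← h1.1.norm_analysis, h1.2]
  have hΦ := continuous_of_lipschitzOnWith_balls (gpField_lipschitz hT hζ hV ε)
  have hsyn : ∀ t ∈ J, synthesis T (analysis T (u t)) = u t := fun t ht =>
    synthesis_analysis hT (hu.memHs t ht) (hu.continuous_space t ht)
  have hg : ContinuousOn (fun t => freeEvol (laplaceSymbol T) (-t)
      (gpField T ζ V ε (analysis T (u t)))) J :=
    continuousOn_freeEvol _ continuous_neg (hΦ.comp_continuousOn hcont)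
  intro t ht
  simp only [interactionField, freeEvol_freeEvol_neg]
  refine hasDerivWithinAt_of_coord hJ (g := fun t => -Complex.I •
    freeEvol (laplaceSymbol T) (-t) (gpField T ζ V ε (analysis T (u t))))
    (hg.const_smul (-Complex.I))
    (fun j t ht => ?_) ht
  -- Testing with the conjugate of `e T j` gives a scalar equation for each Fourier coefficient. The
  -- phase removes its linear term, and continuity of the field lifts the coordinatewise derivatives
  -- to `ℓ²(ℤ)`.
  have hcoef : HasDerivWithinAt (fun s => fourierCoef T (u s) j)
      (-Complex.I * (1 / 2 * laplaceSymbol T j * fourierCoef T (u t) j +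
        fourierCoef T (nonlin ζ V ε (u t)) j)) J t := by
    have h := hu.equation _ (contDiff_conj_e T j)
      (fun x => by simp only [e_periodic hT.ne' j x]) t ht
    refine h.congr_deriv ?_
    have h2 := weak_rhs_eq hT hζ hV hε (analysis T (u t)) (contDiff_conj_e T j)
    rw [hsyn t ht] at h2
    rw [h2, iteratedDeriv_two_conj_e]
    have h3 : ∫ x in (-(T / 2))..(T / 2), u t x *
        (-(laplaceSymbol T j : ℂ) * (starRingEnd ℂ) (e T j x)) =
        -(laplaceSymbol T j : ℂ) * fourierCoef T (u t) j := by
      rw [fourierCoef, ← intervalIntegral.integral_const_mul]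
      refine intervalIntegral.integral_congr fun x _ => ?_
      ring
    rw [h3, fourierCoef, fourierCoef]
    ring
  have hphase := (hasDerivAt_phase (-laplaceSymbol T j) t).hasDerivWithinAt (s := J)
  have hprod := (hphase.mul hcoef).const_mul ((√(weight T j) : ℝ) : ℂ)
  have hfun : ∀ s ∈ J, freeEvol (laplaceSymbol T) (-s) (analysis T (u s)) j =
      ((√(weight T j) : ℝ) : ℂ) * (Complex.exp ((-(-laplaceSymbol T j * s / 2) : ℝ) * Complex.I) *
        fourierCoef T (u s) j) := fun s hs => by
    rw [freeEvol_apply, (hu.memHs s hs).analysis_apply, mul_left_comm]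
    congr 4
    ring_nf
  refine (hprod.congr_of_mem hfun ht).congr_deriv ?_
  have hnl := (memHs_nonlin_synthesis hT hζ hV ε (analysis T (u t))).1
  rw [lp.coeFn_smul, Pi.smul_apply, freeEvol_apply, gpField, hnl.analysis_apply, hsyn t ht,
    smul_eq_mul, show -(laplaceSymbol T j * -t / 2) = -(-laplaceSymbol T j * t / 2) by ring]
  push_cast
  ring

end WeakSolutions

/-! ### Global solutions, uniqueness and the uniform distance. -/

section GlobalFlow

variable {T : ℝ} {ζ V : ℝ → ℝ} {AV C : ℝ}

/-- The bound that conservation of mass and energy gives for the `H_1` norm of a solution with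
initial value of norm at most `C`. -/
def energyBound (T AV C : ℝ) : ℝ :=
  √(C ^ 2 + 4 * ((AV / 2 + (sobConst T * C) ^ 2 / 4) * C ^ 2) + 4 * (AV / 2) * C ^ 2)

theorem le_energyBound (T : ℝ) (hAV : 0 ≤ AV) : C ≤ energyBound T AV C := by
  refine Real.le_sqrt_of_sq_le ?_
  have : 0 ≤ 4 * ((AV / 2 + (sobConst T * C) ^ 2 / 4) * C ^ 2) + 4 * (AV / 2) * C ^ 2 := by
    positivity
  linarith

theorem IsInteractionSol.norm_le_energyBound (hT : 0 < T) (hζ : IsProfile ζ)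
    (hV : SobolevBound T AV fun x => (V x : ℂ)) {ε : ℝ} (hε : 0 ≤ ε) {J : Set ℝ} (hJ : Convex ℝ J)
    {v : ℝ → Seq} (hv : IsInteractionSol (laplaceSymbol T) (gpField T ζ V ε) J v) {s t : ℝ}
    (hs : s ∈ J) (ht : t ∈ J) (hvs : ‖v s‖ ≤ C) : ‖v t‖ ≤ energyBound T AV C :=
  hv.norm_le hJ (isHamiltonian_gp hT hζ hV hε) (by linarith [hV.nonneg])
    (gpPotential_lower hT hζ hV hε) (fun b => gpPotential_upper hT hζ hV hε b) hs ht hvs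

theorem exists_gp_interactionSol (hT : 0 < T) (hζ : IsProfile ζ)
    (hV : SobolevBound T AV fun x => (V x : ℂ)) {ε : ℝ} (hε : 0 ≤ ε) (b : Seq) :
    ∃ v : ℝ → Seq, v 0 = b ∧
      IsInteractionSol (laplaceSymbol T) (gpField T ζ V ε) (Ici 0) v := by
  have hΦ := gpField_lipschitz hT hζ hV ε
  refine exists_global_interactionSol hΦ fun τ hτ =>
    exists_interactionSol hΦ (le_energyBound (C := ‖b‖) T hV.nonneg) (fun σ v hσ hv0 hv => ?_) τ hτ
  exact hv.norm_le_energyBound hT hζ hV hε (convex_Icc 0 σ) (left_mem_Icc.2 hσ)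
    (right_mem_Icc.2 hσ) (by rw [hv0])

/-- Weak solutions are unique. -/
theorem IsSolutionOn.eq_synthesis (hT : 0 < T) (hζ : IsProfile ζ)
    (hV : SobolevBound T AV fun x => (V x : ℂ)) {ε : ℝ} (hε : 0 ≤ ε) {τ : ℝ} {u₀ : ℝ → ℂ}
    (hu₀ : MemHs T 1 u₀) {u : ℝ → ℝ → ℂ} (hu : IsSolutionOn T 1 V ζ ε (Icc 0 τ) u₀ u)
    {v : ℝ → Seq} (hv : IsInteractionSol (laplaceSymbol T) (gpField T ζ V ε) (Icc 0 τ) v)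
    (hv0 : v 0 = analysis T u₀) {t : ℝ} (ht : t ∈ Icc 0 τ) :
    u t = synthesis T (freeEvol (laplaceSymbol T) t (v t)) := by
  have h0 : (0 : ℝ) ∈ Icc 0 τ := left_mem_Icc.2 (ht.1.trans ht.2)
  have hinit : analysis T (u 0) = analysis T u₀ := lp.ext (funext fun j => by
    rw [(hu.memHs 0 h0).analysis_apply, hu₀.analysis_apply, fourierCoef_congr_ae hu.initial])
  have h := (hu.isInteractionSol hT hζ hV hε (convex_Icc 0 τ)).eqOn
    (gpField_lipschitz hT hζ hV ε) hv (by simp only [neg_zero, freeEvol_zero, hinit, hv0]) ht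
  rw [← h, freeEvol_freeEvol_neg, synthesis_analysis hT (hu.memHs t ht) (hu.continuous_space t ht)]

/-- A bound for the uniform distance on `[0, τ]` of two solutions whose `H_1` norms are at most `R`,
whose initial values have the `L²` distance `δ`, and whose interaction ranges differ by `d`. Here
`m` is the first absolute moment of the profile. -/
def distBound (T AV m R τ δ d : ℝ) : ℝ :=
  (√T)⁻¹ * √(∑' j : ℤ, weight T j ^ (-(3 / 4 : ℝ))) *
    (gronwallBound δ (3 * (sobConst T * R) ^ 2 + AV) (2 * (sobConst T * R) ^ 3 * m * d) τ ^
      (1 / 4 : ℝ) * (2 * R) ^ (3 / 4 : ℝ))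

theorem distBound_zero (T AV m R τ : ℝ) : distBound T AV m R τ 0 0 = 0 := by
  rw [distBound, mul_zero, gronwallBound_ε0_δ0, Real.zero_rpow (by norm_num), zero_mul, mul_zero]

theorem continuous_distBound (T AV m R τ : ℝ) :
    Continuous fun p : ℝ × ℝ => distBound T AV m R τ p.1 p.2 := by
  have h : Continuous fun p : ℝ × ℝ => gronwallBound p.1 (3 * (sobConst T * R) ^ 2 + AV)
      (2 * (sobConst T * R) ^ 3 * m * p.2) τ := by
    unfold gronwallBound
    split_ifs <;> fun_prop
  exact continuous_const.mul ((h.rpow_const fun _ => Or.inr (by norm_num)).mul continuous_const)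

/-- Grönwall controls the `L²` distance, the sum of the two `H_1` bounds gives `2 * R`, and
interpolation combines them. -/
theorem norm_synthesis_sub_le_distBound (hT : 0 < T) (hζ : IsProfile ζ)
    (hV : SobolevBound T AV fun x => (V x : ℂ)) {ε ε' τ R : ℝ} {v v' : ℝ → Seq}
    (hv : IsInteractionSol (laplaceSymbol T) (gpField T ζ V ε) (Icc 0 τ) v)
    (hv' : IsInteractionSol (laplaceSymbol T) (gpField T ζ V ε') (Icc 0 τ) v')
    (hR : ∀ t ∈ Icc 0 τ, ‖v t‖ ≤ R) (hR' : ∀ t ∈ Icc 0 τ, ‖v' t‖ ≤ R) {t : ℝ}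
    (ht : t ∈ Icc 0 τ) (x : ℝ) :
    ‖synthesis T (freeEvol (laplaceSymbol T) t (v t)) x -
        synthesis T (freeEvol (laplaceSymbol T) t (v' t)) x‖ ≤
      distBound T AV (∫ z, |z * ζ z|) R τ ‖halfSmooth (laplaceSymbol_nonneg T) (v 0 - v' 0)‖
        |ε - ε'| := by
  have hAV := hV.nonneg
  have hS := one_le_sobConst T
  have hR0 : 0 ≤ R := (norm_nonneg _).trans (hR t ht)
  have hm : 0 ≤ ∫ z, |z * ζ z| := integral_nonneg fun _ => abs_nonneg _
  have h1 := norm_halfSmooth_sub_le (laplaceSymbol_nonneg T) hv hv' (fun t ht =>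
    norm_halfSmooth_gpField_sub_le hT hζ hV ε ε'
      ((norm_freeEvol _ t _).trans_le (hR t ht)) ((norm_freeEvol _ t _).trans_le (hR' t ht))) t ht
  have h2 := h1.trans (gronwallBound_mono (norm_nonneg _) (by positivity) (by positivity) ht.2)
  have h3 : ‖v t - v' t‖ ≤ 2 * R := (norm_sub_le _ _).trans (by linarith [hR t ht, hR' t ht])
  rw [← synthesis_sub hT, ← map_sub]
  refine (norm_synthesis_le_interp hT _ x).trans ?_
  have h4 := Real.rpow_nonneg ((norm_nonneg _).trans h2) (1 / 4)
  rw [norm_halfSmooth_freeEvol, norm_freeEvol, distBound]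
  gcongr

end GlobalFlow

end GP

end

/-! ### The main theorem. -/

theorem theorem1
    (T : ℝ) (hT : 0 < T)
    (V : ℝ → ℝ) (hV : ContDiff ℝ ∞ V) (hVT : Function.Periodic V T)
    (ζ : ℝ → ℝ) (hζ_nonneg : ∀ x, 0 ≤ ζ x) (hζ_even : ∀ x, ζ (-x) = ζ x)
    (hζ_int : Integrable ζ volume) (hζ_mass : ∫ x, ζ x = 1)
    (hζ_moment : Integrable (fun x => x * ζ x) volume)
    (hζ_decay : ∃ M : ℝ, ∃ δ : ℝ, 0 < δ ∧
      ∀ ξ : ℝ, ‖GP.fourierTransform ζ ξ‖ ≤ M * (1 + |ξ|) ^ (-(1 / 2 : ℝ) - δ))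
    (C : ℝ) (hC : 0 < C) :
    ∃ C_u : ℝ, 0 < C_u ∧
      ∀ ψ₀ : ℝ → ℝ → ℂ,
        (∀ ε : ℝ, 0 ≤ ε → GP.MemHs T 1 (ψ₀ ε)) →
        (∀ ε : ℝ, 0 ≤ ε → GP.hsNorm T 1 (ψ₀ ε) ≤ C) →
        Tendsto (fun ε => GP.hsNorm T 1 (ψ₀ ε - ψ₀ 0)) (𝓝[>] 0) (𝓝 0) →
        ∃ ψ : ℝ → ℝ → ℝ → ℂ,
          -- global existence, uniqueness and a uniform bound for every `ε ≥ 0`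
          (∀ ε : ℝ, 0 ≤ ε →
            GP.IsSolutionOn T 1 V ζ ε (Ici 0) (ψ₀ ε) (ψ ε) ∧
            (∀ τ : ℝ, 0 < τ → ∀ v : ℝ → ℝ → ℂ,
              GP.IsSolutionOn T 1 V ζ ε (Icc 0 τ) (ψ₀ ε) v → ∀ t ∈ Icc 0 τ, v t = ψ ε t) ∧
            ∀ t : ℝ, 0 ≤ t → GP.hsNorm T 1 (ψ ε t) ≤ C_u) ∧
          -- the bound for the difference of the nonlocal and the local solution
          (∃ ρ : ℝ → ℝ → ℝ → ℝ,
            (∀ τ : ℝ, 0 < τ → ∀ ε' : ℝ, 0 ≤ ε' →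
              Tendsto (fun ε => ρ τ ε ε') (𝓝[Ici 0] ε') (𝓝 0)) ∧
            ∀ τ : ℝ, 0 < τ → ∀ ε : ℝ, 0 ≤ ε → ∀ t ∈ Icc 0 τ, ∀ x : ℝ,
              ‖ψ ε t x - ψ 0 t x‖ ≤
                (GP.hsNorm T 1 (ψ₀ ε - ψ₀ 0) + 3 * C_u * τ * ρ τ ε 0)
                  * Real.exp (3 * C_u ^ 2 * τ)) ∧
          -- uniform convergence on every finite time interval
          ∀ τ : ℝ, 0 < τ →
            TendstoUniformlyOn (fun (ε : ℝ) (p : ℝ × ℝ) => ψ ε p.1 p.2)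
              (fun p => ψ 0 p.1 p.2) (𝓝[>] 0) (Icc 0 τ ×ˢ univ) := by
  have hζ : GP.IsProfile ζ := ⟨hζ_nonneg, hζ_even, hζ_int, hζ_mass, hζ_moment⟩
  obtain ⟨AV, hVb⟩ := GP.exists_sobolevBound_of_contDiff hT
    (Complex.ofRealCLM.contDiff.comp hV : ContDiff ℝ ∞ fun x => (V x : ℂ))
    (fun x => congrArg Complex.ofReal (hVT x))
  have hAV := hVb.nonneg
  have hC_u : 0 < GP.energyBound T AV C := hC.trans_le (GP.le_energyBound T hAV)
  -- This constant depends only on the period, the bound for `V` and `C`, hence serves all `ε` and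
  -- all families of initial values.
  refine ⟨GP.energyBound T AV C, hC_u, fun ψ₀ hmem hle hconv => ?_⟩
  generalize hR : GP.energyBound T AV C = R at hC_u ⊢
  have hex : ∀ ε : ℝ, ∃ v : ℝ → GP.Seq, 0 ≤ ε → v 0 = GP.analysis T (ψ₀ ε) ∧
      GP.IsInteractionSol (GP.laplaceSymbol T) (GP.gpField T ζ V ε) (Ici 0) v := fun ε => by
    by_cases hε : 0 ≤ ε
    · obtain ⟨v, hv⟩ := GP.exists_gp_interactionSol hT hζ hVb hε (GP.analysis T (ψ₀ ε))
      exact ⟨v, fun _ => hv⟩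
    · exact ⟨0, fun h => absurd h hε⟩
  choose v hv using hex
  have hbound : ∀ ε : ℝ, 0 ≤ ε → ∀ t : ℝ, 0 ≤ t → ‖v ε t‖ ≤ R := fun ε hε t ht => by
    rw [← hR]
    refine (hv ε hε).2.norm_le_energyBound hT hζ hVb hε (convex_Ici 0) self_mem_Ici ht ?_
    rw [(hv ε hε).1, (hmem ε hε).norm_analysis]
    exact hle ε hε
  set δ : ℝ → ℝ := fun ε => ‖GP.halfSmooth (GP.laplaceSymbol_nonneg T)
    (GP.analysis T (ψ₀ ε) - GP.analysis T (ψ₀ 0))‖ with hδ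
  have hδ0 : δ 0 = 0 := by simp only [hδ, sub_self, map_zero, norm_zero]
  have hδ_tendsto : Tendsto δ (𝓝[Ici 0] 0) (𝓝 0) := by
    -- The hypothesis concerns `ε > 0` only; the point `ε = 0` is added by hand, where `δ` vanishes.
    rw [← Ioi_insert, nhdsWithin_insert, tendsto_sup]
    have h0 : Tendsto δ (pure 0) (𝓝 0) := by
      simpa only [hδ0] using tendsto_pure_nhds δ 0
    refine ⟨h0, squeeze_zero' (Eventually.of_forall fun _ => norm_nonneg _)
      ?_ hconv⟩
    filter_upwards [self_mem_nhdsWithin] with ε hε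
    have h := (hmem ε (le_of_lt hε)).analysis_sub hT (hmem 0 le_rfl)
    rw [← h.1.norm_analysis, h.2]
    exact GP.norm_diagOp_le _ _ _
  set m := ∫ z, |z * ζ z|
  -- The initial values converge only as `ε → 0`, so their distance enters only for `ε' = 0`.
  set ρ : ℝ → ℝ → ℝ → ℝ := fun τ ε ε' =>
    GP.distBound T AV m R τ (if ε' = 0 then δ ε else 0) |ε - ε'| / (3 * R * τ) with hρ
  have hρ_tendsto : ∀ τ ε' : ℝ, 0 ≤ ε' → Tendsto (fun ε => ρ τ ε ε') (𝓝[Ici 0] ε') (𝓝 0) := by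
    intro τ ε' hε'
    have h1 : Tendsto (fun ε => if ε' = 0 then δ ε else 0) (𝓝[Ici 0] ε') (𝓝 0) := by
      split_ifs with h
      · rwa [h]
      · exact tendsto_const_nhds
    have h2 : Tendsto (fun ε => |ε - ε'|) (𝓝[Ici 0] ε') (𝓝 0) := by
      refine tendsto_nhdsWithin_of_tendsto_nhds ?_
      exact Continuous.tendsto' (by fun_prop) _ _ (by simp)
    have h3 := ((GP.continuous_distBound T AV m R τ).tendsto' (0, 0) 0
      (GP.distBound_zero T AV m R τ)).comp (h1.prodMk_nhds h2)
    have h4 := h3.div_const (3 * R * τ)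
    rwa [zero_div] at h4
  have hdiff : ∀ τ : ℝ, 0 < τ → ∀ ε : ℝ, 0 ≤ ε → ∀ t ∈ Icc 0 τ, ∀ x : ℝ,
      ‖GP.synthesis T (GP.freeEvol (GP.laplaceSymbol T) t (v ε t)) x -
        GP.synthesis T (GP.freeEvol (GP.laplaceSymbol T) t (v 0 t)) x‖ ≤
      3 * R * τ * ρ τ ε 0 := fun τ hτ ε hε t ht x => by
    have h := GP.norm_synthesis_sub_le_distBound hT hζ hVb
      ((hv ε hε).2.mono Icc_subset_Ici_self) ((hv 0 le_rfl).2.mono Icc_subset_Ici_self)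
      (fun s hs => hbound ε hε s hs.1) (fun s hs => hbound 0 le_rfl s hs.1) ht x
    rw [(hv ε hε).1, (hv 0 le_rfl).1] at h
    -- For `τ > 0` the division in `ρ` is undone, so the term with `ρ` is the full estimate of the
    -- uniform distance.
    have hρ0 : 3 * R * τ * ρ τ ε 0 = GP.distBound T AV m R τ (δ ε) |ε - 0| := by
      simp only [hρ, if_true]
      exact mul_div_cancel₀ _ (by positivity)
    rw [hρ0]
    exact h
  refine ⟨fun ε t => GP.synthesis T (GP.freeEvol (GP.laplaceSymbol T) t (v ε t)),
    fun ε hε => ⟨?_, ?_, ?_⟩, ⟨ρ, fun τ _ => hρ_tendsto τ, ?_⟩, ?_⟩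
  · refine (hv ε hε).2.isSolutionOn hT hζ hVb hε (convex_Ici 0) ?_
    rw [(hv ε hε).1]
    exact GP.synthesis_analysis_ae hT (hmem ε hε)
  · exact fun τ _ u hu t ht => hu.eq_synthesis hT hζ hVb hε (hmem ε hε)
      ((hv ε hε).2.mono Icc_subset_Ici_self) (hv ε hε).1 ht
  · intro t ht
    rw [← (GP.memHs_synthesis hT _).norm_analysis, GP.analysis_synthesis hT, GP.norm_freeEvol]
    exact hbound ε hε t ht
  · intro τ hτ ε hε t ht x
    have h0 : 0 ≤ GP.hsNorm T 1 (ψ₀ ε - ψ₀ 0) := Real.sqrt_nonneg _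
    have h1 := hdiff τ hτ ε hε t ht x
    have h2 := (norm_nonneg _).trans h1
    -- The term with `ρ` already dominates; adding the nonnegative initial distance and multiplying
    -- by an exponential at least 1 only enlarge it.
    refine h1.trans ((le_add_of_nonneg_left h0).trans ?_)
    exact le_mul_of_one_le_right (add_nonneg h0 h2) (Real.one_le_exp (by positivity))
  · intro τ hτ
    rw [Metric.tendstoUniformlyOn_iff]
    intro η hη
    have h1 := ((hρ_tendsto τ 0 le_rfl).mono_left
      (nhdsWithin_mono 0 Ioi_subset_Ici_self)).const_mul (3 * R * τ)
    rw [mul_zero] at h1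
    filter_upwards [h1.eventually_lt_const hη, self_mem_nhdsWithin] with ε h hε p hp
    rw [dist_comm, dist_eq_norm]
    exact (hdiff τ hτ ε (le_of_lt hε) p.1 hp.1 p.2).trans_lt h
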